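/- Fix $n\ge 4$ and put $v=n(n-3)/2$. Let the dimensions $(p,q)$ vary along an index (for instance along all pairs of positive integers, or along a sequence of pairs) with $p\wedge q\to\infty$. For each $(p,q)$ let $X=(x_1,\dots,x_p)\in\mathbb R^p$, $Y=(y_1,\dots,y_q)\in\mathbb R^q$ be random vectors with a joint law that may depend on $(p,q)$, and let $(X_1,Y_1),\dots,(X_n,Y_n)$ be i.i.d. copies of $(X,Y)$, $X_s=(x_{s1},\dots,x_{sp})$, $Y_s=(y_{s1},\dots,y_{sq})$. Primes denote independent copies and $|\cdot|$ the Euclidean norm. **Statistics.** For an $n\times n$ matrix $A$, the $\mathcal U$-centered matrix $\tilde A$ has zero diagonal and, for $s\neq t$, $\tilde a_{st}=a_{st}-\frac1{n-2}\sum_{v\ne s}a_{sv}-\frac1{n-2}\sum_{u\ne t}a_{ut}+\frac1{(n-1)(n-2)}\sum_{u\neq v}a_{uv}$; put $(\tilde A\cdot\tilde B)=\frac1{n(n-3)}\sum_{s\ne t}\tilde a_{st}\tilde b_{st}$. Then $dCov_n^2(\mathbf X,\mathbf Y)=(\tilde A\cdot\tilde B)$ with $a_{st}=|X_s-X_t|$,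 $b_{st}=|Y_s-Y_t|$; $mdCov_n^2(\mathbf X,\mathbf Y)=\sqrt{\binom n2}\sum_{i=1}^p\sum_{j=1}^q dCov_n^2$ of the $i$-th coordinate sample of $X$ and the $j$-th coordinate sample of $Y$; $hCov_n^2(\mathbf X,\mathbf Y)=(\tilde R\cdot\tilde H)$ with $r_{st}=f(|X_s-X_t|/\gamma_{\mathbf X})$, $h_{st}=g(|Y_s-Y_t|/\gamma_{\mathbf Y})$, where $\gamma_{\mathbf X}$, $\gamma_{\mathbf Y}$ are the medians of the pairwise distances ($s\ne t$) and $f,g$ are continuously differentiable on $[0,\infty)$, twice continuously differentiable near $1$, with $f'(1)g'(1)>0$ (for example the Gaussian kernel $e^{-a^2/2}$ and the Laplacian kernel $e^{-a}$); $f$ is used for $\mathbf X$ and $g$ for $\mathbf Y$, also in $hCov_n^2(\mathbf X,\mathbf X)$ and $hCov_n^2(\mathbf Y,\mathbf Y)$. For $R\in\{dCov,hCov,mdCov\}$ let $$R^*=\frac{R_n^2(\mathbf X,\mathbf Y)}{\sqrt{R_n^2(\mathbf X,\mathbf X)R_n^2(\mathbf Y,\mathbf Y)}},\qquad T_R=\sqrt{v-1}\,\frac{R^*}{\sqrt{1-(R^*)^2}}.$$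 The kernel of $R$ is $k(x,y)=|x-y|^2$ for $dCov$, $hCov$ and $k(x,y)=|x-y|$ for $mdCov$. **Assumptions.** (D1) The variances of all coordinates of $X$ and $Y$ are bounded below by a positive constant, and their second moments are bounded above, uniformly in the coordinates and in $(p,q)$. (D2) With $\tau_X^2=E|X-X'|^2$, $\tau_Y^2=E|Y-Y'|^2$, $\tau=\tau_X\tau_Y$ one has $(|X-X'|^2-\tau_X^2)/\tau_X^2=O_p(a)$ and $(|Y-Y'|^2-\tau_Y^2)/\tau_Y^2=O_p(b)$, where the numbers $a,b$ (depending on $(p,q)$) satisfy $a,\ b,\ \tau_X^2a^3,\ \tau_Y^2b^3,\ \tau a^2b,\ \tau ab^2\to0$. (D3) Let $k_{st}(i)=k(x_{si},x_{ti})-E[k(x_{si},x_{ti})|x_{si}]-E[k(x_{si},x_{ti})|x_{ti}]+E[k(x_{si},x_{ti})]$, and let $l_{st}(j)$ be defined in the same way from $y_{sj},y_{tj}$ with the same kernel $k$. Then $\big(p^{-1/2}\sum_ik_{st}(i),\,q^{-1/2}\sum_jl_{uw}(j)\big)_{s<t,\,u<w}$ converges in distribution to a jointly Gaussian vector $(c_{st},d_{uw})_{s<t,\,u<w}$,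 and for all $s<t$ the limits $\sigma_x^2=\lim\frac1p\sum_{i,j}\mathrm{cov}[k_{st}(i),k_{st}(j)]$, $\sigma_y^2=\lim\frac1q\sum_{i,j}\mathrm{cov}[l_{st}(i),l_{st}(j)]$, $\sigma_{xy}^2=\lim\frac1{\sqrt{pq}}\sum_{i,j}\mathrm{cov}[k_{st}(i),l_{st}(j)]$ exist and equal $\mathrm{var}[c_{st}]$, $\mathrm{var}[d_{st}]$, $\mathrm{cov}[c_{st},d_{st}]$. Moreover $\sigma_x^2,\sigma_y^2>0$. **Claim.** Let $R\in\{dCov,hCov,mdCov\}$, assume (D1), (D2), and (D3) for the kernel of $R$, and put $\phi=\sigma_{xy}^2/\sqrt{\sigma_x^2\sigma_y^2}$. 1. For $R\in\{dCov,hCov\}$, $$\phi=\phi_2:=\lim\frac{\sum_{i,j}\mathrm{cov}^2(x_i,y_j)}{\sqrt{\sum_{i,j}\mathrm{cov}^2(x_i,x_j)\sum_{i,j}\mathrm{cov}^2(y_i,y_j)}},$$ and for $R=mdCov$, $\phi=\phi_1$, the limit of the same ratio with each $\mathrm{cov}^2(\xi,\eta)$ replaced by $dCov^2(\xi,\eta)=E|\xi-\xi'||\eta-\eta'|+E|\xi-\xi'|E|\eta-\eta'|-2E|\xi-\xi'||\eta-\eta''|$.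 2. If $X$ and $Y$ are independent (for all $(p,q)$), then $P(T_R\le t)\to P(t_{v-1}\le t)$ for every $t\in\mathbb R$. 3. Without the assumption of independence, in particular under the alternative that $X$ and $Y$ are dependent, if $\phi<1$, then $P(T_R\le t)\to E[P(t_{v-1,W}\le t)]$ for every $t\in\mathbb R$, where $W\sim\sqrt{\frac{\phi^2}{1-\phi^2}\chi_v^2}$ and $t_{a,b}$ is the noncentral $t$-distribution with $a$ degrees of freedom and noncentrality parameter $b$. 4. If $\mathrm{cov}(x_i,y_j)=0$ for all $i,j$ and all $(p,q)$, no matter how $x_i$ and $y_j$ depend on each other, then for $R\in\{dCov,hCov\}$ and every $\alpha\in(0,1)$, $P(T_R>t_{v-1}^{(\alpha)})\to\alpha$, where $t_{v-1}^{(\alpha)}$ is the $(1-\alpha)$-quantile of $t_{v-1}$: these tests have trivial power. -/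

import Mathlib

open MeasureTheory ProbabilityTheory Filter Topology Set

noncomputable section

namespace HighDimDependence

/-- `ℝ^d` with the Euclidean norm. -/
abbrev Vec (d : ℕ) : Type := EuclideanSpace ℝ (Fin d)

/-! ### Reference distributions -/

/-- The chi-square distribution with `k` degrees of freedom: the law of the sum of the squares of
`k` independent standard normal variables. -/
def chiSquared (k : ℕ) : Measure ℝ :=
  (Measure.pi fun _ : Fin k => gaussianReal 0 1).map fun z => ∑ i, z i ^ 2

/-- The noncentral t-distribution with `a` degrees of freedom and noncentrality `b`: the law of
`(Z + b) / √(χ / a)` for independent `Z ∼ N(0, 1)` and `χ ∼ χ²_a`. -/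
def noncentralT (a : ℕ) (b : ℝ) : Measure ℝ :=
  ((gaussianReal 0 1).prod (chiSquared a)).map fun z => (z.1 + b) / √(z.2 / a)

/-- Student's t-distribution with `a` degrees of freedom. -/
def studentT (a : ℕ) : Measure ℝ := noncentralT a 0

/-- The `(1 - α)`-quantile of Student's t-distribution with `a` degrees of freedom. -/
def tQuantile (a : ℕ) (α : ℝ) : ℝ := sInf {x | 1 - α ≤ (studentT a).real (Iic x)}

/-- The distribution function at `t` of the mixed noncentral t-distribution, that is
`E[P(t_{v-1, W} ≤ t)]` with `W = √(φ² / (1 - φ²) χ²_v)`. -/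
def mixedNoncentralTCdf (v : ℕ) (φ t : ℝ) : ℝ :=
  ∫ w, (noncentralT (v - 1) (√(φ ^ 2 / (1 - φ ^ 2) * w))).real (Iic t) ∂(chiSquared v)

/-! ### Sample statistics -/

/-- `U`-centering. The diagonal of the matrix is disregarded (treated as zero). -/
def uCenter {n : ℕ} (A : Fin n → Fin n → ℝ) (s t : Fin n) : ℝ :=
  if s = t then 0 else
    A s t - (∑ v ∈ Finset.univ.erase s, A s v) / ((n : ℝ) - 2)
      - (∑ u ∈ Finset.univ.erase t, A u t) / ((n : ℝ) - 2)
      + (∑ u, ∑ v ∈ Finset.univ.erase u, A u v) / (((n : ℝ) - 1) * ((n : ℝ) - 2))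

/-- The inner product `(Ã · B̃)` of the `U`-centered versions of two matrices. -/
def uInner {n : ℕ} (A B : Fin n → Fin n → ℝ) : ℝ :=
  1 / ((n : ℝ) * ((n : ℝ) - 3)) *
    ∑ s, ∑ t ∈ Finset.univ.erase s, uCenter A s t * uCenter B s t

/-- The unbiased sample (squared) distance covariance. -/
def dCovSample {n : ℕ} {V W : Type*} [NormedAddCommGroup V] [NormedAddCommGroup W]
    (X : Fin n → V) (Y : Fin n → W) : ℝ :=
  uInner (fun s t => ‖X s - X t‖) (fun s t => ‖Y s - Y t‖)

/-- The marginal sample distance covariance. -/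
def mdCovSample {n p q : ℕ} (X : Fin n → Vec p) (Y : Fin n → Vec q) : ℝ :=
  √(n.choose 2 : ℝ) * ∑ i, ∑ j, dCovSample (fun s => X s i) (fun s => Y s j)

/-- The median of the finite family `(a b)_{b ∈ m}` (the average of the lower and of the upper
median). -/
def median {β : Type*} (m : Finset β) (a : β → ℝ) : ℝ :=
  (sInf {x | m.card ≤ 2 * (m.filter fun b => a b ≤ x).card} +
    sSup {x | m.card ≤ 2 * (m.filter fun b => x ≤ a b).card}) / 2

/-- The bandwidth: the median of the pairwise distances `|X_s - X_t|`, `s ≠ t`. -/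
def bandwidth {n d : ℕ} (X : Fin n → Vec d) : ℝ :=
  median (Finset.univ : Finset (Fin n)).offDiag fun st => ‖X st.1 - X st.2‖

/-- The sample (squared) Hilbert-Schmidt covariance with the kernels `f (|x - x'| / γ)`,
`g (|y - y'| / γ')` and median bandwidths. -/
def hCovSample {n p q : ℕ} (f g : ℝ → ℝ) (X : Fin n → Vec p) (Y : Fin n → Vec q) : ℝ :=
  uInner (fun s t => f (‖X s - X t‖ / bandwidth X)) (fun s t => g (‖Y s - Y t‖ / bandwidth Y))

/-- The three statistics. -/
inductive Stat
  | dCov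
  | hCov
  | mdCov

/-- The sample statistic `R_n²(X, Y)`; `f`, `g` are only used by `hCov`. -/
def Stat.sample (R : Stat) (f g : ℝ → ℝ) {n p q : ℕ} (X : Fin n → Vec p) (Y : Fin n → Vec q) : ℝ :=
  match R with
  | .dCov => dCovSample X Y
  | .hCov => hCovSample f g X Y
  | .mdCov => mdCovSample X Y

/-- `v = n (n - 3) / 2`. -/
def dof (n : ℕ) : ℕ := n * (n - 3) / 2

/-- The normalized statistic `R^*`. -/
def Stat.normalized (R : Stat) (f g : ℝ → ℝ) {n p q : ℕ}
    (X : Fin n → Vec p) (Y : Fin n → Vec q) : ℝ :=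
  R.sample f g X Y / √(R.sample f f X X * R.sample g g Y Y)

/-- The studentized test statistic `T_R`. -/
def Stat.studentized (R : Stat) (f g : ℝ → ℝ) {n p q : ℕ}
    (X : Fin n → Vec p) (Y : Fin n → Vec q) : ℝ :=
  √((dof n : ℝ) - 1) * (R.normalized f g X Y / √(1 - R.normalized f g X Y ^ 2))

/-- The univariate kernel `k = l` that belongs to a statistic. -/
def Stat.kernel (R : Stat) (x y : ℝ) : ℝ :=
  match R with
  | .dCov => |x - y| ^ 2
  | .hCov => |x - y| ^ 2
  | .mdCov => |x - y|

/-! ### Population quantities -/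

/-- The population (squared) distance covariance of two real random variables `U`, `V` on `(S, μ)`:
`E|U-U'||V-V'| + E|U-U'| E|V-V'| - 2 E|U-U'||V-V''|`. -/
def dCovSq {S : Type*} [MeasurableSpace S] (μ : Measure S) (U V : S → ℝ) : ℝ :=
  ∫ z, |U z.1 - U z.2| * |V z.1 - V z.2| ∂(μ.prod μ)
    + (∫ z, |U z.1 - U z.2| ∂(μ.prod μ)) * (∫ z, |V z.1 - V z.2| ∂(μ.prod μ))
    - 2 * ∫ z, |U z.1.1 - U z.1.2| * |V z.1.1 - V z.2| ∂((μ.prod μ).prod μ)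

/-- The component-wise measure of dependence that belongs to a statistic: the squared covariance
for `dCov` and `hCov`, the distance covariance for `mdCov`. -/
def Stat.depend (R : Stat) {S : Type*} [MeasurableSpace S] (μ : Measure S) (U V : S → ℝ) : ℝ :=
  match R with
  | .dCov => cov[U, V; μ] ^ 2
  | .hCov => cov[U, V; μ] ^ 2
  | .mdCov => dCovSq μ U V

/-- The ratio whose limit is the parameter `φ` (`φ₂` for `dCov` and `hCov`, `φ₁` for `mdCov`);
`P` is the joint law of `(X, Y)`. -/
def Stat.phiRatio (R : Stat) {p q : ℕ} (P : Measure (Vec p × Vec q)) : ℝ :=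
  (∑ i, ∑ j, R.depend P (fun z => z.1 i) (fun z => z.2 j)) /
    √((∑ i, ∑ j, R.depend P (fun z => z.1 i) (fun z => z.1 j)) *
      (∑ i, ∑ j, R.depend P (fun z => z.2 i) (fun z => z.2 j)))

/-- `τ² = E|X - X'|²` for `X ∼ Q`, with `X'` an independent copy of `X`. -/
def tauSq {d : ℕ} (Q : Measure (Vec d)) : ℝ := ∫ z, ‖z.1 - z.2‖ ^ 2 ∂(Q.prod Q)

/-- `L(x, x') = (|x - x'|² - τ²) / τ²`. -/
def relDev {d : ℕ} (Q : Measure (Vec d)) (z : Vec d × Vec d) : ℝ :=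
  (‖z.1 - z.2‖ ^ 2 - tauSq Q) / tauSq Q

/-- The double centered kernel
`k(x, y) - E[k(ξ, ξ') | ξ = x] - E[k(ξ, ξ') | ξ' = y] + E[k(ξ, ξ')]` with `ξ, ξ'` i.i.d. of
law `ν`. -/
def doubleCentered (k : ℝ → ℝ → ℝ) (ν : Measure ℝ) (x y : ℝ) : ℝ :=
  k x y - ∫ y', k x y' ∂ν - ∫ x', k x' y ∂ν + ∫ x', ∫ y', k x' y' ∂ν ∂ν

/-- `k_{st}(i)` as a function of the two observations `x = X_s`, `x' = X_t`, for `X ∼ Q`. -/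
def centeredCoord (k : ℝ → ℝ → ℝ) {d : ℕ} (Q : Measure (Vec d)) (i : Fin d) (x x' : Vec d) : ℝ :=
  doubleCentered k (Q.map fun w => w i) (x i) (x' i)

/-- `d^{-1/2} ∑ i, k_{st}(i)`. -/
def centeredSum (k : ℝ → ℝ → ℝ) {d : ℕ} (Q : Measure (Vec d)) (x x' : Vec d) : ℝ :=
  (√(d : ℝ))⁻¹ * ∑ i, centeredCoord k Q i x x'

/-- The index set of the pairs `s < t`. -/
abbrev Pairs (n : ℕ) : Type := {st : Fin n × Fin n // st.1 < st.2}

/-! ### Assumptions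

The dimensions `p i`, `q i`, the law `P i` of `(X, Y)` and the samples are indexed by `i : ι`, and
limits are taken along a filter `l` on `ι`. -/

/-- `Z i = O_p(a i)` along `l`. -/
def IsBigOInProb {ι : Type*} (l : Filter ι) {S : ι → Type*} [∀ i, MeasurableSpace (S i)]
    (μ : ∀ i, Measure (S i)) (Z : ∀ i, S i → ℝ) (a : ι → ℝ) : Prop :=
  ∀ ε > (0 : ℝ), ∃ M : ℝ, ∀ᶠ i in l, (μ i).real {z | M * |a i| < |Z i z|} ≤ ε

/-- The variances and second moments of all coordinates are bounded below and above, uniformly in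
the coordinates and in the dimensions. -/
def MomentBounds {ι : Type*} {p q : ι → ℕ} (P : ∀ i, Measure (Vec (p i) × Vec (q i))) : Prop :=
  (∃ a b : ℝ, 0 < a ∧ ∀ (i : ι) (j : Fin (p i)), MemLp (fun z => z.1 j) 2 (P i) ∧
    a ≤ Var[fun z => z.1 j; P i] ∧ ∫ z, (z.1 j) ^ 2 ∂(P i) ≤ b) ∧
  (∃ a b : ℝ, 0 < a ∧ ∀ (i : ι) (j : Fin (q i)), MemLp (fun z => z.2 j) 2 (P i) ∧
    a ≤ Var[fun z => z.2 j; P i] ∧ ∫ z, (z.2 j) ^ 2 ∂(P i) ≤ b)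

/-- `L_X(X, X') = O_p(a)` and `L_Y(Y, Y') = O_p(b)` with `a = o(1)`, `b = o(1)`,
`τ_X² a³ = o(1)`, `τ_Y² b³ = o(1)`, `τ a² b = o(1)`, `τ a b² = o(1)`, where `τ = τ_X τ_Y`. -/
def DistanceConcentration {ι : Type*} (l : Filter ι) {p q : ι → ℕ}
    (P : ∀ i, Measure (Vec (p i) × Vec (q i))) : Prop :=
  ∃ a b : ι → ℝ,
    IsBigOInProb l (fun i => (P i).fst.prod (P i).fst) (fun i => relDev (P i).fst) a ∧
    IsBigOInProb l (fun i => (P i).snd.prod (P i).snd) (fun i => relDev (P i).snd) b ∧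
    Tendsto a l (𝓝 0) ∧ Tendsto b l (𝓝 0) ∧
    Tendsto (fun i => tauSq (P i).fst * a i ^ 3) l (𝓝 0) ∧
    Tendsto (fun i => tauSq (P i).snd * b i ^ 3) l (𝓝 0) ∧
    Tendsto (fun i => √(tauSq (P i).fst * tauSq (P i).snd) * (a i ^ 2 * b i)) l (𝓝 0) ∧
    Tendsto (fun i => √(tauSq (P i).fst * tauSq (P i).snd) * (a i * b i ^ 2)) l (𝓝 0)

/-- The central limit theorem for the double centered kernel distances, jointly over all pairs of
observations: the limit is Gaussian, and the variances of its entries `c_{st}`, `d_{st}` and the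
covariance of `c_{st}` and `d_{st}` are the limits `σx2`, `σy2`, `σxy2` of the corresponding
normalized covariances. Nothing is assumed on the other covariances of the limit. -/
structure JointCLT {ι : Type*} (l : Filter ι) (k : ℝ → ℝ → ℝ) {n : ℕ} {p q : ι → ℕ}
    (P : ∀ i, Measure (Vec (p i) × Vec (q i)))
    {Ω : ι → Type*} [∀ i, MeasurableSpace (Ω i)] (Pr : ∀ i, Measure (Ω i))
    [∀ i, IsProbabilityMeasure (Pr i)]
    (X : ∀ i, Fin n → Ω i → Vec (p i)) (Y : ∀ i, Fin n → Ω i → Vec (q i))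
    (σx2 σy2 σxy2 : ℝ) : Prop where
  clt : ∃ (G : Measure ((Pairs n → ℝ) × (Pairs n → ℝ))) (_ : IsGaussian G),
    (∀ st, Var[fun z => z.1 st; G] = σx2) ∧
    (∀ st, Var[fun z => z.2 st; G] = σy2) ∧
    (∀ st, cov[fun z => z.1 st, fun z => z.2 st; G] = σxy2) ∧
    TendstoInDistribution
      (fun i ω =>
        ((fun st => centeredSum k (P i).fst (X i st.1.1 ω) (X i st.1.2 ω),
          fun uv => centeredSum k (P i).snd (Y i uv.1.1 ω) (Y i uv.1.2 ω)) :
          (Pairs n → ℝ) × (Pairs n → ℝ)))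
      l id Pr G
  tendsto_x : ∀ st : Pairs n, Tendsto (fun i => (1 / (p i : ℝ)) * ∑ a, ∑ b,
      cov[fun ω => centeredCoord k (P i).fst a (X i st.1.1 ω) (X i st.1.2 ω),
        fun ω => centeredCoord k (P i).fst b (X i st.1.1 ω) (X i st.1.2 ω); Pr i]) l (𝓝 σx2)
  tendsto_y : ∀ st : Pairs n, Tendsto (fun i => (1 / (q i : ℝ)) * ∑ a, ∑ b,
      cov[fun ω => centeredCoord k (P i).snd a (Y i st.1.1 ω) (Y i st.1.2 ω),
        fun ω => centeredCoord k (P i).snd b (Y i st.1.1 ω) (Y i st.1.2 ω); Pr i]) l (𝓝 σy2)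
  tendsto_xy : ∀ st : Pairs n, Tendsto (fun i => (1 / √((p i : ℝ) * (q i : ℝ))) * ∑ a, ∑ b,
      cov[fun ω => centeredCoord k (P i).fst a (X i st.1.1 ω) (X i st.1.2 ω),
        fun ω => centeredCoord k (P i).snd b (Y i st.1.1 ω) (Y i st.1.2 ω); Pr i]) l (𝓝 σxy2)

/-- A radial profile of a kernel: continuously differentiable on `[0, ∞)` and twice continuously
differentiable near `1`. -/
def IsKernelProfile (f : ℝ → ℝ) : Prop :=
  ContDiffOn ℝ 1 f (Ici 0) ∧ ContDiffAt ℝ 2 f 1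

end HighDimDependence

end

open HighDimDependence

open HighDimDependence

/-! The proof reduces `T_R` to the studentized correlation of two Gaussian vectors in `ℝ^v`, for
which the noncentral t-law is exact.

Algebra. Seen through the entries above the diagonal, `U`-centering is the orthogonal projection of
the symmetric matrices onto those with vanishing row sums, a space of dimension `n(n-1)/2 - n = v`
(`exists_orthonormal_uInner`). It kills every matrix `h s + h t`, and `T_R` does not change when the
two matrices are multiplied by constants with positive product.

Expansion. By (D2) all pairwise distances are close to `τ`. A Taylor expansion turns the distance
matrix into a constant times the normalized double centered sums, plus terms `h s + h t`, plus an
error which is small because `τ² = O(d)` and `τ² a³ → 0` (`exists_expansion`,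
`tendsto_tauSq_mul_sq`). For `mdCov` the identity is exact. Hence `T_R` is `pairStat` of a small
perturbation of the vector in (D3), and a portmanteau argument passes to the limit
(`tendsto_measureReal_of_perturbation`).

Limit law. (D3) prescribes only the variances and the covariance of `c_st` with `d_st`. Fatou's
lemma forces the limit to be centered, and the convergence of second moments transfers to it that
degenerate kernels of different pairs are uncorrelated (`JointCLT.exists_gaussian`). All covariance
blocks are thus multiples of the identity, and in the `v` orthonormal coordinates the limit is, up
to scale, `(U, φ U + √(1 - φ²) Z)` with independent standard Gaussian `U`, `Z`. Rotating `Z` so that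
its first axis points along `U` gives, given `U`, a noncentral t-variable with noncentrality `φ |U|
/ √(1 - φ²)`; here `|U|²` is chi-square with `v` degrees of freedom (`map_vecStat`).

Parameter. Mixed second moments of double centered kernels are `4 cov²` for the squared distance and
`dCov²` for the absolute distance, so the ratio in claim 1 tends to `φ`. As `dCov²` is an integral
of squares, `φ ≥ 0`; under independence, or without correlation for `dCov` and `hCov`, `φ = 0` and
the mixture collapses to Student's law. -/

namespace HighDimDependence

/-! ### Reference distributions -/

/-- The standard Gaussian measure on `ℝ^k`. -/
noncomputable abbrev gaussPi (k : ℕ) : Measure (Fin k → ℝ) := Measure.pi fun _ => gaussianReal 0 1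

instance isProbabilityMeasure_chiSquared (k : ℕ) : IsProbabilityMeasure (chiSquared k) :=
  Measure.isProbabilityMeasure_map
    (Measurable.aemeasurable (by fun_prop))

lemma measurable_noncentralT_fun (a : ℕ) :
    Measurable fun x : ℝ × ℝ × ℝ => (x.2.1 + x.1) / √(x.2.2 / a) := by fun_prop

instance isProbabilityMeasure_noncentralT (a : ℕ) (b : ℝ) :
    IsProbabilityMeasure (noncentralT a b) :=
  Measure.isProbabilityMeasure_map (by fun_prop)

lemma noncentralT_apply (a : ℕ) (b : ℝ) {s : Set ℝ} (hs : MeasurableSet s) :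
    noncentralT a b s = ((gaussianReal 0 1).prod (chiSquared a))
      {z | (z.1 + b) / √(z.2 / a) ∈ s} := by
  rw [noncentralT, Measure.map_apply (by fun_prop) hs]; rfl

lemma measurable_noncentralT_apply (a : ℕ) {s : Set ℝ} (hs : MeasurableSet s) :
    Measurable fun b => noncentralT a b s := by
  simp_rw [noncentralT_apply a _ hs]
  exact measurable_measure_prodMk_left (measurable_noncentralT_fun a hs)

lemma noncentralT_eq_map_pi (a : ℕ) (b : ℝ) :
    noncentralT a b = ((gaussianReal 0 1).prod (gaussPi a)).map
      fun z => (z.1 + b) / √((∑ i, z.2 i ^ 2) / a) := by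
  have h1 : (gaussianReal 0 1).prod (chiSquared a) =
      ((gaussianReal 0 1).prod (gaussPi a)).map
        (Prod.map id fun z : Fin a → ℝ => ∑ i, z i ^ 2) := by
    rw [← Measure.map_prod_map _ _ measurable_id (by fun_prop), Measure.map_id]; rfl
  rw [noncentralT, h1, Measure.map_map (by fun_prop) (by fun_prop)]
  rfl

lemma ae_gaussPi_sum_sq_pos {m : ℕ} (hm : 1 ≤ m) : ∀ᵐ z ∂(gaussPi m), 0 < ∑ i, z i ^ 2 := by
  have h : gaussPi m {0} = 0 := by
    rw [Measure.pi_singleton]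
    exact Finset.prod_eq_zero (Finset.mem_univ ⟨0, hm⟩)
      (haveI := nullSingletonClass_gaussianReal (μ := 0) (v := 1) one_ne_zero; measure_singleton _)
  have : ∀ᵐ z ∂(gaussPi m), z ≠ 0 := by
    rw [ae_iff]; simpa using h
  filter_upwards [this] with z hz
  obtain ⟨i, hi⟩ := Function.ne_iff.1 hz
  exact Finset.sum_pos' (fun i _ => sq_nonneg _) ⟨i, Finset.mem_univ _, by
    have : z i ≠ 0 := hi
    positivity⟩

/-- Given the chi-square part, which is almost surely positive, only one value of the normal
variable produces `t`. The absence of atoms makes all events `T ≤ t` continuity sets of the limit.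
-/
lemma noncentralT_singleton {a : ℕ} (ha : 1 ≤ a) (b t : ℝ) : noncentralT a b {t} = 0 := by
  have hms : MeasurableSet ((fun z : ℝ × (Fin a → ℝ) => (z.1 + b) / √((∑ i, z.2 i ^ 2) / a)) ⁻¹'
      {t}) := (by fun_prop : Measurable _) (measurableSet_singleton t)
  rw [noncentralT_eq_map_pi, Measure.map_apply (by fun_prop) (measurableSet_singleton t),
    Measure.prod_apply_symm hms, lintegral_eq_zero_iff (measurable_measure_prodMk_right hms)]
  filter_upwards [ae_gaussPi_sum_sq_pos ha] with y hy
  have := nullSingletonClass_gaussianReal (μ := 0) (v := 1) one_ne_zero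
  refine measure_mono_null (t := {t * √((∑ i, y i ^ 2) / a) - b}) (fun x hx => ?_)
    (measure_singleton _)
  have hpos : 0 < √((∑ i, y i ^ 2) / a) := Real.sqrt_pos.2 (div_pos hy (by positivity))
  have hx' : (x + b) / √((∑ i, y i ^ 2) / a) = t := hx
  rw [div_eq_iff hpos.ne'] at hx'
  simp only [mem_singleton_iff]; linarith

/-! ### The studentized correlation of Gaussian vectors -/

/-- The studentization of `a / √(b c)` with `m` degrees of freedom. -/
noncomputable def studentizedRatio (m a b c : ℝ) : ℝ := √m * (a / √(b * c) / √(1 - (a / √(b * c)) ^ 2))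

/-- Under the strict Cauchy-Schwarz inequality the nested roots collapse to a single root of the
Gram determinant, a form in which continuity and the conditional law can be read off. -/
lemma studentizedRatio_eq {m a b c : ℝ} (h : a ^ 2 < b * c) :
    studentizedRatio m a b c = √m * (a / √(b * c - a ^ 2)) := by
  have hbc : 0 < b * c := lt_of_le_of_lt (sq_nonneg a) h
  have h1 : 1 - (a / √(b * c)) ^ 2 = (b * c - a ^ 2) / (b * c) := by
    rw [div_pow, Real.sq_sqrt hbc.le, eq_div_iff hbc.ne', sub_mul, div_mul_cancel₀ _ hbc.ne', one_mul]
  rw [studentizedRatio, h1, Real.sqrt_div (by linarith), div_div, mul_div_cancel₀]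
  exact (Real.sqrt_pos.2 hbc).ne'

/-- Only the sign of `r * s` matters, not those of `r` and `s`; this is how the Taylor slopes, the
powers of `τ` and the binomial factor of `mdCov` disappear. -/
lemma studentizedRatio_scale (m a b c : ℝ) {r s : ℝ} (h : 0 < r * s) :
    studentizedRatio m (r * s * a) (r * r * b) (s * s * c) = studentizedRatio m a b c := by
  have : r * s * a / √(r * r * b * (s * s * c)) = a / √(b * c) := by
    rw [show r * r * b * (s * s * c) = (r * s) ^ 2 * (b * c) by ring,
      Real.sqrt_mul (sq_nonneg _), Real.sqrt_sq h.le, mul_div_mul_left _ _ h.ne']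
  rw [studentizedRatio, this, studentizedRatio]

/-- The studentized correlation of two vectors. -/
noncomputable def vecStat {k : ℕ} (m : ℝ) (u w : Fin k → ℝ) : ℝ := studentizedRatio m (u ⬝ᵥ w) (u ⬝ᵥ u) (w ⬝ᵥ w)

lemma measurable_vecStat_comp {α : Type*} [MeasurableSpace α] {k : ℕ} (m : ℝ)
    {f g : α → Fin k → ℝ} (hf : Measurable f) (hg : Measurable g) :
    Measurable fun x => vecStat m (f x) (g x) := by
  unfold vecStat studentizedRatio dotProduct; fun_prop

lemma dotProduct_self_nonneg' {k : ℕ} (u : Fin k → ℝ) : 0 ≤ u ⬝ᵥ u :=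
  Finset.sum_nonneg fun i _ => mul_self_nonneg (u i)

/-- Rotation of a standard Gaussian vector such that the first coordinate points into the
direction of a given vector. -/
lemma exists_measurePreserving_rotation {m : ℕ} {u : Fin (m + 1) → ℝ} (hu : u ≠ 0) :
    ∃ T : ℝ × (Fin m → ℝ) → (Fin (m + 1) → ℝ),
      MeasurePreserving T ((gaussianReal 0 1).prod (gaussPi m)) (gaussPi (m + 1)) ∧
      (∀ x, u ⬝ᵥ T x = √(u ⬝ᵥ u) * x.1) ∧ ∀ x, T x ⬝ᵥ T x = x.1 ^ 2 + ∑ i, x.2 i ^ 2 := by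
  let U : Vec (m + 1) := WithLp.toLp 2 u
  have hU : U ≠ 0 := fun h => hu (congrArg WithLp.ofLp h)
  have hUn0 : ‖U‖ ≠ 0 := norm_ne_zero_iff.2 hU
  have hUn : ‖U‖ = √(u ⬝ᵥ u) := by
    rw [EuclideanSpace.norm_eq]; simp [U, dotProduct, sq]
  -- An orthonormal basis whose vector number `0` is `u / |u|`.
  obtain ⟨b, hb⟩ := Orthonormal.exists_orthonormalBasis_extension_of_card_eq (𝕜 := ℝ) (E := Vec (m + 1))
    (ι := Fin (m + 1)) (by simp) (v := fun _ => ‖U‖⁻¹ • U) (s := {0}) (by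
      refine ⟨fun i => ?_, fun i j hij => (hij (Subsingleton.elim _ _)).elim⟩
      simp [norm_smul, hUn0])
  have hb0 : b 0 = ‖U‖⁻¹ • U := hb 0 rfl
  let e := (MeasurableEquiv.piFinSuccAbove (fun _ : Fin (m + 1) => ℝ) 0)
  have he := (measurePreserving_piFinSuccAbove (fun _ : Fin (m + 1) => gaussianReal 0 1) 0).symm e
  let S : (Fin (m + 1) → ℝ) → Vec (m + 1) := fun x => ∑ i, x i • b i
  have hS : Measurable S := by fun_prop
  -- Rotation invariance: the standard Gaussian measure is the same in every orthonormal basis.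
  have hmp : MeasurePreserving (fun x => WithLp.ofLp (S x)) (gaussPi (m + 1)) (gaussPi (m + 1)) := by
    refine ⟨by fun_prop, ?_⟩
    have h1 := stdGaussian_eq_map_pi_orthonormalBasis b
    have h2 := map_pi_eq_stdGaussian (ι := Fin (m + 1))
    have h3 : (gaussPi (m + 1)).map (fun x => WithLp.ofLp (S x)) =
        ((gaussPi (m + 1)).map S).map WithLp.ofLp := by
      rw [Measure.map_map (by fun_prop) hS]; rfl
    rw [h3, ← h1, ← h2, Measure.map_map (by fun_prop) (by fun_prop)]
    exact Measure.map_id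
  have hin : ∀ x y : Vec (m + 1), inner ℝ x y = x.ofLp ⬝ᵥ y.ofLp := fun x y => by
    rw [EuclideanSpace.inner_eq_star_dotProduct, dotProduct_comm]; rfl
  refine ⟨fun x => WithLp.ofLp (S (e.symm x)), hmp.comp he, fun x => ?_, fun x => ?_⟩
  · have h0 : e.symm x 0 = x.1 := rfl
    have : u ⬝ᵥ WithLp.ofLp (S (e.symm x)) = inner ℝ U (S (e.symm x)) := (hin _ _).symm
    rw [this, ← hUn]
    have hU' : U = ‖U‖ • b 0 := by rw [hb0, smul_smul, mul_inv_cancel₀ hUn0, one_smul]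
    rw [hU', real_inner_smul_left, ← hU']
    simp only [S, inner_sum, real_inner_smul_right]
    rw [Finset.sum_eq_single 0]
    · simp [h0]
    · intro j _ hj; rw [b.inner_eq_zero hj.symm, mul_zero]
    · simp
  · rw [← hin, real_inner_self_eq_norm_sq, ← b.sum_sq_norm_inner_right, Fin.sum_univ_succ]
    have h1 : ∀ i, inner ℝ (b i) (S (e.symm x)) = e.symm x i := fun i => by
      simp only [S, inner_sum, real_inner_smul_right]
      rw [Finset.sum_eq_single i]
      · simp
      · intro j _ hj; rw [b.inner_eq_zero hj.symm, mul_zero]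
      · simp
    simp only [h1, Real.norm_eq_abs, sq_abs]
    rfl

section

variable {m : ℕ} {φ s : ℝ}

/-- Adding a multiple of `u` does not change the Gram determinant with `u`. So the numerator of the
statistic involves only the component `x` of `z` along `u`, and the denominator only the squared
length `r` of the orthogonal part; for Gaussian `z` these are independent. -/
lemma dotProduct_combination_rotation {u z : Fin (m + 1) → ℝ} {x r : ℝ}
    (h1 : u ⬝ᵥ z = √(u ⬝ᵥ u) * x) (h2 : z ⬝ᵥ z = x ^ 2 + r) :
    u ⬝ᵥ (φ • u + s • z) = √(u ⬝ᵥ u) * (φ * √(u ⬝ᵥ u) + s * x) ∧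
    (u ⬝ᵥ u) * ((φ • u + s • z) ⬝ᵥ (φ • u + s • z)) - (u ⬝ᵥ (φ • u + s • z)) ^ 2 =
      (√(u ⬝ᵥ u)) ^ 2 * s ^ 2 * r := by
  have hn : 0 ≤ u ⬝ᵥ u := dotProduct_self_nonneg' u
  have hs := Real.sq_sqrt hn
  set n := √(u ⬝ᵥ u)
  simp only [dotProduct_add, add_dotProduct, smul_dotProduct, dotProduct_smul, smul_eq_mul,
    dotProduct_comm z u, h1, h2, ← hs]
  constructor <;> ring

lemma ae_nondegenerate_vec (hm : 1 ≤ m) (hs : 0 < s) {u : Fin (m + 1) → ℝ} (hu : u ≠ 0) :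
    ∀ᵐ z ∂(gaussPi (m + 1)),
      (u ⬝ᵥ (φ • u + s • z)) ^ 2 < (u ⬝ᵥ u) * ((φ • u + s • z) ⬝ᵥ (φ • u + s • z)) := by
  obtain ⟨T, hT, h1, h2⟩ := exists_measurePreserving_rotation hu
  have hu0 : 0 < u ⬝ᵥ u :=
    lt_of_le_of_ne (dotProduct_self_nonneg' u) fun h => hu (dotProduct_self_eq_zero.1 h.symm)
  rw [← hT.map_eq, ae_map_iff hT.aemeasurable
    (measurableSet_lt (by unfold dotProduct; fun_prop) (by unfold dotProduct; fun_prop))]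
  have := (Measure.quasiMeasurePreserving_snd (μ := gaussianReal 0 1) (ν := gaussPi m)).ae
    (ae_gaussPi_sum_sq_pos hm)
  filter_upwards [this] with x hx
  have := (dotProduct_combination_rotation (φ := φ) (s := s) (h1 x) (h2 x)).2
  have : 0 < (√(u ⬝ᵥ u)) ^ 2 * s ^ 2 * ∑ i, x.2 i ^ 2 := by positivity
  linarith

/-- Conditionally on `u`, the studentized correlation of `u` and `φ u + s z` has a noncentral
`t`-distribution. -/
lemma map_vecStat (hm : 1 ≤ m) (hs : 0 < s) {u : Fin (m + 1) → ℝ} (hu : u ≠ 0) :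
    (gaussPi (m + 1)).map (fun z => vecStat m u (φ • u + s • z)) =
      noncentralT m (φ / s * √(u ⬝ᵥ u)) := by
  obtain ⟨T, hT, h1, h2⟩ := exists_measurePreserving_rotation hu
  have hu0 : 0 < u ⬝ᵥ u :=
    lt_of_le_of_ne (dotProduct_self_nonneg' u) fun h => hu (dotProduct_self_eq_zero.1 h.symm)
  have hme : Measurable fun z : Fin (m + 1) → ℝ => vecStat m u (φ • u + s • z) :=
    measurable_vecStat_comp m measurable_const (by fun_prop)
  rw [noncentralT_eq_map_pi, ← hT.map_eq, Measure.map_map hme hT.measurable]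
  refine Measure.map_congr ?_
  have := (Measure.quasiMeasurePreserving_snd (μ := gaussianReal 0 1) (ν := gaussPi m)).ae
    (ae_gaussPi_sum_sq_pos hm)
  filter_upwards [this] with x hx
  obtain ⟨h3, h4⟩ := dotProduct_combination_rotation (φ := φ) (s := s) (h1 x) (h2 x)
  have hn : 0 < √(u ⬝ᵥ u) := Real.sqrt_pos.2 hu0
  have hpos : 0 < (√(u ⬝ᵥ u)) ^ 2 * s ^ 2 * ∑ i, x.2 i ^ 2 := by positivity
  have hm0 : (0 : ℝ) < m := by exact_mod_cast hm
  simp only [Function.comp, vecStat]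
  rw [studentizedRatio_eq (by linarith), h4, h3, ← mul_pow, Real.sqrt_mul (sq_nonneg _),
    Real.sqrt_sq (by positivity), Real.sqrt_div hx.le]
  have h5 := Real.sqrt_pos.2 hx
  have h6 := Real.sqrt_pos.2 hm0
  field_simp
  ring

lemma ae_gaussPi_ne_zero (k : ℕ) : ∀ᵐ u ∂(gaussPi (k + 1)), u ≠ 0 := by
  filter_upwards [ae_gaussPi_sum_sq_pos (m := k + 1) (by omega)] with u hu h
  simp [h] at hu

lemma measurable_vecStat_combination (φ s : ℝ) :
    Measurable fun z : (Fin (m + 1) → ℝ) × (Fin (m + 1) → ℝ) =>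
      vecStat m z.1 (φ • z.1 + s • z.2) :=
  measurable_vecStat_comp m measurable_fst (by fun_prop)

/-- Fubini: the conditional law given `u` depends on `u` through `|u|²` alone, so integrating over
`u` is integrating over a chi-square variable. -/
lemma gaussPi_prod_vecStat_apply (hm : 1 ≤ m) (hs : 0 < s) {B : Set ℝ} (hB : MeasurableSet B) :
    ((gaussPi (m + 1)).prod (gaussPi (m + 1))) {z | vecStat m z.1 (φ • z.1 + s • z.2) ∈ B} =
      ∫⁻ w, noncentralT m (φ / s * √w) B ∂(chiSquared (m + 1)) := by
  have hms := measurable_vecStat_combination (m := m) φ s hB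
  have h0 := Measure.prod_apply (μ := gaussPi (m + 1)) (ν := gaussPi (m + 1)) hms
  refine h0.trans ?_
  rw [chiSquared, lintegral_map]
  · refine lintegral_congr_ae ?_
    filter_upwards [ae_gaussPi_ne_zero m] with u hu
    have : ∑ i, u i ^ 2 = u ⬝ᵥ u := by simp [dotProduct, sq]
    rw [this, ← map_vecStat hm hs hu, Measure.map_apply _ hB]
    · rfl
    · exact measurable_vecStat_comp m measurable_const (by fun_prop)
  · exact (measurable_noncentralT_apply m hB).comp (by fun_prop)
  · fun_prop

lemma gaussPi_prod_vecStat_eq_null (hm : 1 ≤ m) (hs : 0 < s) (t : ℝ) :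
    ((gaussPi (m + 1)).prod (gaussPi (m + 1))) {z | vecStat m z.1 (φ • z.1 + s • z.2) = t} = 0 := by
  have := gaussPi_prod_vecStat_apply (φ := φ) hm hs (measurableSet_singleton t)
  simpa [noncentralT_singleton hm] using this

lemma gaussPi_prod_vecStat_le (hm : 1 ≤ m) (hφ0 : 0 ≤ φ) (hφ1 : φ < 1) (t : ℝ) :
    ((gaussPi (m + 1)).prod (gaussPi (m + 1))).real
      {z | vecStat m z.1 (φ • z.1 + √(1 - φ ^ 2) • z.2) ≤ t} =
      mixedNoncentralTCdf (m + 1) φ t := by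
  have hs : 0 < √(1 - φ ^ 2) := Real.sqrt_pos.2 (by nlinarith)
  have := gaussPi_prod_vecStat_apply (φ := φ) hm hs (measurableSet_Iic (a := t))
  rw [Measure.real, mixedNoncentralTCdf, Nat.add_sub_cancel]
  refine (congrArg _ this).trans ?_
  have hme : Measurable fun w : ℝ => noncentralT m (φ / √(1 - φ ^ 2) * √w) (Iic t) :=
    (measurable_noncentralT_apply m measurableSet_Iic).comp (by fun_prop)
  rw [← integral_toReal hme.aemeasurable (ae_of_all _ fun w => measure_lt_top _ _)]
  congr 1
  ext w
  -- Here `0 ≤ φ` is essential: the mixing variable is a nonnegative root and does not see the sign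
  -- of `φ`.
  have h : √(φ ^ 2 / (1 - φ ^ 2) * w) = φ / √(1 - φ ^ 2) * √w := by
    rw [Real.sqrt_mul (div_nonneg (sq_nonneg _) (by nlinarith)), Real.sqrt_div (sq_nonneg _),
      Real.sqrt_sq hφ0]
  rw [h]; rfl

lemma ae_gaussPi_prod_nondegenerate (hm : 1 ≤ m) (hs : 0 < s) :
    ∀ᵐ z ∂((gaussPi (m + 1)).prod (gaussPi (m + 1))),
      (z.1 ⬝ᵥ (φ • z.1 + s • z.2)) ^ 2 <
        (z.1 ⬝ᵥ z.1) * ((φ • z.1 + s • z.2) ⬝ᵥ (φ • z.1 + s • z.2)) := by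
  rw [Measure.ae_prod_iff_ae_ae
    (measurableSet_lt (by unfold dotProduct; fun_prop) (by unfold dotProduct; fun_prop))]
  filter_upwards [ae_gaussPi_ne_zero m] with u hu
  exact ae_nondegenerate_vec hm hs hu

end

lemma mixedNoncentralTCdf_zero (v : ℕ) (t : ℝ) :
    mixedNoncentralTCdf v 0 t = (studentT (v - 1)).real (Iic t) := by
  simp [mixedNoncentralTCdf, studentT]

lemma continuous_studentT_cdf {a : ℕ} (ha : 1 ≤ a) :
    Continuous fun x => (studentT a).real (Iic x) := by
  have : IsProbabilityMeasure (studentT a) := isProbabilityMeasure_noncentralT a 0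
  simp_rw [← cdf_eq_real]
  refine continuous_iff_continuousAt.2 fun x => ?_
  rw [(monotone_cdf (studentT a)).continuousAt_iff_leftLim_eq_rightLim, StieltjesFunction.rightLim_eq]
  have h := StieltjesFunction.measure_singleton (cdf (studentT a)) x
  rw [measure_cdf, studentT, noncentralT_singleton ha, eq_comm, ENNReal.ofReal_eq_zero] at h
  exact le_antisymm ((monotone_cdf _).leftLim_le le_rfl) (by rw [studentT]; linarith)

/-- By continuity the superlevel set is closed and contains its infimum, which gives `≥`; the
intermediate value theorem yields a point of that set where the level is attained exactly, and
monotonicity gives `≤`. -/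
lemma studentT_tQuantile {a : ℕ} (ha : 1 ≤ a) {α : ℝ} (h0 : 0 < α) (h1 : α < 1) :
    (studentT a).real (Iic (tQuantile a α)) = 1 - α := by
  have : IsProbabilityMeasure (studentT a) := isProbabilityMeasure_noncentralT a 0
  have hc := continuous_studentT_cdf ha
  rw [tQuantile]
  simp_rw [← cdf_eq_real] at hc ⊢
  have hm := monotone_cdf (studentT a)
  obtain ⟨x, hx⟩ := ((tendsto_cdf_atBot (studentT a)).eventually_lt_const
    (show (0 : ℝ) < 1 - α by linarith)).exists
  obtain ⟨z, hz⟩ := ((tendsto_cdf_atTop (studentT a)).eventually_const_lt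
    (show 1 - α < (1 : ℝ) by linarith)).exists
  obtain ⟨y, hy⟩ := mem_range_of_exists_le_of_exists_ge hc ⟨x, hx.le⟩ ⟨z, hz.le⟩
  have hbdd : BddBelow {w | 1 - α ≤ cdf (studentT a) w} :=
    ⟨x, fun w hw => le_of_not_gt fun h => absurd (hm h.le) (by
      have : 1 - α ≤ cdf (studentT a) w := hw
      linarith)⟩
  have hcl : IsClosed {w | 1 - α ≤ cdf (studentT a) w} := isClosed_le continuous_const hc
  have hmem := hcl.csInf_mem ⟨y, hy.ge⟩ hbdd
  exact le_antisymm ((hm (csInf_le hbdd hy.ge)).trans hy.le) hmem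

/-! ### `U`-centering -/

section UCenter

variable {n : ℕ}

lemma uCenter_congr {A B : Fin n → Fin n → ℝ} (h : ∀ s t, s ≠ t → A s t = B s t) :
    uCenter A = uCenter B := by
  have h1 : ∀ s, ∑ v ∈ Finset.univ.erase s, A s v = ∑ v ∈ Finset.univ.erase s, B s v := fun s =>
    Finset.sum_congr rfl fun v hv => h _ _ (Finset.ne_of_mem_erase hv).symm
  have h2 : ∀ t, ∑ u ∈ Finset.univ.erase t, A u t = ∑ u ∈ Finset.univ.erase t, B u t := fun t =>
    Finset.sum_congr rfl fun u hu => h _ _ (Finset.ne_of_mem_erase hu)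
  ext s t
  unfold uCenter
  split_ifs with hst
  · rfl
  · simp only [h1, h2, h s t hst]

lemma uCenter_add (A B : Fin n → Fin n → ℝ) (s t : Fin n) :
    uCenter (fun s t => A s t + B s t) s t = uCenter A s t + uCenter B s t := by
  unfold uCenter
  split_ifs
  · simp
  · simp only [Finset.sum_add_distrib]; ring

lemma uCenter_const_mul (c : ℝ) (A : Fin n → Fin n → ℝ) (s t : Fin n) :
    uCenter (fun s t => c * A s t) s t = c * uCenter A s t := by
  unfold uCenter
  split_ifs
  · simp
  · simp only [← Finset.mul_sum]; ring

lemma sum_erase_add (h : Fin n → ℝ) (s : Fin n) :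
    ∑ t ∈ Finset.univ.erase s, (h s + h t) = ((n : ℝ) - 2) * h s + ∑ t, h t := by
  rw [Finset.sum_erase_eq_sub (Finset.mem_univ s), Finset.sum_add_distrib, Finset.sum_const,
    Finset.card_univ, Fintype.card_fin, nsmul_eq_mul]
  ring

/-- Makes every term of an expansion that depends on a single observation invisible: conditional
expectations, means and constants. -/
lemma uCenter_add_self (hn : 3 ≤ n) (h : Fin n → ℝ) (s t : Fin n) :
    uCenter (fun s t => h s + h t) s t = 0 := by
  have hn' : (3 : ℝ) ≤ n := by exact_mod_cast hn
  have h1 : (n : ℝ) - 2 ≠ 0 := by linarith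
  have h2 : (n : ℝ) - 1 ≠ 0 := by linarith
  unfold uCenter
  split_ifs
  · rfl
  · have h3 : ∀ t, ∑ u ∈ Finset.univ.erase t, (h u + h t) = ((n : ℝ) - 2) * h t + ∑ u, h u :=
      fun t => by rw [← sum_erase_add]; exact Finset.sum_congr rfl fun _ _ => add_comm _ _
    simp only [sum_erase_add, h3]
    simp only [Finset.sum_add_distrib, ← Finset.mul_sum, Finset.sum_const,
      Finset.card_univ, Fintype.card_fin, nsmul_eq_mul]
    field_simp
    ring

/-- `U`-centering removes the additive terms. -/
lemma uCenter_of_eq_mul_add (hn : 3 ≤ n) {A B : Fin n → Fin n → ℝ} {c : ℝ} {h : Fin n → ℝ}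
    (hA : ∀ s t, s ≠ t → A s t = c * B s t + (h s + h t)) (s t : Fin n) :
    uCenter A s t = c * uCenter B s t := by
  rw [uCenter_congr hA, uCenter_add, uCenter_const_mul, uCenter_add_self hn, add_zero]

lemma uInner_of_uCenter {A B A' B' : Fin n → Fin n → ℝ} {c d : ℝ}
    (hA : ∀ s t, uCenter A s t = c * uCenter A' s t)
    (hB : ∀ s t, uCenter B s t = d * uCenter B' s t) :
    uInner A B = c * d * uInner A' B' := by
  simp only [uInner, hA, hB, Finset.mul_sum]
  exact Finset.sum_congr rfl fun s _ => Finset.sum_congr rfl fun t _ => by ring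

lemma uCenter_sum {κ : Type*} (I : Finset κ) (A : κ → Fin n → Fin n → ℝ) (s t : Fin n) :
    uCenter (fun s t => ∑ i ∈ I, A i s t) s t = ∑ i ∈ I, uCenter (A i) s t := by
  classical
  induction I using Finset.induction_on with
  | empty => simpa using uCenter_const_mul 0 (fun _ _ => (0 : ℝ)) s t
  | insert i I hi ih => simp only [Finset.sum_insert hi, uCenter_add, ih]

/-- Bilinearity. It turns the double sum in `mdCov` into one inner product of `ℓ¹`-distance
matrices, so that all three statistics have the same shape. -/
lemma sum_sum_uInner {κ κ' : Type*} [Fintype κ] [Fintype κ'] (A : κ → Fin n → Fin n → ℝ)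
    (B : κ' → Fin n → Fin n → ℝ) :
    ∑ i, ∑ j, uInner (A i) (B j) =
      uInner (fun s t => ∑ i, A i s t) (fun s t => ∑ j, B j s t) := by
  simp only [uInner, uCenter_sum, Finset.sum_mul_sum, ← Finset.mul_sum]
  congr 1
  have h1 : ∀ i, ∑ j, ∑ s, ∑ t ∈ Finset.univ.erase s, uCenter (A i) s t * uCenter (B j) s t =
      ∑ s, ∑ t ∈ Finset.univ.erase s, ∑ j, uCenter (A i) s t * uCenter (B j) s t := fun i => by
    rw [Finset.sum_comm]
    exact Finset.sum_congr rfl fun s _ => Finset.sum_comm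
  simp only [h1]
  rw [Finset.sum_comm]
  refine Finset.sum_congr rfl fun s _ => Finset.sum_comm.trans
    (Finset.sum_congr rfl fun t _ => ?_)
  simp only [Finset.mul_sum]

/-! ### Symmetric matrices as vectors indexed by pairs, and their row sums. -/

/-- The symmetric matrix with zero diagonal and given entries above the diagonal. -/
noncomputable def symMat (c : Pairs n → ℝ) (s t : Fin n) : ℝ :=
  if h : s < t then c ⟨(s, t), h⟩ else if h : t < s then c ⟨(t, s), h⟩ else 0

lemma symMat_comm (c : Pairs n → ℝ) (s t : Fin n) : symMat c s t = symMat c t s := by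
  unfold symMat
  rcases lt_trichotomy s t with h | h | h
  · simp [h, not_lt.2 h.le]
  · simp [h]
  · simp [h, not_lt.2 h.le]

lemma symMat_self (c : Pairs n → ℝ) (s : Fin n) : symMat c s s = 0 := by simp [symMat]

lemma symMat_pair (c : Pairs n → ℝ) (p : Pairs n) : symMat c p.1.1 p.1.2 = c p := by
  simp [symMat, p.2]

lemma symMat_restrict {A : Fin n → Fin n → ℝ} (hA : ∀ s t, A s t = A t s) {s t : Fin n}
    (hst : s ≠ t) : symMat (fun p => A p.1.1 p.1.2) s t = A s t := by
  unfold symMat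
  rcases lt_or_gt_of_ne hst with h | h
  · simp [h]
  · simp [h, not_lt.2 h.le, hA t s]

lemma sum_sum_erase_eq_sum_pairs (F : Fin n → Fin n → ℝ) :
    ∑ s, ∑ t ∈ Finset.univ.erase s, F s t =
      ∑ p : Pairs n, (F p.1.1 p.1.2 + F p.1.2 p.1.1) := by
  have h1 : ∀ s, ∑ t ∈ Finset.univ.erase s, F s t =
      ∑ t, ((if s < t then F s t else 0) + if t < s then F s t else 0) := fun s => by
    rw [← Finset.add_sum_erase _ _ (Finset.mem_univ s)]
    simp only [lt_irrefl, if_false, add_zero, zero_add]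
    refine Finset.sum_congr rfl fun t ht => ?_
    rcases lt_or_gt_of_ne (Finset.ne_of_mem_erase ht) with h | h
    · simp [h, not_lt.2 h.le]
    · simp [h, not_lt.2 h.le]
  have h2 : ∀ G : Fin n → Fin n → ℝ, ∑ s, ∑ t, (if s < t then G s t else 0) =
      ∑ p : Pairs n, G p.1.1 p.1.2 := fun G => by
    rw [← Finset.sum_product', Finset.univ_product_univ, ← Finset.sum_filter]
    exact (Finset.sum_subtype _ (by simp) _)
  simp only [h1, Finset.sum_add_distrib, h2]
  rw [Finset.sum_comm (f := fun s t => if t < s then F s t else 0), h2 fun t s => F s t]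

lemma sum_sum_eq_sum_pairs {F : Fin n → Fin n → ℝ} (hF : ∀ s t, F s t = F t s)
    (h0 : ∀ s, F s s = 0) : ∑ s, ∑ t, F s t = 2 * ∑ p : Pairs n, F p.1.1 p.1.2 := by
  have : ∀ s, ∑ t, F s t = ∑ t ∈ Finset.univ.erase s, F s t := fun s => by
    rw [← Finset.add_sum_erase _ _ (Finset.mem_univ s), h0, zero_add]
  simp only [this, sum_sum_erase_eq_sum_pairs, Finset.mul_sum]
  exact Finset.sum_congr rfl fun p _ => by rw [hF p.1.2 p.1.1]; ring

/-- The map from `h` to `h s + h t` is the adjoint of the row sum map; hence additive matrices are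
orthogonal to the kernel of the row sums. -/
lemma sum_pairs_mul_add (e : Pairs n → ℝ) (h : Fin n → ℝ) :
    ∑ p : Pairs n, e p * (h p.1.1 + h p.1.2) = ∑ s, h s * ∑ t, symMat e s t := by
  have h1 := sum_sum_eq_sum_pairs (F := fun s t => symMat e s t * (h s + h t))
    (fun s t => by rw [symMat_comm]; ring) (fun s => by rw [symMat_self]; ring)
  simp only [symMat_pair, mul_add, Finset.sum_add_distrib] at h1
  rw [Finset.sum_comm (f := fun s t => symMat e s t * h t)] at h1
  have h2 : ∑ t, ∑ s, symMat e s t * h t = ∑ s, ∑ t, symMat e s t * h s :=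
    Finset.sum_congr rfl fun t _ => Finset.sum_congr rfl fun s _ => by rw [symMat_comm]
  simp only [mul_add, Finset.sum_add_distrib]
  have h3 : ∀ s, h s * ∑ t, symMat e s t = ∑ t, symMat e s t * h s := fun s => by
    rw [Finset.mul_sum]; exact Finset.sum_congr rfl fun _ _ => mul_comm _ _
  simp only [h3]
  linarith

/-- The row sums of the symmetric matrix. -/
noncomputable def rowSum (n : ℕ) : EuclideanSpace ℝ (Pairs n) →ₗ[ℝ] (Fin n → ℝ) where
  toFun c s := ∑ t, symMat c s t
  map_add' c d := by
    ext s
    simp only [Pi.add_apply, ← Finset.sum_add_distrib]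
    refine Finset.sum_congr rfl fun t _ => ?_
    unfold symMat; split_ifs <;> simp
  map_smul' r c := by
    ext s
    simp only [Pi.smul_apply, smul_eq_mul, Finset.mul_sum, RingHom.id_apply]
    refine Finset.sum_congr rfl fun t _ => ?_
    unfold symMat; split_ifs <;> simp

lemma rowSum_apply (c : EuclideanSpace ℝ (Pairs n)) (s : Fin n) :
    rowSum n c s = ∑ t, symMat c s t := rfl

lemma sum_symMat_add (h : Fin n → ℝ) (s : Fin n) :
    ∑ t, symMat (fun p : Pairs n => h p.1.1 + h p.1.2) s t = ((n : ℝ) - 2) * h s + ∑ t, h t := by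
  rw [← sum_erase_add, ← Finset.add_sum_erase _ _ (Finset.mem_univ s), symMat_self, zero_add]
  exact Finset.sum_congr rfl fun t ht => symMat_restrict (A := fun s t => h s + h t)
    (fun _ _ => add_comm _ _) (Finset.ne_of_mem_erase ht).symm

lemma rowSum_surjective (hn : 3 ≤ n) : Function.Surjective (rowSum n) := fun r => by
  have hn' : (3 : ℝ) ≤ n := by exact_mod_cast hn
  have h1 : (n : ℝ) - 2 ≠ 0 := by linarith
  have h2 : (n : ℝ) - 1 ≠ 0 := by linarith
  -- The preimage is sought among additive matrices, where the equation reads `(n - 2) h s + ∑ h = r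
  -- s`. Summation over `s` forces `∑ h = H`.
  let H := (∑ s, r s) / (2 * ((n : ℝ) - 1))
  let h : Fin n → ℝ := fun s => (r s - H) / ((n : ℝ) - 2)
  refine ⟨WithLp.toLp 2 fun p => h p.1.1 + h p.1.2, ?_⟩
  ext s
  rw [rowSum_apply, sum_symMat_add]
  have : ∑ t, h t = H := by
    simp only [h, ← Finset.sum_div, Finset.sum_sub_distrib, Finset.sum_const, Finset.card_univ,
      Fintype.card_fin, nsmul_eq_mul, H]
    field_simp
    ring
  rw [this]
  simp only [h]
  field_simp
  ring

lemma two_mul_card_pairs (n : ℕ) : 2 * Fintype.card (Pairs n) = n * (n - 1) := by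
  have h := sum_sum_erase_eq_sum_pairs (n := n) fun _ _ => 1
  simp only [Finset.sum_const, Finset.card_erase_of_mem (Finset.mem_univ _), Finset.card_univ,
    Fintype.card_fin, nsmul_eq_mul, mul_one] at h
  have : ((n * (n - 1) : ℕ) : ℝ) = ((Fintype.card (Pairs n) * 2 : ℕ) : ℝ) := by
    rw [Nat.cast_mul, h]; push_cast; ring
  have := Nat.cast_injective this
  omega

lemma two_mul_dof (hn : 3 ≤ n) : 2 * dof n = n * (n - 3) := by
  obtain ⟨k, rfl⟩ := Nat.exists_eq_add_of_le hn
  have h : Even ((3 + k) * k) := by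
    rcases Nat.even_or_odd k with h | h
    · exact h.mul_left _
    · exact (Odd.add_odd (by decide) h).mul_right _
  rw [dof, Nat.add_sub_cancel_left]
  exact Nat.two_mul_div_two_of_even h

/-- Rank-nullity: `n(n-1)/2 - n = n(n-3)/2`. This is where the degrees of freedom come from. -/
lemma finrank_ker_rowSum (hn : 3 ≤ n) : Module.finrank ℝ (LinearMap.ker (rowSum n)) = dof n := by
  have h1 := LinearMap.finrank_range_add_finrank_ker (rowSum n)
  rw [LinearMap.range_eq_top.2 (rowSum_surjective hn), finrank_top, Module.finrank_fin_fun,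
    finrank_euclideanSpace] at h1
  have h2 := two_mul_card_pairs n
  have h3 := two_mul_dof hn
  obtain ⟨k, rfl⟩ := Nat.exists_eq_add_of_le hn
  have h4 : 3 + k - 1 = k + 2 := by omega
  rw [Nat.add_sub_cancel_left] at h3
  rw [h4] at h2
  nlinarith

/-- Already for `n = 4` one has `v = 2`, which leaves one degree of freedom for the denominator. -/
lemma one_le_dof_sub_one (hn : 4 ≤ n) : 1 ≤ dof n - 1 := by
  have := two_mul_dof (n := n) (by omega)
  have : 4 * 1 ≤ n * (n - 3) := Nat.mul_le_mul hn (by omega)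
  omega

/-! ### `U`-centering as an orthogonal projection. -/

/-- The entries of the `U`-centered matrix above the diagonal. -/
noncomputable def uProj (a : Pairs n → ℝ) : EuclideanSpace ℝ (Pairs n) :=
  WithLp.toLp 2 fun p => uCenter (symMat a) p.1.1 p.1.2

/-- The additive part which is removed by `U`-centering. -/
noncomputable def uShift (a : Pairs n → ℝ) (s : Fin n) : ℝ :=
  (∑ t, symMat a s t) / ((n : ℝ) - 2) -
    (∑ s, ∑ t, symMat a s t) / (2 * ((n : ℝ) - 1) * ((n : ℝ) - 2))

lemma uCenter_symMat (hn : 3 ≤ n) (a : Pairs n → ℝ) {s t : Fin n} (hst : s ≠ t) :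
    uCenter (symMat a) s t = symMat a s t - (uShift a s + uShift a t) := by
  have hn' : (3 : ℝ) ≤ n := by exact_mod_cast hn
  have h1 : (n : ℝ) - 2 ≠ 0 := by linarith
  have h2 : (n : ℝ) - 1 ≠ 0 := by linarith
  have h3 : ∀ s, ∑ v ∈ Finset.univ.erase s, symMat a s v = ∑ v, symMat a s v := fun s => by
    rw [← Finset.add_sum_erase Finset.univ _ (Finset.mem_univ s), symMat_self, zero_add]
  have h4 : ∀ t, ∑ u ∈ Finset.univ.erase t, symMat a u t = ∑ v, symMat a t v := fun t => by
    rw [← h3]; exact Finset.sum_congr rfl fun u _ => symMat_comm _ _ _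
  rw [uCenter, if_neg hst]
  simp only [h3, h4, uShift]
  field_simp
  ring

lemma uProj_apply (hn : 3 ≤ n) (a : Pairs n → ℝ) (p : Pairs n) :
    uProj a p = a p - (uShift a p.1.1 + uShift a p.1.2) := by
  have := uCenter_symMat hn a p.2.ne
  rwa [symMat_pair] at this

/-- Since `uProj a` differs from `a` by an additive matrix, which is orthogonal to the kernel, this
identifies `uProj` as the orthogonal projection onto the kernel. -/
lemma uProj_mem_ker (hn : 3 ≤ n) (a : Pairs n → ℝ) : uProj a ∈ LinearMap.ker (rowSum n) := by
  have hn' : (3 : ℝ) ≤ n := by exact_mod_cast hn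
  have h1 : (n : ℝ) - 2 ≠ 0 := by linarith
  have h2 : (n : ℝ) - 1 ≠ 0 := by linarith
  have : uProj a = WithLp.toLp 2 a -
      WithLp.toLp 2 fun p : Pairs n => uShift a p.1.1 + uShift a p.1.2 := by
    ext p; exact uProj_apply hn a p
  rw [LinearMap.mem_ker, this, map_sub]
  ext s
  rw [Pi.sub_apply, rowSum_apply, rowSum_apply, sum_symMat_add, Pi.zero_apply]
  simp only [uShift, Finset.sum_sub_distrib, ← Finset.sum_div, Finset.sum_const, Finset.card_univ,
    Fintype.card_fin, nsmul_eq_mul]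
  field_simp
  ring

lemma uInner_symMat_eq_inner (hn : 4 ≤ n) (a b : Pairs n → ℝ) :
    uInner (symMat a) (symMat b) = (dof n : ℝ)⁻¹ * inner ℝ (uProj a) (uProj b) := by
  have hn' : (4 : ℝ) ≤ n := by exact_mod_cast hn
  have h2 : 2 * (dof n : ℝ) = n * (n - 3) := by
    have := two_mul_dof (n := n) (by omega)
    rw [← Nat.cast_ofNat, ← Nat.cast_mul, this, Nat.cast_mul, Nat.cast_sub (by omega)]; simp
  have hc : ∀ a : Pairs n → ℝ, ∀ s t, uCenter (symMat a) s t = uCenter (symMat a) t s :=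
    fun a s t => by
      by_cases hst : s = t
      · rw [hst]
      · rw [uCenter_symMat (by omega) a hst, uCenter_symMat (by omega) a (Ne.symm hst), symMat_comm,
          add_comm]
  -- The normalization `n (n - 3)` equals `2 v`, and each unordered pair is counted twice.
  rw [uInner, sum_sum_erase_eq_sum_pairs, ← h2, PiLp.inner_apply]
  have hv : (dof n : ℝ) ≠ 0 := fun h => by rw [h] at h2; nlinarith
  have h3 : ∀ p : Pairs n, uCenter (symMat a) p.1.1 p.1.2 * uCenter (symMat b) p.1.1 p.1.2 +
      uCenter (symMat a) p.1.2 p.1.1 * uCenter (symMat b) p.1.2 p.1.1 =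
      2 * inner ℝ (uProj a p) (uProj b p) := fun p => by
    rw [hc a p.1.2, hc b p.1.2]; simp [uProj]; ring
  simp only [h3, ← Finset.mul_sum]
  field_simp

/-- In suitable orthonormal coordinates, the inner product of `U`-centered matrices is `1 / v`
times the standard inner product of `ℝ^v`. -/
lemma exists_orthonormal_uInner (hn : 4 ≤ n) :
    ∃ e : Fin (dof n) → Pairs n → ℝ,
      (∀ k l, ∑ p, e k p * e l p = if k = l then 1 else 0) ∧
      ∀ a b, uInner (symMat a) (symMat b) =
        (dof n : ℝ)⁻¹ * ((fun k => ∑ p, e k p * a p) ⬝ᵥ fun k => ∑ p, e k p * b p) := by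
  let b := (stdOrthonormalBasis ℝ (LinearMap.ker (rowSum n))).reindex
    (finCongr (finrank_ker_rowSum (n := n) (by omega)))
  have hin : ∀ x y : EuclideanSpace ℝ (Pairs n), inner ℝ x y = ∑ p, x p * y p := fun x y => by
    rw [PiLp.inner_apply]; exact Finset.sum_congr rfl fun p _ => by simp [mul_comm]
  refine ⟨fun k p => (b k : EuclideanSpace ℝ (Pairs n)) p, fun k l => ?_, fun x y => ?_⟩
  · rw [← hin, ← Submodule.coe_inner]
    exact orthonormal_iff_ite.1 b.orthonormal k l
  -- The basis vectors lie in the kernel, so pairing them with `x` or with its projection is the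
  -- same; the identity to be shown is then Parseval's.
  · have hk : ∀ (k) (x : Pairs n → ℝ), ∑ p, (b k : EuclideanSpace ℝ (Pairs n)) p * x p =
        inner ℝ (b k) (⟨uProj x, uProj_mem_ker (by omega) x⟩ : LinearMap.ker (rowSum n)) :=
      fun k x => by
        rw [Submodule.coe_inner, hin]
        simp only [uProj_apply (n := n) (by omega), mul_sub, Finset.sum_sub_distrib]
        rw [sum_pairs_mul_add, eq_comm, sub_eq_self]
        refine Finset.sum_eq_zero fun s _ => ?_
        have h0 := congrFun (LinearMap.mem_ker.1 (b k).2) s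
        rw [rowSum_apply] at h0
        rw [h0]; simp
    rw [uInner_symMat_eq_inner hn]
    congr 1
    simp only [hk, dotProduct]
    have := b.sum_inner_mul_inner ⟨uProj x, uProj_mem_ker (by omega) x⟩
      ⟨uProj y, uProj_mem_ker (by omega) y⟩
    rw [Submodule.coe_inner] at this
    rw [← this]
    exact Finset.sum_congr rfl fun k _ => by rw [real_inner_comm]

end UCenter

/-! ### The Gaussian limit -/

/-- The studentized statistic of two symmetric matrices, given by their entries above the
diagonal. -/
noncomputable def pairStat {n : ℕ} (z : (Pairs n → ℝ) × (Pairs n → ℝ)) : ℝ :=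
  studentizedRatio ((dof n : ℝ) - 1) (uInner (symMat z.1) (symMat z.2))
    (uInner (symMat z.1) (symMat z.1)) (uInner (symMat z.2) (symMat z.2))

lemma covariance_linear_combination {κ α β : Type*} [MeasurableSpace κ] [Fintype α]
    [Fintype β] {G : Measure κ} [IsFiniteMeasure G] {f : α → κ → ℝ} {g : β → κ → ℝ}
    (hf : ∀ p, MemLp (f p) 2 G) (hg : ∀ p, MemLp (g p) 2 G) (c : α → ℝ) (d : β → ℝ) :
    cov[fun z => ∑ p, c p * f p z, fun z => ∑ p, d p * g p z; G] =
      ∑ p, ∑ r, c p * d r * cov[f p, g r; G] := by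
  rw [covariance_fun_sum_fun_sum (fun p => (hf p).const_mul _) (fun p => (hg p).const_mul _)]
  simp only [covariance_const_mul_left, covariance_const_mul_right]
  exact Finset.sum_congr rfl fun p _ => Finset.sum_congr rfl fun r _ => by ring

/-- A covariance matrix `σ I` stays `σ I` in any orthonormal system; it applies to the two variance
blocks and to the cross block alike. -/
lemma covariance_orthonormal_combination {κ α γ : Type*} [MeasurableSpace κ] [Fintype α]
    [DecidableEq α] [DecidableEq γ]
    {G : Measure κ} [IsFiniteMeasure G] {f g : α → κ → ℝ} {σ : ℝ} {e : γ → α → ℝ}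
    (he : ∀ k l, ∑ p, e k p * e l p = if k = l then 1 else 0)
    (hf : ∀ p, MemLp (f p) 2 G) (hg : ∀ p, MemLp (g p) 2 G)
    (h : ∀ p r, cov[f p, g r; G] = if p = r then σ else 0) (k l : γ) :
    cov[fun z => ∑ p, e k p * f p z, fun z => ∑ p, e l p * g p z; G] =
      if k = l then σ else 0 := by
  rw [covariance_linear_combination hf hg]
  simp only [h, mul_ite, mul_zero, Finset.sum_ite_eq, Finset.mem_univ, if_true, ← Finset.sum_mul,
    he, ite_mul, one_mul, zero_mul]

/-- Standardized uncorrelated centered jointly Gaussian variables. -/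
lemma map_eq_gaussPi_prod {κ : Type*} [MeasurableSpace κ] {G : Measure κ} [IsProbabilityMeasure G]
    {k : ℕ}
    {U Z : Fin k → κ → ℝ}
    (hUZ : HasGaussianLaw (fun z => ((fun i => U i z : Fin k → ℝ), (fun i => Z i z : Fin k → ℝ))) G)
    (hU : ∀ i j, cov[U i, U j; G] = if i = j then 1 else 0)
    (hZ : ∀ i j, cov[Z i, Z j; G] = if i = j then 1 else 0)
    (hc : ∀ i j, cov[U i, Z j; G] = 0) (hU0 : ∀ i, ∫ z, U i z ∂G = 0)
    (hZ0 : ∀ i, ∫ z, Z i z ∂G = 0) :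
    G.map (fun z => ((fun i => U i z : Fin k → ℝ), (fun i => Z i z : Fin k → ℝ))) =
      (gaussPi k).prod (gaussPi k) := by
  have hm : ∀ V : Fin k → κ → ℝ, HasGaussianLaw (fun z => (fun i => V i z : Fin k → ℝ)) G →
      (∀ i j, cov[V i, V j; G] = if i = j then 1 else 0) → (∀ i, ∫ z, V i z ∂G = 0) →
      G.map (fun z => (fun i => V i z : Fin k → ℝ)) = gaussPi k := fun V hV h1 h0 => by
    -- For jointly Gaussian variables, vanishing covariances mean independence.
    have hi := hV.iIndepFun_of_covariance_eq_zero fun i j hij => by rw [h1, if_neg hij]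
    have hme : ∀ i, AEMeasurable (V i) G := fun i => (hV.eval i).aemeasurable
    rw [hi.map_fun_eq_pi_map hme]
    congr 1
    ext1 i
    rw [(hV.eval i).map_eq_gaussianReal, h0, ← covariance_self (hme i), h1]
    simp
  have h := hUZ.indepFun_of_covariance_eval hc
  rw [h.map_prod_eq_prod_map_map hUZ.fst.aemeasurable hUZ.snd.aemeasurable,
    hm U hUZ.fst hU hU0, hm Z hUZ.snd hZ hZ0]

section GaussianLimit

variable {n : ℕ} {G : Measure ((Pairs n → ℝ) × (Pairs n → ℝ))} [IsGaussian G]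

lemma IsGaussian.memLp_fst (p : Pairs n) : MemLp (fun z => z.1 p) 2 G :=
  IsGaussian.memLp_dual G ((ContinuousLinearMap.proj p).comp (ContinuousLinearMap.fst ℝ _ _)) 2
    (by simp)

lemma IsGaussian.memLp_snd (p : Pairs n) : MemLp (fun z => z.2 p) 2 G :=
  IsGaussian.memLp_dual G ((ContinuousLinearMap.proj p).comp (ContinuousLinearMap.snd ℝ _ _)) 2
    (by simp)

/-- The centered Gaussian measure with the covariances of the limit is represented by independent
standard Gaussian vectors of dimension `v`. -/
lemma exists_standardization (hn : 4 ≤ n) {σx2 σy2 σxy2 φ : ℝ} (hσx : 0 < σx2) (hσy : 0 < σy2)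
    (hφ : φ = σxy2 / √(σx2 * σy2)) (hφ1 : φ ^ 2 < 1)
    (hx0 : ∀ p, ∫ z, z.1 p ∂G = 0) (hy0 : ∀ p, ∫ z, z.2 p ∂G = 0)
    (hx : ∀ p r, cov[fun z => z.1 p, fun z => z.1 r; G] = if p = r then σx2 else 0)
    (hy : ∀ p r, cov[fun z => z.2 p, fun z => z.2 r; G] = if p = r then σy2 else 0)
    (hxy : ∀ p r, cov[fun z => z.1 p, fun z => z.2 r; G] = if p = r then σxy2 else 0) :
    ∃ T : (Pairs n → ℝ) × (Pairs n → ℝ) → (Fin (dof n) → ℝ) × (Fin (dof n) → ℝ),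
      MeasurePreserving T G ((gaussPi (dof n)).prod (gaussPi (dof n))) ∧
      ∃ c d : ℝ, 0 < c ∧ 0 < d ∧ ∀ z,
        uInner (symMat z.1) (symMat z.2) =
          c * d * ((T z).1 ⬝ᵥ (φ • (T z).1 + √(1 - φ ^ 2) • (T z).2)) ∧
        uInner (symMat z.1) (symMat z.1) = c * c * ((T z).1 ⬝ᵥ (T z).1) ∧
        uInner (symMat z.2) (symMat z.2) =
          d * d * ((φ • (T z).1 + √(1 - φ ^ 2) • (T z).2) ⬝ᵥ
            (φ • (T z).1 + √(1 - φ ^ 2) • (T z).2)) := by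
  obtain ⟨e, he, hu⟩ := exists_orthonormal_uInner hn
  set s := √(1 - φ ^ 2) with hs
  have hs0 : 0 < s := Real.sqrt_pos.2 (by linarith)
  have hs2 : s ^ 2 = 1 - φ ^ 2 := Real.sq_sqrt (by linarith)
  have hx2 := Real.sq_sqrt hσx.le
  have hy2 := Real.sq_sqrt hσy.le
  have hx3 := Real.sqrt_pos.2 hσx
  have hy3 := Real.sqrt_pos.2 hσy
  rw [Real.sqrt_mul hσx.le] at hφ
  set sx := √σx2
  set sy := √σy2
  let A : Fin (dof n) → (Pairs n → ℝ) × (Pairs n → ℝ) → ℝ := fun k z => ∑ p, e k p * z.1 p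
  let B : Fin (dof n) → (Pairs n → ℝ) × (Pairs n → ℝ) → ℝ := fun k z => ∑ p, e k p * z.2 p
  have hA : ∀ k, MemLp (A k) 2 G := fun k =>
    memLp_finsetSum _ fun p _ => (IsGaussian.memLp_fst p).const_mul _
  have hB : ∀ k, MemLp (B k) 2 G := fun k =>
    memLp_finsetSum _ fun p _ => (IsGaussian.memLp_snd p).const_mul _
  have hAA : ∀ k l, cov[A k, A l; G] = if k = l then σx2 else 0 :=
    covariance_orthonormal_combination he IsGaussian.memLp_fst IsGaussian.memLp_fst hx
  have hBB : ∀ k l, cov[B k, B l; G] = if k = l then σy2 else 0 :=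
    covariance_orthonormal_combination he IsGaussian.memLp_snd IsGaussian.memLp_snd hy
  have hAB : ∀ k l, cov[A k, B l; G] = if k = l then σxy2 else 0 :=
    covariance_orthonormal_combination he IsGaussian.memLp_fst IsGaussian.memLp_snd hxy
  have hA0 : ∀ k, ∫ z, A k z ∂G = 0 := fun k => by
    simp only [A]
    rw [integral_finsetSum _ fun p _ =>
      ((IsGaussian.memLp_fst p).integrable one_le_two).const_mul _]
    simp [integral_const_mul, hx0]
  have hB0 : ∀ k, ∫ z, B k z ∂G = 0 := fun k => by
    simp only [B]
    rw [integral_finsetSum _ fun p _ =>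
      ((IsGaussian.memLp_snd p).integrable one_le_two).const_mul _]
    simp [integral_const_mul, hy0]
  let U : Fin (dof n) → (Pairs n → ℝ) × (Pairs n → ℝ) → ℝ := fun k z => sx⁻¹ * A k z
  -- `Z` is the standardized residual in the regression of `B` on `A`, so that `B = sy (φ U + s Z)`.
  let Z : Fin (dof n) → (Pairs n → ℝ) × (Pairs n → ℝ) → ℝ :=
    fun k z => (sy * s)⁻¹ * B k z - φ / (sx * s) * A k z
  have hlin : HasGaussianLaw (fun z => ((fun i => U i z : Fin (dof n) → ℝ),
      (fun i => Z i z : Fin (dof n) → ℝ))) G := by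
    let LA : (Pairs n → ℝ) × (Pairs n → ℝ) →ₗ[ℝ] (Fin (dof n) → ℝ) :=
      { toFun := fun z k => A k z
        map_add' := fun x y => by ext; simp [A, mul_add, Finset.sum_add_distrib]
        map_smul' := fun r x => by ext; simp [A, Finset.mul_sum, mul_left_comm] }
    let LB : (Pairs n → ℝ) × (Pairs n → ℝ) →ₗ[ℝ] (Fin (dof n) → ℝ) :=
      { toFun := fun z k => B k z
        map_add' := fun x y => by ext; simp [B, mul_add, Finset.sum_add_distrib]
        map_smul' := fun r x => by ext; simp [B, Finset.mul_sum, mul_left_comm] }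
    let L := (sx⁻¹ • LA).prod ((sy * s)⁻¹ • LB - (φ / (sx * s)) • LA)
    exact IsGaussian.hasGaussianLaw_id.map_fun (LinearMap.toContinuousLinearMap L)
  have hcA : ∀ (c : ℝ) k, MemLp (fun z => c * A k z) 2 G := fun c k => (hA k).const_mul c
  have hcB : ∀ (c : ℝ) k, MemLp (fun z => c * B k z) 2 G := fun c k => (hB k).const_mul c
  have hmp := map_eq_gaussPi_prod hlin
    (fun k l => by
      simp only [U, covariance_const_mul_left, covariance_const_mul_right]
      rw [hAA]
      split_ifs
      · rw [← hx2]; field_simp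
      · simp)
    (fun k l => by
      simp only [Z]
      rw [covariance_fun_sub_fun_sub (hcB _ _) (hcA _ _) (hcB _ _) (hcA _ _)]
      simp only [covariance_const_mul_left, covariance_const_mul_right]
      rw [covariance_comm (B k) (A l), hAA, hAB, hAB, hBB]
      by_cases hkl : k = l
      · subst hkl
        simp only [if_true]
        have : σxy2 = φ * (sx * sy) := by rw [hφ]; field_simp
        rw [this, ← hx2, ← hy2]
        field_simp
        rw [hs2]; ring
      · simp [hkl, Ne.symm hkl])
    (fun k l => by
      simp only [Z, U]
      rw [covariance_fun_sub_right (hcA _ _) (hcB _ _) (hcA _ _)]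
      simp only [covariance_const_mul_left, covariance_const_mul_right]
      rw [hAA, hAB]
      split_ifs
      · have : σxy2 = φ * (sx * sy) := by rw [hφ]; field_simp
        rw [this, ← hx2]
        field_simp
        ring
      · simp)
    (fun k => by simp [U, integral_const_mul, hA0])
    (fun k => by
      simp only [Z]
      rw [integral_sub ((hcB _ _).integrable one_le_two) ((hcA _ _).integrable one_le_two)]
      simp [integral_const_mul, hA0, hB0])
  have hv : (0 : ℝ) < dof n := by
    have := one_le_dof_sub_one hn
    exact_mod_cast (by omega : 0 < dof n)
  have hv' := Real.sqrt_pos.2 hv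
  -- The factor `1 / v` of the inner product is split evenly between the two scales.
  refine ⟨fun z => (fun i => U i z, fun i => Z i z), ⟨?_, hmp⟩, sx / √(dof n : ℝ),
    sy / √(dof n : ℝ), by positivity, by positivity, fun z => ?_⟩
  · simp only [U, Z, A, B]; fun_prop
  · have h1 : (fun k => ∑ p, e k p * z.1 p) = sx • (fun i => U i z : Fin (dof n) → ℝ) := by
      ext k; simp only [U, A, Pi.smul_apply, smul_eq_mul]; field_simp
    have h2 : (fun k => ∑ p, e k p * z.2 p) = sy • (φ • (fun i => U i z : Fin (dof n) → ℝ) +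
        s • (fun i => Z i z : Fin (dof n) → ℝ)) := by
      ext k
      simp only [U, Z, A, B, Pi.smul_apply, Pi.add_apply, smul_eq_mul]; field_simp; ring
    have h3 : (√(dof n : ℝ)) ^ 2 = dof n := Real.sq_sqrt hv.le
    have h4 : ∀ a b x : ℝ, (dof n : ℝ)⁻¹ * (a * (b * x)) =
        a / √(dof n : ℝ) * (b / √(dof n : ℝ)) * x := fun a b x => by
      have : (dof n : ℝ)⁻¹ = (√(dof n : ℝ))⁻¹ * (√(dof n : ℝ))⁻¹ := by rw [← mul_inv, ← sq, h3]
      rw [this]; field_simp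
    rw [hu, hu, hu, h1, h2]
    dsimp only
    generalize φ • (fun i => U i z : Fin (dof n) → ℝ) + s • (fun i => Z i z : Fin (dof n) → ℝ) = W
    generalize (fun i => U i z : Fin (dof n) → ℝ) = V
    simp only [smul_dotProduct, dotProduct_smul, smul_eq_mul]
    exact ⟨(h4 _ _ _).trans (by ring), h4 _ _ _, h4 _ _ _⟩

end GaussianLimit

/-! ### Continuity sets of the statistic for the Gaussian limit. -/

/-- The matrices at which the studentized statistic is well-behaved. -/
def nondegenerate (n : ℕ) : Set ((Pairs n → ℝ) × (Pairs n → ℝ)) :=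
  {z | uInner (symMat z.1) (symMat z.2) ^ 2 <
    uInner (symMat z.1) (symMat z.1) * uInner (symMat z.2) (symMat z.2)}

lemma continuous_symMat {n : ℕ} (s t : Fin n) : Continuous fun c : Pairs n → ℝ => symMat c s t := by
  unfold symMat
  split_ifs <;> fun_prop

lemma continuous_uInner_symMat {n : ℕ} {α : Type*} [TopologicalSpace α] {f g : α → Pairs n → ℝ}
    (hf : Continuous f) (hg : Continuous g) :
    Continuous fun z => uInner (symMat (f z)) (symMat (g z)) := by
  have h : ∀ {f : α → Pairs n → ℝ}, Continuous f → ∀ s t,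
      Continuous fun z => uCenter (symMat (f z)) s t := fun {f} hf s t => by
    have h1 := fun s t => (continuous_symMat (n := n) s t).comp hf
    simp only [Function.comp_def] at h1
    unfold uCenter
    split_ifs
    · exact continuous_const
    · fun_prop
  have h1 := h hf
  have h2 := h hg
  unfold uInner
  fun_prop

lemma isOpen_nondegenerate (n : ℕ) : IsOpen (nondegenerate n) :=
  isOpen_lt ((continuous_uInner_symMat continuous_fst continuous_snd).pow 2)
    ((continuous_uInner_symMat continuous_fst continuous_fst).mul
      (continuous_uInner_symMat continuous_snd continuous_snd))

lemma continuousOn_pairStat (n : ℕ) : ContinuousOn (pairStat (n := n)) (nondegenerate n) := by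
  have h : ContinuousOn (fun z : (Pairs n → ℝ) × (Pairs n → ℝ) => √((dof n : ℝ) - 1) *
      (uInner (symMat z.1) (symMat z.2) / √(uInner (symMat z.1) (symMat z.1) *
        uInner (symMat z.2) (symMat z.2) - uInner (symMat z.1) (symMat z.2) ^ 2)))
      (nondegenerate n) := by
    refine continuousOn_const.mul (ContinuousOn.div ?_ ?_ fun z hz => ?_)
    · exact (continuous_uInner_symMat continuous_fst continuous_snd).continuousOn
    · exact ((((continuous_uInner_symMat continuous_fst continuous_fst).mul
        (continuous_uInner_symMat continuous_snd continuous_snd)).sub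
        ((continuous_uInner_symMat continuous_fst continuous_snd).pow 2)).sqrt).continuousOn
    · exact (Real.sqrt_pos.2 (sub_pos.2 hz)).ne'
  exact h.congr fun z hz => studentizedRatio_eq hz

lemma measurable_pairStat (n : ℕ) : Measurable (pairStat (n := n)) := by
  have h1 := (continuous_uInner_symMat (n := n) continuous_fst continuous_snd).measurable
  have h2 := (continuous_uInner_symMat (n := n) (α := (Pairs n → ℝ) × (Pairs n → ℝ))
    continuous_fst continuous_fst).measurable
  have h3 := (continuous_uInner_symMat (n := n) (α := (Pairs n → ℝ) × (Pairs n → ℝ))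
    continuous_snd continuous_snd).measurable
  unfold pairStat studentizedRatio
  fun_prop

/-- At a nondegenerate point with value different from `t` the statistic is continuous, so the
inequality holds or fails on a whole neighbourhood. -/
lemma frontier_pairStat_le_subset (n : ℕ) (t : ℝ) :
    frontier {z : (Pairs n → ℝ) × (Pairs n → ℝ) | pairStat z ≤ t} ⊆
      {z | pairStat z = t} ∪ (nondegenerate n)ᶜ := fun z hz => by
  by_cases hn : z ∈ nondegenerate n
  · left
    have hc := (continuousOn_pairStat n).continuousAt ((isOpen_nondegenerate n).mem_nhds hn)
    by_contra hne
    rcases lt_or_gt_of_ne hne with h | h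
    · have : {z : (Pairs n → ℝ) × (Pairs n → ℝ) | pairStat z ≤ t} ∈ 𝓝 z := by
        filter_upwards [hc.eventually (gt_mem_nhds h)] with w hw using hw.le
      exact hz.2 (mem_interior_iff_mem_nhds.2 this)
    · have := mem_closure_iff_frequently.1 hz.1
      refine this ?_
      filter_upwards [hc.eventually (lt_mem_nhds h)] with w hw using not_le.2 hw
  · right; exact hn

section

variable {n : ℕ} {G : Measure ((Pairs n → ℝ) × (Pairs n → ℝ))} [IsGaussian G]

/-- The law of the studentized statistic of the Gaussian limit. -/
lemma gaussian_pairStat_le (hn : 4 ≤ n) {σx2 σy2 σxy2 φ : ℝ} (hσx : 0 < σx2) (hσy : 0 < σy2)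
    (hφ : φ = σxy2 / √(σx2 * σy2)) (hφ0 : 0 ≤ φ) (hφ1 : φ < 1)
    (hx0 : ∀ p, ∫ z, z.1 p ∂G = 0) (hy0 : ∀ p, ∫ z, z.2 p ∂G = 0)
    (hx : ∀ p r, cov[fun z => z.1 p, fun z => z.1 r; G] = if p = r then σx2 else 0)
    (hy : ∀ p r, cov[fun z => z.2 p, fun z => z.2 r; G] = if p = r then σy2 else 0)
    (hxy : ∀ p r, cov[fun z => z.1 p, fun z => z.2 r; G] = if p = r then σxy2 else 0) (t : ℝ) :
    G (frontier {z | pairStat z ≤ t}) = 0 ∧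
    G.real {z | pairStat z ≤ t} = mixedNoncentralTCdf (dof n) φ t := by
  obtain ⟨T, hT, c, d, hc, hd, h⟩ := exists_standardization hn hσx hσy hφ (by nlinarith)
    hx0 hy0 hx hy hxy
  have hs : 0 < √(1 - φ ^ 2) := Real.sqrt_pos.2 (by nlinarith)
  have hv := one_le_dof_sub_one hn
  obtain ⟨m, hm⟩ : ∃ m, dof n = m + 1 := ⟨dof n - 1, by omega⟩
  have hm1 : 1 ≤ m := by omega
  have hcast : (dof n : ℝ) - 1 = m := by rw [hm]; simp
  have hstat : ∀ z, pairStat z = vecStat m (T z).1 (φ • (T z).1 + √(1 - φ ^ 2) • (T z).2) :=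
    fun z => by
      obtain ⟨h1, h2, h3⟩ := h z
      rw [pairStat, h1, h2, h3, studentizedRatio_scale _ _ _ _ (mul_pos hc hd), hcast, vecStat]
  have hmeas : Measurable fun z : (Fin (dof n) → ℝ) × (Fin (dof n) → ℝ) =>
      vecStat m z.1 (φ • z.1 + √(1 - φ ^ 2) • z.2) :=
    measurable_vecStat_comp m measurable_fst (by fun_prop)
  have key : ∀ B : Set ℝ, MeasurableSet B → G {z | pairStat z ∈ B} =
      ((gaussPi (dof n)).prod (gaussPi (dof n)))
        {z | vecStat m z.1 (φ • z.1 + √(1 - φ ^ 2) • z.2) ∈ B} := fun B hB => by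
    have h4 := hT.measure_preimage (hmeas hB).nullMeasurableSet
    simp only [hstat]
    exact h4
  -- Equality in Cauchy-Schwarz requires the component of the noise orthogonal to the first vector
  -- to vanish, which has probability zero.
  have hdeg : G (nondegenerate n)ᶜ = 0 := by
    have hcd : 0 < (c * d) ^ 2 := by positivity
    have h0 : ∀ᵐ z ∂((gaussPi (dof n)).prod (gaussPi (dof n))),
        (z.1 ⬝ᵥ (φ • z.1 + √(1 - φ ^ 2) • z.2)) ^ 2 < (z.1 ⬝ᵥ z.1) *
          ((φ • z.1 + √(1 - φ ^ 2) • z.2) ⬝ᵥ (φ • z.1 + √(1 - φ ^ 2) • z.2)) := by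
      rw [hm]; exact ae_gaussPi_prod_nondegenerate hm1 hs
    have h4 := hT.quasiMeasurePreserving.ae h0
    refine measure_mono_null (fun z hz => ?_) h4
    intro hlt
    obtain ⟨h1, h2, h3⟩ := h z
    refine hz ?_
    rw [nondegenerate, mem_ofPred_eq, h1, h2, h3]
    have := mul_lt_mul_of_pos_left hlt hcd
    linarith [this]
  constructor
  · refine measure_mono_null (frontier_pairStat_le_subset n t) (measure_union_null ?_ hdeg)
    have := key {t} (measurableSet_singleton t)
    simp only [mem_singleton_iff] at this
    rw [this, hm]
    exact gaussPi_prod_vecStat_eq_null hm1 hs t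
  · have := key (Iic t) measurableSet_Iic
    simp only [mem_Iic] at this
    rw [Measure.real, this, hm]
    exact gaussPi_prod_vecStat_le hm1 hφ0 hφ1 t

end

/-! ### Convergence of probabilities under small perturbations -/

section Perturbation

variable {ι E : Type*} {l : Filter ι} [PseudoMetricSpace E] [MeasurableSpace E] [BorelSpace E]
  {Ω : ι → Type*} [∀ i, MeasurableSpace (Ω i)] {Pr : ∀ i, Measure (Ω i)}
  [∀ i, IsProbabilityMeasure (Pr i)] {G : Measure E} [IsProbabilityMeasure G]
  {Z : ∀ i, Ω i → E}

/-- Off a small event, `D i` forces `Z i` into a closed thickening of `A`; the portmanteau theorem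
bounds the limiting mass of that thickening, which shrinks to the closure. The nearby point is
chosen separately for each `ω`, so neither a measurable choice nor measurability of `D i` enters. -/
lemma eventually_measure_le_of_perturbation (hZ : TendstoInDistribution Z l id Pr G)
    {D : ∀ i, Set (Ω i)} {A : Set E}
    (h : ∀ δ > (0 : ℝ), Tendsto (fun i => Pr i {ω | ¬ ∃ z, dist z (Z i ω) < δ ∧ (ω ∈ D i → z ∈ A)})
      l (𝓝 0)) {ε : ℝ} (hε : 0 < ε) :
    ∀ᶠ i in l, (Pr i).real (D i) ≤ G.real (closure A) + ε := by
  have hε2 : ENNReal.ofReal (ε / 2) ≠ 0 := by simpa using hε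
  have h1 := tendsto_measure_cthickening (μ := G) (s := A) ⟨1, one_pos, measure_ne_top _ _⟩
  have h2 : G (closure A) < G (closure A) + ENNReal.ofReal (ε / 2) :=
    ENNReal.lt_add_right (measure_ne_top _ _) hε2
  obtain ⟨δ, hδ, hδ0⟩ := (((h1.mono_left nhdsWithin_le_nhds).eventually
    (gt_mem_nhds h2)).and (self_mem_nhdsWithin (a := (0 : ℝ)) (s := Ioi 0))).exists
  have hδ0 : 0 < δ := hδ0
  have h3 := ProbabilityMeasure.limsup_measure_closed_le_of_tendsto hZ.tendsto
    (F := Metric.cthickening δ A) Metric.isClosed_cthickening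
  simp only [ProbabilityMeasure.coe_mk, Measure.map_id] at h3
  have h4 := eventually_lt_of_limsup_lt (h3.trans_lt hδ)
  have h5 := (h δ hδ0).eventually (gt_mem_nhds (pos_iff_ne_zero.2 hε2))
  filter_upwards [h4, h5] with i hi1 hi2
  rw [Measure.map_apply_of_aemeasurable (hZ.forall_aemeasurable i)
    Metric.isClosed_cthickening.measurableSet] at hi1
  have h6 : D i ⊆ Z i ⁻¹' (Metric.cthickening δ A) ∪
      {ω | ¬ ∃ z, dist z (Z i ω) < δ ∧ (ω ∈ D i → z ∈ A)} := fun ω hω => by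
    by_cases hex : ∃ z, dist z (Z i ω) < δ ∧ (ω ∈ D i → z ∈ A)
    · left
      obtain ⟨z, hz, hzA⟩ := hex
      exact Metric.mem_cthickening_of_dist_le _ z _ _ (hzA hω) (by rw [dist_comm]; exact hz.le)
    · right; exact hex
  have h7 : Pr i (D i) ≤ G (closure A) + ENNReal.ofReal ε :=
    calc Pr i (D i) ≤ _ := (measure_mono h6).trans (measure_union_le _ _)
      _ ≤ (G (closure A) + ENNReal.ofReal (ε / 2)) + ENNReal.ofReal (ε / 2) :=
        add_le_add hi1.le hi2.le
      _ = _ := by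
        rw [add_assoc, ← ENNReal.ofReal_add (by positivity) (by positivity), add_halves]
  have h8 := ENNReal.toReal_mono (by finiteness) h7
  rwa [ENNReal.toReal_add (by finiteness) (by finiteness), ENNReal.toReal_ofReal hε.le] at h8

/-- If the events `D i` are, up to small perturbations of `Z i` and small probabilities, given by
`Z i ∈ A`, then their probabilities converge to the probability of `A` under the limit law. -/
lemma tendsto_measureReal_of_perturbation (hZ : TendstoInDistribution Z l id Pr G)
    {D : ∀ i, Set (Ω i)} {A : Set E} (hA : G (frontier A) = 0)
    (h : ∀ δ > (0 : ℝ), Tendsto (fun i => Pr i {ω | ¬ ∃ z, dist z (Z i ω) < δ ∧ (ω ∈ D i ↔ z ∈ A)})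
      l (𝓝 0)) :
    Tendsto (fun i => (Pr i).real (D i)) l (𝓝 (G.real A)) := by
  have hcl : ∀ B : Set E, G (frontier B) = 0 → G.real (closure B) = G.real B := fun B hB => by
    refine le_antisymm ?_ (measureReal_mono subset_closure)
    have : closure B ⊆ B ∪ frontier B := fun x hx => by
      by_cases hxB : x ∈ B
      · exact Or.inl hxB
      · exact Or.inr ⟨hx, fun hi => hxB (interior_subset hi)⟩
    refine (measureReal_mono this).trans ((measureReal_union_le _ _).trans ?_)
    simp [Measure.real, hB]
  have hmeas : G.real A + G.real Aᶜ = 1 := by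
    have h0 : NullMeasurableSet A G := by
      refine (isOpen_interior (s := A)).measurableSet.nullMeasurableSet.congr ?_
      exact interior_ae_eq_of_null_frontier hA
    rw [measureReal_add_measureReal_compl₀ h0, probReal_univ]
  rw [Metric.tendsto_nhds]
  intro ε hε
  have h1 := eventually_measure_le_of_perturbation hZ (D := D) (A := A) (fun δ hδ => by
    refine tendsto_of_tendsto_of_tendsto_of_le_of_le tendsto_const_nhds (h δ hδ)
      (fun _ => zero_le) fun i => measure_mono fun ω hω hex => hω ?_
    obtain ⟨z, hz, hzA⟩ := hex
    exact ⟨z, hz, hzA.1⟩) (half_pos hε)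
  -- The lower bound is the upper bound for the complements, which have the same frontier.
  have h2 := eventually_measure_le_of_perturbation hZ (D := fun i => (D i)ᶜ) (A := Aᶜ)
    (fun δ hδ => by
    refine tendsto_of_tendsto_of_tendsto_of_le_of_le tendsto_const_nhds (h δ hδ)
      (fun _ => zero_le) fun i => measure_mono fun ω hω hex => hω ?_
    obtain ⟨z, hz, hzA⟩ := hex
    exact ⟨z, hz, fun h hz => h (hzA.2 hz)⟩) (half_pos hε)
  rw [hcl A hA] at h1
  rw [hcl Aᶜ (by rwa [frontier_compl])] at h2
  filter_upwards [h1, h2] with i hi1 hi2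
  -- Subadditivity is enough and does not require `D i` to be measurable.
  have h3 : 1 ≤ (Pr i).real (D i) + (Pr i).real (D i)ᶜ := by
    rw [← probReal_univ (μ := Pr i), ← union_compl_self (D i)]
    exact measureReal_union_le _ _
  rw [Real.dist_eq, abs_lt]
  constructor <;> linarith

end Perturbation

/-! ### Limits of second moments -/

section SecondMoments

lemma integral_add_mul_sq {κ : Type*} [MeasurableSpace κ] {μ : Measure κ} {u v : κ → ℝ} (c : ℝ)
    (hu : MemLp u 2 μ) (hv : MemLp v 2 μ) : ∫ z, (u z + c * v z) ^ 2 ∂μ =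
      ∫ z, u z ^ 2 ∂μ + c ^ 2 * ∫ z, v z ^ 2 ∂μ + 2 * c * ∫ z, u z * v z ∂μ := by
  have h1 : Integrable (fun z => u z ^ 2) μ := hu.integrable_sq
  have h2 : Integrable (fun z => c ^ 2 * v z ^ 2) μ := hv.integrable_sq.const_mul _
  have h3 : Integrable (fun z => 2 * c * (u z * v z)) μ := (hu.integrable_mul hv).const_mul _
  rw [← integral_const_mul, ← integral_const_mul, ← integral_add h1 h2, ← integral_add (f := fun z => u z ^ 2 + c ^ 2 * v z ^ 2)
    (h1.add h2) h3]
  congr 1; ext z; ring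

variable {ι E : Type*} {l : Filter ι} [TopologicalSpace E] [MeasurableSpace E] [BorelSpace E]
  {Ω : ι → Type*} [∀ i, MeasurableSpace (Ω i)] {Pr : ∀ i, Measure (Ω i)}
  [∀ i, IsProbabilityMeasure (Pr i)] {G : Measure E} [IsProbabilityMeasure G]
  {Z : ∀ i, Ω i → E}

/-- Fatou's lemma for convergence in distribution. -/
lemma integral_le_of_tendstoInDistribution [l.NeBot] (hZ : TendstoInDistribution Z l id Pr G)
    {g : E → ℝ} (hg : Continuous g) (hg0 : ∀ z, 0 ≤ g z) (hgi : Integrable g G)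
    (hi : ∀ i, Integrable (fun ω => g (Z i ω)) (Pr i)) {L : ℝ}
    (hL : Tendsto (fun i => ∫ ω, g (Z i ω) ∂(Pr i)) l (𝓝 L)) : ∫ z, g z ∂G ≤ L := by
  -- Truncation at level `M` gives a bounded continuous test function; dominated convergence removes
  -- it afterwards.
  have h1 : ∀ M : ℕ, ∫ z, min (g z) M ∂G ≤ L := fun M => by
    let f : BoundedContinuousFunction E ℝ := BoundedContinuousFunction.ofNormedAddCommGroup
      (fun z => min (g z) M) (by fun_prop) M fun z => by
        rw [Real.norm_eq_abs, abs_of_nonneg (le_min (hg0 z) (by positivity))]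
        exact min_le_right _ _
    have h2 := (ProbabilityMeasure.tendsto_iff_forall_integral_tendsto.1 hZ.tendsto) f
    simp only [ProbabilityMeasure.coe_mk, Measure.map_id] at h2
    refine le_of_tendsto_of_tendsto h2 hL (Eventually.of_forall fun i => ?_)
    dsimp only
    rw [integral_map (hZ.forall_aemeasurable i) f.continuous.aestronglyMeasurable]
    refine integral_mono_of_nonneg (ae_of_all _ fun ω => le_min (hg0 _) (by positivity)) (hi i)
      (ae_of_all _ fun ω => min_le_left _ _)
  have h3 : Tendsto (fun M : ℕ => ∫ z, min (g z) M ∂G) atTop (𝓝 (∫ z, g z ∂G)) := by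
    refine tendsto_integral_of_dominated_convergence g
      (fun M => (by fun_prop : Continuous fun z => min (g z) (M : ℝ)).aestronglyMeasurable) hgi
      (fun M => ae_of_all _ fun z => ?_) (ae_of_all _ fun z => ?_)
    · rw [Real.norm_eq_abs, abs_of_nonneg (le_min (hg0 z) (by positivity))]
      exact min_le_left _ _
    · refine tendsto_const_nhds.congr' ?_
      filter_upwards [eventually_ge_atTop ⌈g z⌉₊] with M hM
      rw [min_eq_left ((Nat.le_ceil _).trans (by exact_mod_cast hM))]
  exact le_of_tendsto' h3 h1

variable {f g : E → ℝ}

/-- If the second moments converge to those of the limit, then so do the mixed moments. -/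
lemma integral_mul_eq_of_tendstoInDistribution [l.NeBot]
    (hZ : TendstoInDistribution Z l id Pr G) (hf : Continuous f) (hg : Continuous g)
    (hfG : MemLp f 2 G) (hgG : MemLp g 2 G)
    (hfi : ∀ i, MemLp (fun ω => f (Z i ω)) 2 (Pr i))
    (hgi : ∀ i, MemLp (fun ω => g (Z i ω)) 2 (Pr i)) {L : ℝ}
    (hf2 : Tendsto (fun i => ∫ ω, f (Z i ω) ^ 2 ∂(Pr i)) l (𝓝 (∫ z, f z ^ 2 ∂G)))
    (hg2 : Tendsto (fun i => ∫ ω, g (Z i ω) ^ 2 ∂(Pr i)) l (𝓝 (∫ z, g z ^ 2 ∂G)))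
    (hL : Tendsto (fun i => ∫ ω, f (Z i ω) * g (Z i ω) ∂(Pr i)) l (𝓝 L)) :
    ∫ z, f z * g z ∂G = L := by
  -- Fatou for `(f + c g)²`: the pure squares converge to their limits and cancel, leaving an
  -- inequality for the mixed term. The values `c = 1` and `c = -1` give both directions.
  have key : ∀ c : ℝ, 2 * c * ∫ z, f z * g z ∂G ≤ 2 * c * L := fun c => by
    have h1 : Tendsto (fun i => ∫ ω, (f (Z i ω) + c * g (Z i ω)) ^ 2 ∂(Pr i)) l
        (𝓝 (∫ z, f z ^ 2 ∂G + c ^ 2 * ∫ z, g z ^ 2 ∂G + 2 * c * L)) := by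
      simp_rw [fun i => integral_add_mul_sq c (hfi i) (hgi i)]
      exact (hf2.add (hg2.const_mul _)).add (hL.const_mul _)
    have h2 := integral_le_of_tendstoInDistribution hZ (g := fun z => (f z + c * g z) ^ 2)
      (by fun_prop) (fun z => sq_nonneg _) ((hfG.add (hgG.const_mul c)).integrable_sq)
      (fun i => ((hfi i).add ((hgi i).const_mul c)).integrable_sq) h1
    rw [integral_add_mul_sq c hfG hgG] at h2
    linarith
  have h1 := key 1
  have h2 := key (-1)
  linarith

/-- If second moments converge to the variance of the limit, then the limit is centered. -/
lemma integral_eq_zero_of_tendsto_variance [l.NeBot]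
    (hZ : TendstoInDistribution Z l id Pr G) (hf : Continuous f) (hfG : MemLp f 2 G)
    (hfi : ∀ i, MemLp (fun ω => f (Z i ω)) 2 (Pr i))
    (hf2 : Tendsto (fun i => ∫ ω, f (Z i ω) ^ 2 ∂(Pr i)) l (𝓝 Var[f; G])) :
    ∫ z, f z ∂G = 0 := by
  -- Fatou bounds the second moment of the limit by its variance, which leaves no room for a mean.
  have h := integral_le_of_tendstoInDistribution hZ (g := fun z => f z ^ 2) (by fun_prop)
    (fun z => sq_nonneg _) hfG.integrable_sq (fun i => (hfi i).integrable_sq) hf2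
  rw [variance_eq_sub hfG] at h
  have : (∫ z, f z ∂G) ^ 2 ≤ 0 := by
    have h' : ∫ z, (f ^ 2) z ∂G = ∫ z, f z ^ 2 ∂G := rfl
    rw [h'] at h
    linarith
  exact pow_eq_zero_iff two_ne_zero |>.1 (le_antisymm this (sq_nonneg _))

end SecondMoments

/-! ### Degenerate kernels -/

/-- A symmetric square integrable kernel with vanishing conditional expectations. -/
structure IsDegenerateKernel {V : Type*} [MeasurableSpace V] (κ : V → V → ℝ) (Q : Measure V) :
    Prop where
  measurable : Measurable fun z : V × V => κ z.1 z.2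
  memLp : MemLp (fun z : V × V => κ z.1 z.2) 2 (Q.prod Q)
  symm : ∀ x y, κ x y = κ y x
  integrable_left : ∀ y, Integrable (fun x => κ x y) Q
  integral_left : ∀ y, ∫ x, κ x y ∂Q = 0

lemma hasLaw_pair {V Ω : Type*} [MeasurableSpace V] [MeasurableSpace Ω] {Q : Measure V}
    {Pr : Measure Ω} [IsProbabilityMeasure Pr] {n : ℕ} {Z : Fin n → Ω → V}
    (hZ : ∀ s, HasLaw (Z s) Q Pr) (hi : iIndepFun Z Pr) {s t : Fin n} (hst : s ≠ t) :
    HasLaw (fun ω => (Z s ω, Z t ω)) (Q.prod Q) Pr :=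
  (hi.indepFun hst).hasLaw_prod (hZ s) (hZ t)

namespace IsDegenerateKernel

variable {V W : Type*} [MeasurableSpace V] [MeasurableSpace W] {Q : Measure V}
  {κ lam : V → V → ℝ}

lemma integral_right (h : IsDegenerateKernel κ Q) (x : V) : ∫ y, κ x y ∂Q = 0 := by
  simp_rw [h.symm x]; exact h.integral_left x

lemma comp {f : W → V} {P : Measure W} [IsProbabilityMeasure P] (hf : Measurable f)
    (h : IsDegenerateKernel κ (P.map f)) : IsDegenerateKernel (fun x y => κ (f x) (f y)) P := by
  have hm : ∀ y, Measurable fun x => κ x y := fun y =>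
    h.measurable.comp (measurable_id.prodMk measurable_const)
  refine ⟨h.measurable.comp (hf.prodMap hf), ?_, fun x y => h.symm _ _, fun y => ?_, fun y => ?_⟩
  · have hp := hf.measurePreserving P
    have := h.memLp
    rw [Measure.map_prod_map P P hf hf] at this
    exact this.comp_of_map (by fun_prop : Measurable (Prod.map f f)).aemeasurable
  · have := h.integrable_left (f y)
    rwa [integrable_map_measure (hm _).aestronglyMeasurable hf.aemeasurable] at this
  · have := h.integral_left (f y)
    rwa [integral_map hf.aemeasurable (hm _).aestronglyMeasurable] at this

lemma const_mul (h : IsDegenerateKernel κ Q) (c : ℝ) :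
    IsDegenerateKernel (fun x y => c * κ x y) Q :=
  ⟨h.measurable.const_mul c, h.memLp.const_mul c, fun x y => by rw [h.symm],
    fun y => (h.integrable_left y).const_mul c,
    fun y => by rw [integral_const_mul, h.integral_left, mul_zero]⟩

lemma sum {α : Type*} {I : Finset α} {κ : α → V → V → ℝ}
    (h : ∀ i ∈ I, IsDegenerateKernel (κ i) Q) :
    IsDegenerateKernel (fun x y => ∑ i ∈ I, κ i x y) Q :=
  ⟨Finset.measurable_fun_sum _ fun i hi => (h i hi).measurable,
    memLp_finsetSum _ fun i hi => (h i hi).memLp,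
    fun x y => Finset.sum_congr rfl fun i hi => (h i hi).symm x y,
    fun y => integrable_finsetSum _ fun i hi => (h i hi).integrable_left y,
    fun y => by
      rw [integral_finsetSum _ fun i hi => (h i hi).integrable_left y]
      exact Finset.sum_eq_zero fun i hi => (h i hi).integral_left y⟩

lemma integral_prod_eq_zero [IsProbabilityMeasure Q] (h : IsDegenerateKernel κ Q) :
    ∫ z : V × V, κ z.1 z.2 ∂(Q.prod Q) = 0 := by
  rw [integral_prod_symm _ (h.memLp.integrable one_le_two)]
  simp [h.integral_left]

/-- Degenerate kernels are orthogonal to functions of one argument; against such a kernel the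
centering of a second kernel can be ignored. -/
lemma integral_mul_fst_eq_zero [IsProbabilityMeasure Q] (h : IsDegenerateKernel κ Q) {f : V → ℝ} (hf : MemLp f 2 Q) :
    ∫ z : V × V, κ z.1 z.2 * f z.1 ∂(Q.prod Q) = 0 := by
  have hi : Integrable (fun z : V × V => κ z.1 z.2 * f z.1) (Q.prod Q) :=
    h.memLp.integrable_mul (hf.comp_fst Q)
  rw [integral_prod _ hi]
  simp [integral_mul_const, h.integral_right]

lemma integral_mul_snd_eq_zero [IsProbabilityMeasure Q] (h : IsDegenerateKernel κ Q) {f : V → ℝ} (hf : MemLp f 2 Q) :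
    ∫ z : V × V, κ z.1 z.2 * f z.2 ∂(Q.prod Q) = 0 := by
  have hi : Integrable (fun z : V × V => κ z.1 z.2 * f z.2) (Q.prod Q) :=
    h.memLp.integrable_mul (hf.comp_snd Q)
  rw [integral_prod_symm _ hi]
  simp [integral_mul_const, h.integral_left]

section Sample

variable {Ω : Type*} [MeasurableSpace Ω] {Pr : Measure Ω} [IsProbabilityMeasure Pr] {n : ℕ}
  {Z : Fin n → Ω → V} (hZ : ∀ s, HasLaw (Z s) Q Pr) (hi : iIndepFun Z Pr)

include hZ hi in
lemma memLp_sample (h : IsDegenerateKernel κ Q) {s t : Fin n} (hst : s ≠ t) :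
    MemLp (fun ω => κ (Z s ω) (Z t ω)) 2 Pr := by
  have hl := hasLaw_pair hZ hi hst
  have := h.memLp
  rw [← hl.map_eq] at this
  exact this.comp_of_map hl.aemeasurable

include hZ hi in
-- The observation `Z s` occurs in one factor only and is independent of the three others jointly,
-- so integrating over it first annihilates the product. The indices `t`, `u`, `w` may coincide.
lemma integral_sample_mul_of_notMem [IsProbabilityMeasure Q] (h : IsDegenerateKernel κ Q) (h' : IsDegenerateKernel lam Q)
    {s t u w : Fin n} (hst : s ≠ t) (hsu : s ≠ u) (hsw : s ≠ w) :
    ∫ ω, κ (Z s ω) (Z t ω) * lam (Z u ω) (Z w ω) ∂Pr = 0 := by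
  have hme : ∀ s, AEMeasurable (Z s) Pr := fun s => (hZ s).aemeasurable
  let T : Finset (Fin n) := {t, u, w}
  have hd : Disjoint ({s} : Finset (Fin n)) T := by simp [T, hst, hsu, hsw]
  have h1 := hi.indepFun_finset₀ {s} T hd hme
  let φ : (({s} : Finset (Fin n)) → V) → V := fun x => x ⟨s, by simp⟩
  let ψ : (T → V) → V × V × V := fun x => (x ⟨t, by simp [T]⟩, x ⟨u, by simp [T]⟩, x ⟨w, by simp [T]⟩)
  have h2 : IndepFun (Z s) (fun ω => (Z t ω, Z u ω, Z w ω)) Pr :=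
    h1.comp (φ := φ) (ψ := ψ) (by fun_prop) (by fun_prop)
  have h3 : HasLaw (fun ω => (Z t ω, Z u ω, Z w ω)) (Pr.map fun ω => (Z t ω, Z u ω, Z w ω)) Pr :=
    ⟨by fun_prop, rfl⟩
  have : IsProbabilityMeasure (Pr.map fun ω => (Z t ω, Z u ω, Z w ω)) :=
    Measure.isProbabilityMeasure_map (by fun_prop)
  have h4 := h2.hasLaw_prod (hZ s) h3
  let F : V × V × V × V → ℝ := fun z => κ z.1 z.2.1 * lam z.2.2.1 z.2.2.2
  have hF : Measurable F :=
    (h.measurable.comp (by fun_prop : Measurable fun z : V × V × V × V => (z.1, z.2.1))).mul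
      (h'.measurable.comp (by fun_prop : Measurable fun z : V × V × V × V => z.2.2))
  have h5 := h4.integral_comp (f := F) hF.aestronglyMeasurable
  refine h5.trans ?_
  -- Without integrability the integral is zero by convention, so both cases agree.
  by_cases hint : Integrable F (Q.prod (Pr.map fun ω => (Z t ω, Z u ω, Z w ω)))
  · rw [integral_prod_symm _ hint]
    simp [F, integral_mul_const, h.integral_left]
  · exact integral_undef hint

include hZ hi in
/-- Degenerate kernels of different pairs of observations are uncorrelated. -/
lemma integral_sample_mul_of_ne [IsProbabilityMeasure Q] (h : IsDegenerateKernel κ Q) (h' : IsDegenerateKernel lam Q)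
    {p r : Pairs n} (hpr : p ≠ r) :
    ∫ ω, κ (Z p.1.1 ω) (Z p.1.2 ω) * lam (Z r.1.1 ω) (Z r.1.2 ω) ∂Pr = 0 := by
  obtain ⟨⟨s, t⟩, hst⟩ := p
  obtain ⟨⟨u, w⟩, huw⟩ := r
  simp only at hst huw ⊢
  by_cases hs : s ≠ u ∧ s ≠ w
  · exact h.integral_sample_mul_of_notMem hZ hi h' hst.ne hs.1 hs.2
  by_cases ht : t ≠ u ∧ t ≠ w
  · simp_rw [h.symm (Z s _)]
    exact h.integral_sample_mul_of_notMem hZ hi h' hst.ne' ht.1 ht.2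
  -- Both indices of `p` now occur in `r`; since pairs are ordered, `p = r`.
  exfalso
  apply hpr
  simp only [Subtype.mk.injEq, Prod.mk.injEq]
  omega

include hZ hi in
lemma integral_sample_mul (h : IsDegenerateKernel κ Q) (h' : IsDegenerateKernel lam Q)
    {s t : Fin n} (hst : s ≠ t) :
    ∫ ω, κ (Z s ω) (Z t ω) * lam (Z s ω) (Z t ω) ∂Pr =
      ∫ z : V × V, κ z.1 z.2 * lam z.1 z.2 ∂(Q.prod Q) :=
  (hasLaw_pair hZ hi hst).integral_comp (f := fun z : V × V => κ z.1 z.2 * lam z.1 z.2)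
    (h.measurable.mul h'.measurable).aestronglyMeasurable

include hZ hi in
lemma integral_sample [IsProbabilityMeasure Q] (h : IsDegenerateKernel κ Q) {s t : Fin n} (hst : s ≠ t) :
    ∫ ω, κ (Z s ω) (Z t ω) ∂Pr = 0 :=
  ((hasLaw_pair hZ hi hst).integral_comp (f := fun z : V × V => κ z.1 z.2)
    h.measurable.aestronglyMeasurable).trans h.integral_prod_eq_zero

include hZ hi in
lemma covariance_sample [IsProbabilityMeasure Q] (h : IsDegenerateKernel κ Q) (h' : IsDegenerateKernel lam Q)
    {s t : Fin n} (hst : s ≠ t) :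
    cov[fun ω => κ (Z s ω) (Z t ω), fun ω => lam (Z s ω) (Z t ω); Pr] =
      ∫ z : V × V, κ z.1 z.2 * lam z.1 z.2 ∂(Q.prod Q) := by
  rw [covariance_eq_sub (h.memLp_sample hZ hi hst) (h'.memLp_sample hZ hi hst),
    h.integral_sample hZ hi hst, zero_mul, sub_zero]
  exact h.integral_sample_mul hZ hi h' hst

end Sample

end IsDegenerateKernel

/-! ### The double centered kernels -/

lemma memLp_two_mul_prod {S T : Type*} [MeasurableSpace S] [MeasurableSpace T] {μ : Measure S}
    {ρ : Measure T} [SFinite μ] [SFinite ρ] {f : S → ℝ} {g : T → ℝ} (hf : MemLp f 2 μ)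
    (hg : MemLp g 2 ρ) : MemLp (fun z : S × T => f z.1 * g z.2) 2 (μ.prod ρ) := by
  have hm : AEStronglyMeasurable (fun z : S × T => f z.1 * g z.2) (μ.prod ρ) :=
    hf.1.comp_fst.mul hg.1.comp_snd
  rw [memLp_two_iff_integrable_sq hm]
  simp_rw [mul_pow]
  exact hf.integrable_sq.mul_prod hg.integrable_sq

section DoubleCentered

variable {ν : Measure ℝ}

/-- The mean distance of a point to a random point. -/
noncomputable def meanDist (ν : Measure ℝ) (x : ℝ) : ℝ := ∫ y, |x - y| ∂ν

lemma meanDist_nonneg (x : ℝ) : 0 ≤ meanDist ν x := integral_nonneg fun _ => abs_nonneg _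

lemma doubleCentered_abs (x y : ℝ) :
    doubleCentered (fun x y => |x - y|) ν x y =
      |x - y| - meanDist ν x - meanDist ν y + ∫ u, meanDist ν u ∂ν := by
  simp only [doubleCentered, meanDist, abs_sub_comm _ y]

variable [IsProbabilityMeasure ν]

/-- In `x² - 2xy + y²` only the mixed term survives double centering. This product structure is why
the squared distance detects nothing beyond covariances. -/
lemma doubleCentered_sq (hν : MemLp id 2 ν) (x y : ℝ) :
    doubleCentered (fun x y => |x - y| ^ 2) ν x y = -2 * ((x - ∫ u, u ∂ν) * (y - ∫ u, u ∂ν)) := by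
  have h1 : Integrable (fun u : ℝ => u) ν := hν.integrable one_le_two
  have h2 : Integrable (fun u : ℝ => u ^ 2) ν := hν.integrable_sq
  have key : ∀ x, ∫ u, |x - u| ^ 2 ∂ν = x ^ 2 - 2 * x * ∫ u, u ∂ν + ∫ u, u ^ 2 ∂ν := fun x => by
    have : ∀ u, |x - u| ^ 2 = (x ^ 2 - 2 * x * u) + u ^ 2 := fun u => by rw [sq_abs]; ring
    simp_rw [this]
    have h0 : Integrable (fun u => x ^ 2 - 2 * x * u) ν :=
      (integrable_const _).sub (h1.const_mul _)
    rw [integral_add h0 h2,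
      integral_sub (integrable_const _) (h1.const_mul _), integral_const_mul]
    simp
  have key' : ∀ x, ∫ u, |u - x| ^ 2 ∂ν = x ^ 2 - 2 * x * ∫ u, u ∂ν + ∫ u, u ^ 2 ∂ν := fun x => by
    simp_rw [abs_sub_comm _ x]; exact key x
  have h3 : ∫ x, ∫ u, |x - u| ^ 2 ∂ν ∂ν = 2 * ∫ u, u ^ 2 ∂ν - 2 * (∫ u, u ∂ν) ^ 2 := by
    simp_rw [key]
    have : Integrable (fun x => 2 * x * ∫ u, u ∂ν) ν := (h1.const_mul 2).mul_const _
    have h0 : Integrable (fun x => x ^ 2 - 2 * x * ∫ u, u ∂ν) ν := h2.sub this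
    rw [integral_add h0 (integrable_const _), integral_sub h2 this, integral_mul_const,
      integral_const_mul]
    simp; ring
  rw [doubleCentered, key, key', h3, sq_abs]
  ring

lemma isDegenerateKernel_sq (hν : MemLp id 2 ν) :
    IsDegenerateKernel (doubleCentered (fun x y => |x - y| ^ 2) ν) ν := by
  have h1 : Integrable (fun u : ℝ => u) ν := hν.integrable one_le_two
  have h2 : MemLp (fun u : ℝ => u - ∫ u, u ∂ν) 2 ν := hν.sub (memLp_const _)
  refine ⟨?_, ?_, fun x y => ?_, fun y => ?_, fun y => ?_⟩ <;> simp only [doubleCentered_sq hν]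
  · fun_prop
  · exact (memLp_two_mul_prod h2 h2).const_mul _
  · ring
  · exact ((h2.integrable one_le_two).mul_const _).const_mul _
  · rw [integral_const_mul, integral_mul_const, integral_sub h1 (integrable_const _)]
    simp

lemma integrable_abs_sub (hν : Integrable id ν) (x : ℝ) : Integrable (fun y => |x - y|) ν :=
  ((integrable_const x).sub hν).abs

lemma continuous_meanDist (hν : Integrable id ν) : Continuous (meanDist ν) := by
  refine LipschitzWith.continuous (K := 1) (LipschitzWith.of_dist_le_mul fun x y => ?_)
  rw [Real.dist_eq, Real.dist_eq, meanDist, meanDist,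
    ← integral_sub (integrable_abs_sub hν x) (integrable_abs_sub hν y)]
  have := norm_integral_le_of_norm_le_const (μ := ν) (f := fun u => |x - u| - |y - u|)
    (C := |x - y|) (ae_of_all _ fun u => by
      rw [Real.norm_eq_abs]
      exact (abs_abs_sub_abs_le _ _).trans (le_of_eq (by congr 1; ring)))
  simpa using this

lemma memLp_abs_sub (hν : MemLp id 2 ν) :
    MemLp (fun z : ℝ × ℝ => |z.1 - z.2|) 2 (ν.prod ν) :=
  ((hν.comp_fst ν).sub (hν.comp_snd ν)).abs

lemma memLp_meanDist (hν : MemLp id 2 ν) : MemLp (meanDist ν) 2 ν := by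
  have h1 : Integrable id ν := hν.integrable one_le_two
  refine MemLp.of_le (g := fun x => |x| + ∫ y, |y| ∂ν) (hν.abs.add (memLp_const _))
    (continuous_meanDist h1).aestronglyMeasurable (ae_of_all _ fun x => ?_)
  rw [Real.norm_eq_abs, abs_of_nonneg (meanDist_nonneg x), Real.norm_eq_abs,
    abs_of_nonneg (add_nonneg (abs_nonneg _) (integral_nonneg fun _ => abs_nonneg _))]
  have : ∫ y, (|x| + |y|) ∂ν = |x| + ∫ y, |y| ∂ν := by
    have h0 : Integrable (fun y : ℝ => |y|) ν := h1.abs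
    rw [integral_add (integrable_const _) h0]; simp
  rw [← this]
  exact integral_mono (integrable_abs_sub h1 x) ((integrable_const _).add h1.abs)
    fun y => abs_sub _ _

lemma isDegenerateKernel_abs (hν : MemLp id 2 ν) :
    IsDegenerateKernel (doubleCentered (fun x y => |x - y|) ν) ν := by
  have h1 : Integrable id ν := hν.integrable one_le_two
  have hc := continuous_meanDist h1
  have hm := memLp_meanDist hν
  have hmi := hm.integrable one_le_two
  have hyi : ∀ y, Integrable (fun x => |x - y|) ν := fun y => by
    simp_rw [abs_sub_comm _ y]; exact integrable_abs_sub h1 y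
  refine ⟨?_, ?_, fun x y => ?_, fun y => ?_, fun y => ?_⟩ <;> simp only [doubleCentered_abs]
  · have := hc.measurable; fun_prop
  · exact (((memLp_abs_sub hν).sub (hm.comp_fst ν)).sub (hm.comp_snd ν)).add (memLp_const _)
  · rw [abs_sub_comm]; ring
  · exact (((hyi y).sub hmi).sub (integrable_const _)).add (integrable_const _)
  · have h2 : Integrable (fun x => |x - y| - meanDist ν x) ν := (hyi y).sub hmi
    have h3 : Integrable (fun x => |x - y| - meanDist ν x - meanDist ν y) ν :=
      h2.sub (integrable_const _)
    rw [integral_add h3 (integrable_const _), integral_sub h2 (integrable_const _),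
      integral_sub (hyi y) hmi]
    simp_rw [abs_sub_comm _ y]
    simp [meanDist]

end DoubleCentered

/-! ### The dependence measures as mixed moments of double centered kernels -/

section Dependence

variable {S : Type*} [MeasurableSpace S] {μ : Measure S} {U V : S → ℝ}

lemma memLp_id_map (hU : Measurable U) (hU2 : MemLp U 2 μ) : MemLp id 2 (μ.map U) :=
  (memLp_map_measure_iff aestronglyMeasurable_id hU.aemeasurable).2 hU2

lemma meanDist_map (hU : Measurable U) (x : ℝ) : meanDist (μ.map U) x = ∫ z, |x - U z| ∂μ := by
  rw [meanDist, integral_map hU.aemeasurable (by fun_prop)]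

variable [IsProbabilityMeasure μ]

/-- Both kernels are products over the two independent copies, so the integral factors into `(-2)²`
times the covariance twice. -/
lemma integral_doubleCentered_sq_mul (hU : Measurable U) (hV : Measurable V) (hU2 : MemLp U 2 μ)
    (hV2 : MemLp V 2 μ) :
    ∫ z : S × S, doubleCentered (fun x y => |x - y| ^ 2) (μ.map U) (U z.1) (U z.2) *
      doubleCentered (fun x y => |x - y| ^ 2) (μ.map V) (V z.1) (V z.2) ∂(μ.prod μ) =
      4 * cov[U, V; μ] ^ 2 := by
  have := Measure.isProbabilityMeasure_map (μ := μ) hU.aemeasurable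
  have := Measure.isProbabilityMeasure_map (μ := μ) hV.aemeasurable
  simp only [doubleCentered_sq (memLp_id_map hU hU2), doubleCentered_sq (memLp_id_map hV hV2)]
  rw [integral_map (f := fun u => u) hU.aemeasurable aestronglyMeasurable_id,
    integral_map (f := fun u => u) hV.aemeasurable aestronglyMeasurable_id]
  have h : ∀ z : S × S, -2 * ((U z.1 - μ[U]) * (U z.2 - μ[U])) *
      (-2 * ((V z.1 - μ[V]) * (V z.2 - μ[V]))) =
      4 * (((U z.1 - μ[U]) * (V z.1 - μ[V])) * ((U z.2 - μ[U]) * (V z.2 - μ[V]))) :=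
    fun z => by ring
  simp_rw [h]
  rw [integral_const_mul, integral_prod_mul (fun z => (U z - μ[U]) * (V z - μ[V]))
    fun z => (U z - μ[U]) * (V z - μ[V]), sq]
  rfl

lemma integral_meanDist_mul (hU : Measurable U) (hV : Measurable V) (hU2 : MemLp U 2 μ)
    (hV2 : MemLp V 2 μ) :
    ∫ z : S × S, meanDist (μ.map U) (U z.1) * |V z.1 - V z.2| ∂(μ.prod μ) =
      ∫ z, meanDist (μ.map U) (U z) * meanDist (μ.map V) (V z) ∂μ := by
  have := Measure.isProbabilityMeasure_map (μ := μ) hU.aemeasurable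
  have hu : MemLp (fun z => meanDist (μ.map U) (U z)) 2 μ :=
    (memLp_meanDist (memLp_id_map hU hU2)).comp_of_map hU.aemeasurable
  have hv : MemLp (fun z : S × S => |V z.1 - V z.2|) 2 (μ.prod μ) :=
    ((hV2.comp_fst μ).sub (hV2.comp_snd μ)).abs
  have hi : Integrable (fun z : S × S => meanDist (μ.map U) (U z.1) * |V z.1 - V z.2|)
    (μ.prod μ) := (hu.comp_fst μ).integrable_mul hv
  rw [integral_prod _ hi]
  simp_rw [integral_const_mul, ← meanDist_map hV]

lemma integral_doubleCentered_abs_mul (hU : Measurable U) (hV : Measurable V) (hU2 : MemLp U 2 μ)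
    (hV2 : MemLp V 2 μ) :
    ∫ z : S × S, doubleCentered (fun x y => |x - y|) (μ.map U) (U z.1) (U z.2) *
      doubleCentered (fun x y => |x - y|) (μ.map V) (V z.1) (V z.2) ∂(μ.prod μ) =
      dCovSq μ U V := by
  have := Measure.isProbabilityMeasure_map (μ := μ) hU.aemeasurable
  have := Measure.isProbabilityMeasure_map (μ := μ) hV.aemeasurable
  have hUm := memLp_id_map hU hU2
  have hVm := memLp_id_map hV hV2
  have hκ := (isDegenerateKernel_abs hUm).comp hU
  set κ : S → S → ℝ := fun x y => doubleCentered (fun x y => |x - y|) (μ.map U) (U x) (U y)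
  have hu : MemLp (fun z => meanDist (μ.map U) (U z)) 2 μ :=
    (memLp_meanDist hUm).comp_of_map hU.aemeasurable
  have hv : MemLp (fun z => meanDist (μ.map V) (V z)) 2 μ :=
    (memLp_meanDist hVm).comp_of_map hV.aemeasurable
  have hV' : MemLp (fun z : S × S => |V z.1 - V z.2|) 2 (μ.prod μ) :=
    ((hV2.comp_fst μ).sub (hV2.comp_snd μ)).abs
  have hU' : MemLp (fun z : S × S => |U z.1 - U z.2|) 2 (μ.prod μ) :=
    ((hU2.comp_fst μ).sub (hU2.comp_snd μ)).abs
  set e := ∫ u, meanDist (μ.map U) u ∂(μ.map U)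
  set e' := ∫ u, meanDist (μ.map V) u ∂(μ.map V)
  have he : e = ∫ z : S × S, |U z.1 - U z.2| ∂(μ.prod μ) := by
    have h1 : e = ∫ z, meanDist (μ.map U) (U z) ∂μ :=
      integral_map hU.aemeasurable
        (continuous_meanDist (hUm.integrable one_le_two)).aestronglyMeasurable
    rw [h1, integral_prod _ (hU'.integrable one_le_two)]
    simp_rw [meanDist_map hU]
  -- One centering suffices: `κ` is orthogonal to everything subtracted from `|V - V'|`.
  have hsub : ∫ z : S × S, κ z.1 z.2 *
      doubleCentered (fun x y => |x - y|) (μ.map V) (V z.1) (V z.2) ∂(μ.prod μ) =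
      ∫ z : S × S, κ z.1 z.2 * |V z.1 - V z.2| ∂(μ.prod μ) := by
    have i1 : Integrable (fun z : S × S => κ z.1 z.2 * |V z.1 - V z.2|) (μ.prod μ) :=
      hκ.memLp.integrable_mul hV'
    have i2 : Integrable (fun z : S × S => κ z.1 z.2 * meanDist (μ.map V) (V z.1)) (μ.prod μ) :=
      hκ.memLp.integrable_mul (hv.comp_fst μ)
    have i3 : Integrable (fun z : S × S => κ z.1 z.2 * meanDist (μ.map V) (V z.2)) (μ.prod μ) :=
      hκ.memLp.integrable_mul (hv.comp_snd μ)
    have i4 : Integrable (fun z : S × S => κ z.1 z.2 * e') (μ.prod μ) :=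
      (hκ.memLp.integrable one_le_two).mul_const _
    have i5 : Integrable (fun z : S × S => κ z.1 z.2 * |V z.1 - V z.2| -
      κ z.1 z.2 * meanDist (μ.map V) (V z.1)) (μ.prod μ) := i1.sub i2
    have i6 : Integrable (fun z : S × S => κ z.1 z.2 * |V z.1 - V z.2| -
      κ z.1 z.2 * meanDist (μ.map V) (V z.1) - κ z.1 z.2 * meanDist (μ.map V) (V z.2))
      (μ.prod μ) := i5.sub i3
    simp_rw [doubleCentered_abs, mul_add, mul_sub]
    rw [integral_add i6 i4, integral_sub i5 i3, integral_sub i1 i2, integral_mul_const,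
      hκ.integral_prod_eq_zero, hκ.integral_mul_fst_eq_zero hv, hκ.integral_mul_snd_eq_zero hv]
    ring
  rw [hsub]
  have j1 : Integrable (fun z : S × S => |U z.1 - U z.2| * |V z.1 - V z.2|) (μ.prod μ) :=
    hU'.integrable_mul hV'
  have j2 : Integrable (fun z : S × S => meanDist (μ.map U) (U z.1) * |V z.1 - V z.2|)
    (μ.prod μ) := (hu.comp_fst μ).integrable_mul hV'
  have j3 : Integrable (fun z : S × S => meanDist (μ.map U) (U z.2) * |V z.1 - V z.2|)
    (μ.prod μ) := (hu.comp_snd μ).integrable_mul hV'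
  have j4 : Integrable (fun z : S × S => e * |V z.1 - V z.2|) (μ.prod μ) :=
    (hV'.integrable one_le_two).const_mul _
  have j5 : Integrable (fun z : S × S => |U z.1 - U z.2| * |V z.1 - V z.2| -
    meanDist (μ.map U) (U z.1) * |V z.1 - V z.2|) (μ.prod μ) := j1.sub j2
  have j6 : Integrable (fun z : S × S => |U z.1 - U z.2| * |V z.1 - V z.2| -
    meanDist (μ.map U) (U z.1) * |V z.1 - V z.2| - meanDist (μ.map U) (U z.2) * |V z.1 - V z.2|)
    (μ.prod μ) := j5.sub j3
  have hswap : ∫ z : S × S, meanDist (μ.map U) (U z.2) * |V z.1 - V z.2| ∂(μ.prod μ) =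
      ∫ z : S × S, meanDist (μ.map U) (U z.1) * |V z.1 - V z.2| ∂(μ.prod μ) := by
    rw [← integral_prod_swap]
    simp_rw [Prod.fst_swap, Prod.snd_swap, abs_sub_comm]
  -- Given the common first copy, the two distances are independent and average to the two mean
  -- distances.
  have hthird : ∫ z : (S × S) × S, |U z.1.1 - U z.1.2| * |V z.1.1 - V z.2| ∂((μ.prod μ).prod μ) =
      ∫ z, meanDist (μ.map U) (U z) * meanDist (μ.map V) (V z) ∂μ := by
    have hm1 : MemLp (fun z : (S × S) × S => |U z.1.1 - U z.1.2|) 2 ((μ.prod μ).prod μ) :=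
      hU'.comp_fst μ
    have hm2 : MemLp (fun z : (S × S) × S => |V z.1.1 - V z.2|) 2 ((μ.prod μ).prod μ) :=
      (((hV2.comp_fst μ).comp_fst μ).sub (hV2.comp_snd (μ.prod μ))).abs
    have k1 : Integrable (fun z : (S × S) × S => |U z.1.1 - U z.1.2| * |V z.1.1 - V z.2|)
      ((μ.prod μ).prod μ) := hm1.integrable_mul hm2
    rw [integral_prod _ k1]
    simp_rw [integral_const_mul, ← meanDist_map hV]
    have k2 : Integrable (fun z : S × S => |U z.1 - U z.2| * meanDist (μ.map V) (V z.1))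
      (μ.prod μ) := hU'.integrable_mul (hv.comp_fst μ)
    rw [integral_prod _ k2]
    simp_rw [integral_mul_const, ← meanDist_map hU]
  have hκ' : ∀ z : S × S, κ z.1 z.2 * |V z.1 - V z.2| = |U z.1 - U z.2| * |V z.1 - V z.2| -
      meanDist (μ.map U) (U z.1) * |V z.1 - V z.2| - meanDist (μ.map U) (U z.2) * |V z.1 - V z.2| +
      e * |V z.1 - V z.2| := fun z => by
    simp only [κ, doubleCentered_abs]; ring
  simp_rw [hκ']
  rw [integral_add j6 j4, integral_sub j5 j3, integral_sub j1 j2, hswap,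
    integral_meanDist_mul hU hV hU2 hV2, integral_const_mul, dCovSq, hthird, he]
  ring

end Dependence

/-! ### Nonnegativity of the distance covariance -/

section Nonneg

variable {ν : Measure ℝ} [IsProbabilityMeasure ν]

/-- The centered indicator of `t < x`. -/
noncomputable def centeredInd (ν : Measure ℝ) (t x : ℝ) : ℝ :=
  (Iio x).indicator 1 t - ∫ y, (Iio y).indicator 1 t ∂ν

lemma measurable_ind : Measurable fun z : ℝ × ℝ => (Iio z.2).indicator (1 : ℝ → ℝ) z.1 := by
  have : (fun z : ℝ × ℝ => (Iio z.2).indicator (1 : ℝ → ℝ) z.1) =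
      {z : ℝ × ℝ | z.1 < z.2}.indicator 1 := by
    ext z; simp [Set.indicator]
  rw [this]
  exact measurable_one.indicator (measurableSet_lt measurable_fst measurable_snd)

lemma measurable_centeredInd : Measurable fun z : ℝ × ℝ => centeredInd ν z.1 z.2 := by
  refine measurable_ind.sub ?_
  have h : StronglyMeasurable fun z : ℝ × ℝ => (Iio z.2).indicator (1 : ℝ → ℝ) z.1 :=
    measurable_ind.stronglyMeasurable
  exact h.integral_prod_right'.measurable.comp measurable_fst

lemma integrable_ind (t : ℝ) : Integrable (fun y => (Iio y).indicator (1 : ℝ → ℝ) t) ν := by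
  refine Integrable.of_bound (C := 1)
    (measurable_ind.comp (measurable_const.prodMk measurable_id)).aestronglyMeasurable
    (ae_of_all _ fun y => ?_)
  by_cases h : t < y <;> simp [Set.indicator, h]

lemma integral_centeredInd (t : ℝ) : ∫ x, centeredInd ν t x ∂ν = 0 := by
  simp only [centeredInd]
  rw [integral_sub (integrable_ind t) (integrable_const _)]
  simp

lemma abs_centeredInd_le (t x : ℝ) : |centeredInd ν t x| ≤ 1 := by
  have h0 : ∀ y, 0 ≤ (Iio y).indicator (1 : ℝ → ℝ) t := fun y =>
    indicator_nonneg (fun _ _ => zero_le_one) _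
  have h1 : ∀ y, (Iio y).indicator (1 : ℝ → ℝ) t ≤ 1 := fun y =>
    indicator_le_self' (f := (1 : ℝ → ℝ)) (fun _ _ => zero_le_one) _
  have h2 : 0 ≤ ∫ y, (Iio y).indicator (1 : ℝ → ℝ) t ∂ν := integral_nonneg h0
  have h3 : ∫ y, (Iio y).indicator (1 : ℝ → ℝ) t ∂ν ≤ 1 := by
    simpa using integral_mono (integrable_ind (ν := ν) t) (integrable_const 1) h1
  rw [centeredInd, abs_le]
  constructor <;> linarith [h0 x, h1 x]

lemma ind_sub_ind_sq (x y t : ℝ) :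
    ((Iio x).indicator (1 : ℝ → ℝ) t - (Iio y).indicator 1 t) ^ 2 =
      (Ico (min x y) (max x y)).indicator 1 t := by
  rcases le_total x y with h | h <;> by_cases h1 : t < x <;> by_cases h2 : t < y <;>
    simp [Set.indicator, h, h1, h2] <;> linarith

/-- Realizes `|x - y|` as a squared `L²` distance between indicators of half-lines. This makes the
absolute distance a kernel of negative type and yields `dCov² ≥ 0` without Fourier transforms. -/
lemma integral_ind_sub_ind_sq (x y : ℝ) :
    ∫ t, ((Iio x).indicator (1 : ℝ → ℝ) t - (Iio y).indicator 1 t) ^ 2 = |x - y| := by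
  simp_rw [ind_sub_ind_sq]
  rw [integral_indicator_one measurableSet_Ico, Real.volume_real_Ico_of_le min_le_max,
    max_sub_min_eq_abs, abs_sub_comm]

lemma integral_abs_ind_sub_ind (x y : ℝ) :
    ∫ t, |(Iio x).indicator (1 : ℝ → ℝ) t - (Iio y).indicator 1 t| = |x - y| := by
  rw [← integral_ind_sub_ind_sq]
  congr 1; ext t
  by_cases h1 : t < x <;> by_cases h2 : t < y <;> simp [Set.indicator, h1, h2]

lemma integrable_ind_sub_ind (x y : ℝ) :
    Integrable fun t => (Iio x).indicator (1 : ℝ → ℝ) t - (Iio y).indicator 1 t := by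
  have h1 : Integrable ((Ico (min x y) (max x y)).indicator (1 : ℝ → ℝ)) :=
    (integrable_indicator_iff measurableSet_Ico).2 (integrableOn_const (by simp))
  refine h1.mono' ?_ (ae_of_all _ fun t => ?_)
  · exact ((measurable_one.indicator measurableSet_Iio).sub
      (measurable_one.indicator measurableSet_Iio)).aestronglyMeasurable
  · rw [← ind_sub_ind_sq, Real.norm_eq_abs]
    by_cases h1 : t < x <;> by_cases h2 : t < y <;> simp [Set.indicator, h1, h2]

/-- The indicator itself is not integrable in `t`; the centered one is an average over `y` of
differences of indicators, whose `L¹` norms are `|x - y|`. -/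
lemma integrable_centeredInd (hν : Integrable id ν) (x : ℝ) :
    Integrable (fun t => centeredInd ν t x) ∧ ∫ t, |centeredInd ν t x| ≤ meanDist ν x := by
  let F : ℝ × ℝ → ℝ := fun z => (Iio x).indicator (1 : ℝ → ℝ) z.1 - (Iio z.2).indicator 1 z.1
  have hF : Measurable F :=
    (measurable_ind.comp (measurable_fst.prodMk measurable_const)).sub measurable_ind
  have hFi : Integrable F (volume.prod ν) := by
    rw [integrable_prod_iff' hF.aestronglyMeasurable]
    refine ⟨ae_of_all _ fun y => integrable_ind_sub_ind x y, ?_⟩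
    simp only [F, Real.norm_eq_abs, integral_abs_ind_sub_ind]
    exact integrable_abs_sub hν x
  have hc : ∀ t, centeredInd ν t x = ∫ y, F (t, y) ∂ν := fun t => by
    simp only [F]
    rw [integral_sub (integrable_const _) (integrable_ind t)]
    simp [centeredInd]
  simp only [hc]
  refine ⟨hFi.integral_prod_left, ?_⟩
  calc ∫ t, |∫ y, F (t, y) ∂ν| ≤ ∫ t, ∫ y, |F (t, y)| ∂ν :=
        integral_mono hFi.integral_prod_left.abs hFi.abs.integral_prod_left
          fun t => abs_integral_le_integral_abs
    _ = ∫ y, ∫ t, |F (t, y)| ∂volume ∂ν := by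
        rw [integral_integral_swap hFi.abs]
    _ = meanDist ν x := by simp only [F, integral_abs_ind_sub_ind, meanDist]

lemma integrable_centeredInd_mul (hν : Integrable id ν) (x y : ℝ) :
    Integrable fun t => centeredInd ν t x * centeredInd ν t y := by
  refine (integrable_centeredInd hν x).1.mul_bdd (c := 1) ?_ (ae_of_all _ fun t => ?_)
  · exact (measurable_centeredInd.comp (measurable_id.prodMk measurable_const)).aestronglyMeasurable
  · exact abs_centeredInd_le t y

lemma measurable_integral_centeredInd_mul :
    Measurable fun z : ℝ × ℝ => ∫ t, centeredInd ν t z.1 * centeredInd ν t z.2 := by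
  have h : StronglyMeasurable fun z : (ℝ × ℝ) × ℝ =>
      centeredInd ν z.2 z.1.1 * centeredInd ν z.2 z.1.2 :=
    ((measurable_centeredInd.comp (measurable_snd.prodMk (measurable_fst.comp measurable_fst))).mul
      (measurable_centeredInd.comp
        (measurable_snd.prodMk (measurable_snd.comp measurable_fst)))).stronglyMeasurable
  exact h.integral_prod_right'.measurable

lemma abs_integral_centeredInd_mul_le (hν : Integrable id ν) (x y : ℝ) :
    |∫ t, centeredInd ν t x * centeredInd ν t y| ≤ meanDist ν x :=
  calc _ ≤ ∫ t, |centeredInd ν t x * centeredInd ν t y| := abs_integral_le_integral_abs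
    _ ≤ ∫ t, |centeredInd ν t x| :=
      integral_mono (integrable_centeredInd_mul hν x y).abs (integrable_centeredInd hν x).1.abs
        fun t => by
          dsimp only
          rw [abs_mul]
          exact mul_le_of_le_one_right (abs_nonneg _) (abs_centeredInd_le t y)
    _ ≤ _ := (integrable_centeredInd hν x).2

lemma integral_integral_centeredInd_mul (hν : Integrable id ν) (x : ℝ) :
    ∫ y, ∫ t, centeredInd ν t x * centeredInd ν t y ∂volume ∂ν = 0 := by
  have hm : Measurable fun z : ℝ × ℝ => centeredInd ν z.2 x * centeredInd ν z.2 z.1 :=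
    (measurable_centeredInd.comp (measurable_snd.prodMk measurable_const)).mul
      (measurable_centeredInd.comp measurable_swap)
  have hi : Integrable (fun z : ℝ × ℝ => centeredInd ν z.2 x * centeredInd ν z.2 z.1)
      (ν.prod volume) := by
    refine ((integrable_centeredInd hν x).1.comp_snd ν).mono hm.aestronglyMeasurable
      (ae_of_all _ fun z => ?_)
    rw [norm_mul]
    exact mul_le_of_le_one_right (norm_nonneg _) (abs_centeredInd_le z.2 z.1)
  rw [integral_integral_swap hi]
  simp [integral_const_mul, integral_centeredInd]

/-- The double centered absolute difference is the negative of a positive definite kernel. -/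
lemma doubleCentered_abs_eq_integral (hν : Integrable id ν) (x y : ℝ) :
    doubleCentered (fun x y => |x - y|) ν x y =
      -2 * ∫ t, centeredInd ν t x * centeredInd ν t y := by
  set r : ℝ → ℝ → ℝ := fun x y => ∫ t, centeredInd ν t x * centeredInd ν t y with hr
  have hc := (continuous_meanDist hν).measurable
  -- The centering cancels in differences. As `r` has mean zero in each argument, double centering
  -- removes the two diagonal terms and keeps `-2 r x y`.
  have h1 : ∀ x y, |x - y| = r x x + r y y - 2 * r x y := fun x y => by
    have i1 := integrable_centeredInd_mul hν x x
    have i2 := integrable_centeredInd_mul hν y y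
    have i3 := (integrable_centeredInd_mul hν x y).const_mul 2
    have i4 : Integrable (fun t => centeredInd ν t x * centeredInd ν t x +
      centeredInd ν t y * centeredInd ν t y) := i1.add i2
    simp only [hr]
    rw [← integral_const_mul, ← integral_add i1 i2, ← integral_sub i4 i3,
      ← integral_ind_sub_ind_sq]
    congr 1; ext t
    simp only [centeredInd]; ring
  have hri : ∀ x, Integrable (fun y => r x y) ν := fun x => by
    refine Integrable.of_bound (C := meanDist ν x)
      (measurable_integral_centeredInd_mul.comp
        (measurable_const.prodMk measurable_id)).aestronglyMeasurable
      (ae_of_all _ fun y => abs_integral_centeredInd_mul_le hν x y)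
  have hqi : Integrable (fun y => r y y) ν := by
    have := ((integrable_abs_sub hν 0).sub (integrable_const (r 0 0))).add ((hri 0).const_mul 2)
    refine this.congr (ae_of_all _ fun y => ?_)
    simp only [Pi.add_apply, Pi.sub_apply, h1]; ring
  have h2 : ∀ x, meanDist ν x = r x x + ∫ y, r y y ∂ν := fun x => by
    simp only [meanDist, h1]
    have i1 : Integrable (fun y => r x x + r y y) ν := (integrable_const _).add hqi
    rw [integral_sub i1 ((hri x).const_mul 2), integral_add (integrable_const _) hqi,
      integral_const_mul, integral_integral_centeredInd_mul hν x]
    simp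
  rw [doubleCentered_abs]
  simp only [h2]
  rw [integral_add hqi (integrable_const _), h1 x y]
  simp
  ring

end Nonneg

/-- The distance covariance as the integrated squared covariance of indicators. -/
lemma dCovSq_eq_integral {S : Type*} [MeasurableSpace S] {μ : Measure S} [IsProbabilityMeasure μ]
    {U V : S → ℝ} (hU : Measurable U) (hV : Measurable V) (hU2 : MemLp U 2 μ)
    (hV2 : MemLp V 2 μ) : dCovSq μ U V = 4 * ∫ w : ℝ × ℝ,
      (∫ z, centeredInd (μ.map U) w.1 (U z) * centeredInd (μ.map V) w.2 (V z) ∂μ) ^ 2 := by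
  have := Measure.isProbabilityMeasure_map (μ := μ) hU.aemeasurable
  have := Measure.isProbabilityMeasure_map (μ := μ) hV.aemeasurable
  have hUi : Integrable id (μ.map U) := (memLp_id_map hU hU2).integrable one_le_two
  have hVi : Integrable id (μ.map V) := (memLp_id_map hV hV2).integrable one_le_two
  rw [← integral_doubleCentered_abs_mul hU hV hU2 hV2]
  simp only [doubleCentered_abs_eq_integral hUi, doubleCentered_abs_eq_integral hVi]
  let A : ℝ → S → ℝ := fun t z => centeredInd (μ.map U) t (U z)
  let B : ℝ → S → ℝ := fun t z => centeredInd (μ.map V) t (V z)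
  let F : (S × S) × (ℝ × ℝ) → ℝ := fun w => (A w.2.1 w.1.1 * A w.2.1 w.1.2) *
    (B w.2.2 w.1.1 * B w.2.2 w.1.2)
  have hA : Measurable fun w : ℝ × S => A w.1 w.2 :=
    measurable_centeredInd.comp (measurable_fst.prodMk (hU.comp measurable_snd))
  have hB : Measurable fun w : ℝ × S => B w.1 w.2 :=
    measurable_centeredInd.comp (measurable_fst.prodMk (hV.comp measurable_snd))
  have hF : Measurable F := by
    have h1 : Measurable fun w : (S × S) × (ℝ × ℝ) => A w.2.1 w.1.1 :=
      hA.comp (by fun_prop : Measurable fun w : (S × S) × (ℝ × ℝ) => (w.2.1, w.1.1))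
    have h2 : Measurable fun w : (S × S) × (ℝ × ℝ) => A w.2.1 w.1.2 :=
      hA.comp (by fun_prop : Measurable fun w : (S × S) × (ℝ × ℝ) => (w.2.1, w.1.2))
    have h3 : Measurable fun w : (S × S) × (ℝ × ℝ) => B w.2.2 w.1.1 :=
      hB.comp (by fun_prop : Measurable fun w : (S × S) × (ℝ × ℝ) => (w.2.2, w.1.1))
    have h4 : Measurable fun w : (S × S) × (ℝ × ℝ) => B w.2.2 w.1.2 :=
      hB.comp (by fun_prop : Measurable fun w : (S × S) × (ℝ × ℝ) => (w.2.2, w.1.2))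
    exact (h1.mul h2).mul (h3.mul h4)
  have hFi : Integrable F ((μ.prod μ).prod (volume.prod volume)) := by
    rw [integrable_prod_iff hF.aestronglyMeasurable]
    constructor
    · refine ae_of_all _ fun z => ?_
      have i1 : Integrable fun t => A t z.1 * A t z.2 :=
        integrable_centeredInd_mul hUi (U z.1) (U z.2)
      have i2 : Integrable fun t => B t z.1 * B t z.2 :=
        integrable_centeredInd_mul hVi (V z.1) (V z.2)
      exact i1.mul_prod i2
    · have hu : Integrable (fun z => meanDist (μ.map U) (U z)) μ :=
        ((memLp_meanDist (memLp_id_map hU hU2)).comp_of_map hU.aemeasurable).integrable one_le_two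
      have hv : Integrable (fun z => meanDist (μ.map V) (V z)) μ :=
        ((memLp_meanDist (memLp_id_map hV hV2)).comp_of_map hV.aemeasurable).integrable one_le_two
      refine (hu.mul_prod hv).mono' ?_ (ae_of_all _ fun z => ?_)
      · exact hF.aestronglyMeasurable.norm.integral_prod_right'
      · have key : ∀ {ν : Measure ℝ} [IsProbabilityMeasure ν], Integrable id ν → ∀ x y : ℝ,
            ∫ t, |centeredInd ν t x * centeredInd ν t y| ≤ meanDist ν x := fun {ν} _ hν x y =>
          (integral_mono (integrable_centeredInd_mul hν x y).abs
            (integrable_centeredInd hν x).1.abs fun t => by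
              dsimp only
              rw [abs_mul]
              exact mul_le_of_le_one_right (abs_nonneg _) (abs_centeredInd_le t y)).trans
            (integrable_centeredInd hν x).2
        rw [Real.norm_eq_abs, abs_of_nonneg (integral_nonneg fun _ => norm_nonneg _)]
        simp only [F, norm_mul, Real.norm_eq_abs]
        rw [integral_prod_mul (fun t => |A t z.1| * |A t z.2|) fun t => |B t z.1| * |B t z.2|]
        refine mul_le_mul ?_ ?_ (integral_nonneg fun _ => by positivity) (meanDist_nonneg _)
        · simpa only [abs_mul] using key hUi (U z.1) (U z.2)
        · have := key hVi (V z.2) (V z.1)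
          simp only [abs_mul] at this
          simpa only [mul_comm |B _ z.1|] using this
  have h1 : ∀ z : S × S, -2 * (∫ t, A t z.1 * A t z.2) * (-2 * ∫ t, B t z.1 * B t z.2) =
      4 * ∫ w, F (z, w) ∂(volume.prod volume) := fun z => by
    simp only [F]
    rw [integral_prod_mul (fun t => A t z.1 * A t z.2) fun t => B t z.1 * B t z.2]
    ring
  refine (integral_congr_ae (ae_of_all _ h1)).trans ?_
  rw [integral_const_mul, integral_integral_swap (f := fun z w => F (z, w)) hFi]
  congr 1
  refine integral_congr_ae (ae_of_all _ fun w => ?_)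
  have h2 : ∀ z : S × S, F (z, w) = (A w.1 z.1 * B w.2 z.1) * (A w.1 z.2 * B w.2 z.2) :=
    fun z => by simp only [F]; ring
  simp only [h2]
  -- For fixed thresholds the two copies separate into equal factors, and the square appears.
  rw [integral_prod_mul (fun z => A w.1 z * B w.2 z) fun z => A w.1 z * B w.2 z, sq]

/-! ### The kernel of a statistic -/

/-- The factor between the mixed moments of the double centered kernels and the measures of
dependence. -/
noncomputable def Stat.factor (R : Stat) : ℝ :=
  match R with
  | .dCov => 4
  | .hCov => 4
  | .mdCov => 1

lemma Stat.factor_pos (R : Stat) : 0 < R.factor := by cases R <;> simp [Stat.factor]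

lemma Stat.isDegenerateKernel (R : Stat) {ν : Measure ℝ} [IsProbabilityMeasure ν]
    (hν : MemLp id 2 ν) : IsDegenerateKernel (doubleCentered R.kernel ν) ν := by
  cases R
  · exact isDegenerateKernel_sq hν
  · exact isDegenerateKernel_sq hν
  · exact isDegenerateKernel_abs hν

section

variable {S : Type*} [MeasurableSpace S] {μ : Measure S} [IsProbabilityMeasure μ] {U V : S → ℝ}

lemma Stat.integral_doubleCentered_mul (R : Stat) (hU : Measurable U) (hV : Measurable V)
    (hU2 : MemLp U 2 μ) (hV2 : MemLp V 2 μ) :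
    ∫ z : S × S, doubleCentered R.kernel (μ.map U) (U z.1) (U z.2) *
      doubleCentered R.kernel (μ.map V) (V z.1) (V z.2) ∂(μ.prod μ) =
      R.factor * R.depend μ U V := by
  cases R
  · exact integral_doubleCentered_sq_mul hU hV hU2 hV2
  · exact integral_doubleCentered_sq_mul hU hV hU2 hV2
  · exact (integral_doubleCentered_abs_mul hU hV hU2 hV2).trans (one_mul _).symm

lemma Stat.depend_nonneg (R : Stat) (hU : Measurable U) (hV : Measurable V)
    (hU2 : MemLp U 2 μ) (hV2 : MemLp V 2 μ) : 0 ≤ R.depend μ U V := by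
  cases R
  · exact sq_nonneg _
  · exact sq_nonneg _
  · simp only [Stat.depend]
    rw [dCovSq_eq_integral hU hV hU2 hV2]
    exact mul_nonneg (by norm_num) (integral_nonneg fun _ => sq_nonneg _)

/-- The measures of dependence vanish for independent variables. -/
lemma Stat.depend_eq_zero (R : Stat) (hU : Measurable U) (hV : Measurable V)
    (hU2 : MemLp U 2 μ) (hV2 : MemLp V 2 μ) (h : IndepFun U V μ) : R.depend μ U V = 0 := by
  cases R
  · simp [Stat.depend, h.covariance_eq_zero hU2 hV2]
  · simp [Stat.depend, h.covariance_eq_zero hU2 hV2]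
  · simp only [Stat.depend]
    have := Measure.isProbabilityMeasure_map (μ := μ) hU.aemeasurable
    have := Measure.isProbabilityMeasure_map (μ := μ) hV.aemeasurable
    have hz : ∀ t, ∫ z, centeredInd (μ.map U) t (U z) ∂μ = 0 := fun t => by
      rw [← integral_centeredInd (ν := μ.map U) t, integral_map hU.aemeasurable]
      exact (measurable_centeredInd.comp
        (measurable_const.prodMk measurable_id)).aestronglyMeasurable
    have hm : ∀ {ν : Measure ℝ} [IsProbabilityMeasure ν] (t : ℝ),
        Measurable fun x => centeredInd ν t x := fun t =>
      measurable_centeredInd.comp (measurable_const.prodMk measurable_id)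
    have h0 : ∀ w : ℝ × ℝ, ∫ z, centeredInd (μ.map U) w.1 (U z) *
        centeredInd (μ.map V) w.2 (V z) ∂μ = 0 := fun w => by
      have hi := h.comp (hm (ν := μ.map U) w.1) (hm (ν := μ.map V) w.2)
      refine (hi.integral_fun_mul_eq_mul_integral
        ((hm _).comp hU).aestronglyMeasurable ((hm _).comp hV).aestronglyMeasurable).trans ?_
      simp only [Function.comp_apply, hz, zero_mul]
    rw [dCovSq_eq_integral hU hV hU2 hV2]
    simp [h0]

end

/-! ### Moments of the centered sums -/

section Moments

variable {p q : ℕ} {P : Measure (Vec p × Vec q)}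

lemma map_coord_fst (a : Fin p) : P.fst.map (fun w => w a) = P.map fun z => z.1 a := by
  rw [Measure.fst, Measure.map_map (by fun_prop) measurable_fst]; rfl

lemma map_coord_snd (b : Fin q) : P.snd.map (fun w => w b) = P.map fun z => z.2 b := by
  rw [Measure.snd, Measure.map_map (by fun_prop) measurable_snd]; rfl

variable [IsProbabilityMeasure P]

lemma Stat.isDegenerateKernel_coord (R : Stat) {V : Type*} [MeasurableSpace V] {Q : Measure V}
    [IsProbabilityMeasure Q] {U : V → ℝ} (hU : Measurable U) (hU2 : MemLp U 2 Q) :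
    IsDegenerateKernel (fun z z' => doubleCentered R.kernel (Q.map U) (U z) (U z')) Q := by
  have := Measure.isProbabilityMeasure_map (μ := Q) hU.aemeasurable
  exact (R.isDegenerateKernel (memLp_id_map hU hU2)).comp hU

lemma Stat.isDegenerateKernel_coord_fst (R : Stat) (h : ∀ a, MemLp (fun z => z.1 a) 2 P)
    (a : Fin p) :
    IsDegenerateKernel (fun z z' : Vec p × Vec q => centeredCoord R.kernel P.fst a z.1 z'.1) P := by
  simp only [centeredCoord, map_coord_fst]
  exact R.isDegenerateKernel_coord (U := fun z : Vec p × Vec q => z.1 a) (by fun_prop) (h a)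

lemma Stat.isDegenerateKernel_coord_snd (R : Stat) (h : ∀ b, MemLp (fun z => z.2 b) 2 P)
    (b : Fin q) :
    IsDegenerateKernel (fun z z' : Vec p × Vec q => centeredCoord R.kernel P.snd b z.2 z'.2) P := by
  simp only [centeredCoord, map_coord_snd]
  exact R.isDegenerateKernel_coord (U := fun z : Vec p × Vec q => z.2 b) (by fun_prop) (h b)

lemma Stat.isDegenerateKernel_sum_fst (R : Stat) (h : ∀ a, MemLp (fun z => z.1 a) 2 P) :
    IsDegenerateKernel (fun z z' : Vec p × Vec q => centeredSum R.kernel P.fst z.1 z'.1) P :=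
  (IsDegenerateKernel.sum fun a _ => R.isDegenerateKernel_coord_fst h a).const_mul _

lemma Stat.isDegenerateKernel_sum_snd (R : Stat) (h : ∀ b, MemLp (fun z => z.2 b) 2 P) :
    IsDegenerateKernel (fun z z' : Vec p × Vec q => centeredSum R.kernel P.snd z.2 z'.2) P :=
  (IsDegenerateKernel.sum fun b _ => R.isDegenerateKernel_coord_snd h b).const_mul _

lemma integral_sum_mul_sum {V α β : Type*} [MeasurableSpace V] {Q : Measure V}
    [Fintype α] [Fintype β] {κ : α → V → V → ℝ} {lam : β → V → V → ℝ}
    (hκ : ∀ a, IsDegenerateKernel (κ a) Q) (hl : ∀ b, IsDegenerateKernel (lam b) Q) (c d : ℝ) :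
    ∫ z : V × V, (c * ∑ a, κ a z.1 z.2) * (d * ∑ b, lam b z.1 z.2) ∂(Q.prod Q) =
      c * d * ∑ a, ∑ b, ∫ z : V × V, κ a z.1 z.2 * lam b z.1 z.2 ∂(Q.prod Q) := by
  have h : ∀ z : V × V, (c * ∑ a, κ a z.1 z.2) * (d * ∑ b, lam b z.1 z.2) =
      c * d * ∑ a, ∑ b, κ a z.1 z.2 * lam b z.1 z.2 := fun z => by
    rw [← Finset.sum_mul_sum]; ring
  have hi : ∀ a b, Integrable (fun z : V × V => κ a z.1 z.2 * lam b z.1 z.2) (Q.prod Q) :=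
    fun a b => (hκ a).memLp.integrable_mul (hl b).memLp
  simp_rw [h]
  rw [integral_const_mul, integral_finsetSum _ fun a _ => integrable_finsetSum _ fun b _ => hi a b]
  congr 1
  exact Finset.sum_congr rfl fun a _ => integral_finsetSum _ fun b _ => hi a b

variable {n : ℕ} {Ω : Type*} [MeasurableSpace Ω] {Pr : Measure Ω} [IsProbabilityMeasure Pr]
  {X : Fin n → Ω → Vec p} {Y : Fin n → Ω → Vec q}

lemma Stat.covariance_coord_fst (R : Stat) (h : ∀ a, MemLp (fun z => z.1 a) 2 P)
    (hZ : ∀ s, HasLaw (fun ω => (X s ω, Y s ω)) P Pr)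
    (hi : iIndepFun (fun s ω => (X s ω, Y s ω)) Pr) {s t : Fin n} (hst : s ≠ t) (a b : Fin p) :
    cov[fun ω => centeredCoord R.kernel P.fst a (X s ω) (X t ω),
      fun ω => centeredCoord R.kernel P.fst b (X s ω) (X t ω); Pr] =
      R.factor * R.depend P (fun z => z.1 a) (fun z => z.1 b) := by
  rw [← R.integral_doubleCentered_mul (by fun_prop) (by fun_prop) (h a) (h b),
    (R.isDegenerateKernel_coord_fst h a).covariance_sample hZ hi
      (R.isDegenerateKernel_coord_fst h b) hst]
  simp only [centeredCoord, map_coord_fst]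

lemma Stat.covariance_coord_snd (R : Stat) (h : ∀ a, MemLp (fun z => z.2 a) 2 P)
    (hZ : ∀ s, HasLaw (fun ω => (X s ω, Y s ω)) P Pr)
    (hi : iIndepFun (fun s ω => (X s ω, Y s ω)) Pr) {s t : Fin n} (hst : s ≠ t) (a b : Fin q) :
    cov[fun ω => centeredCoord R.kernel P.snd a (Y s ω) (Y t ω),
      fun ω => centeredCoord R.kernel P.snd b (Y s ω) (Y t ω); Pr] =
      R.factor * R.depend P (fun z => z.2 a) (fun z => z.2 b) := by
  rw [← R.integral_doubleCentered_mul (by fun_prop) (by fun_prop) (h a) (h b),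
    (R.isDegenerateKernel_coord_snd h a).covariance_sample hZ hi
      (R.isDegenerateKernel_coord_snd h b) hst]
  simp only [centeredCoord, map_coord_snd]

lemma Stat.covariance_coord_fst_snd (R : Stat) (h : ∀ a, MemLp (fun z => z.1 a) 2 P)
    (h' : ∀ a, MemLp (fun z => z.2 a) 2 P)
    (hZ : ∀ s, HasLaw (fun ω => (X s ω, Y s ω)) P Pr)
    (hi : iIndepFun (fun s ω => (X s ω, Y s ω)) Pr) {s t : Fin n} (hst : s ≠ t) (a : Fin p)
    (b : Fin q) :
    cov[fun ω => centeredCoord R.kernel P.fst a (X s ω) (X t ω),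
      fun ω => centeredCoord R.kernel P.snd b (Y s ω) (Y t ω); Pr] =
      R.factor * R.depend P (fun z => z.1 a) (fun z => z.2 b) := by
  rw [← R.integral_doubleCentered_mul (by fun_prop) (by fun_prop) (h a) (h' b),
    (R.isDegenerateKernel_coord_fst h a).covariance_sample hZ hi
      (R.isDegenerateKernel_coord_snd h' b) hst]
  simp only [centeredCoord, map_coord_fst, map_coord_snd]

lemma Stat.integral_sum_fst_mul (R : Stat) (h : ∀ a, MemLp (fun z => z.1 a) 2 P) :
    ∫ z, centeredSum R.kernel P.fst z.1.1 z.2.1 * centeredSum R.kernel P.fst z.1.1 z.2.1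
      ∂(P.prod P) =
      1 / (p : ℝ) * ∑ a, ∑ b, R.factor * R.depend P (fun z => z.1 a) (fun z => z.1 b) := by
  have h1 := integral_sum_mul_sum (R.isDegenerateKernel_coord_fst h)
    (R.isDegenerateKernel_coord_fst h) (√(p : ℝ))⁻¹ (√(p : ℝ))⁻¹
  refine h1.trans ?_
  congr 1
  · rw [← mul_inv, Real.mul_self_sqrt (Nat.cast_nonneg _), one_div]
  · refine Finset.sum_congr rfl fun a _ => Finset.sum_congr rfl fun b _ => ?_
    rw [← R.integral_doubleCentered_mul (by fun_prop) (by fun_prop) (h a) (h b)]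
    simp only [centeredCoord, map_coord_fst]

lemma Stat.integral_sum_snd_mul (R : Stat) (h : ∀ a, MemLp (fun z => z.2 a) 2 P) :
    ∫ z, centeredSum R.kernel P.snd z.1.2 z.2.2 * centeredSum R.kernel P.snd z.1.2 z.2.2
      ∂(P.prod P) =
      1 / (q : ℝ) * ∑ a, ∑ b, R.factor * R.depend P (fun z => z.2 a) (fun z => z.2 b) := by
  have h1 := integral_sum_mul_sum (R.isDegenerateKernel_coord_snd h)
    (R.isDegenerateKernel_coord_snd h) (√(q : ℝ))⁻¹ (√(q : ℝ))⁻¹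
  refine h1.trans ?_
  congr 1
  · rw [← mul_inv, Real.mul_self_sqrt (Nat.cast_nonneg _), one_div]
  · refine Finset.sum_congr rfl fun a _ => Finset.sum_congr rfl fun b _ => ?_
    rw [← R.integral_doubleCentered_mul (by fun_prop) (by fun_prop) (h a) (h b)]
    simp only [centeredCoord, map_coord_snd]

end Moments

/-! ### The limit of the ratio and the covariances of the limit -/

section Limit

variable {ι : Type*} {p q : ι → ℕ} {P : ∀ i, Measure (Vec (p i) × Vec (q i))}

lemma MomentBounds.memLp_fst (D1 : MomentBounds P) (i : ι) (a : Fin (p i)) :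
    MemLp (fun z => z.1 a) 2 (P i) := by
  obtain ⟨⟨_, _, _, h⟩, _⟩ := D1; exact (h i a).1

lemma MomentBounds.memLp_snd (D1 : MomentBounds P) (i : ι) (a : Fin (q i)) :
    MemLp (fun z => z.2 a) 2 (P i) := by
  obtain ⟨_, ⟨_, _, _, h⟩⟩ := D1; exact (h i a).1

variable {l : Filter ι} {n : ℕ} [∀ i, IsProbabilityMeasure (P i)]
  {Ω : ι → Type*} [∀ i, MeasurableSpace (Ω i)] {Pr : ∀ i, Measure (Ω i)}
  [∀ i, IsProbabilityMeasure (Pr i)]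
  {X : ∀ i, Fin n → Ω i → Vec (p i)} {Y : ∀ i, Fin n → Ω i → Vec (q i)}
  {R : Stat} {σx2 σy2 σxy2 φ : ℝ}

lemma JointCLT.tendsto_depend (hlaw : ∀ i s, HasLaw (fun ω => (X i s ω, Y i s ω)) (P i) (Pr i))
    (hindep : ∀ i, iIndepFun (fun s ω => (X i s ω, Y i s ω)) (Pr i)) (D1 : MomentBounds P)
    (D3 : JointCLT l R.kernel P Pr X Y σx2 σy2 σxy2) (hn : 4 ≤ n) :
    Tendsto (fun i => 1 / (p i : ℝ) * ∑ a, ∑ b,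
      R.factor * R.depend (P i) (fun z => z.1 a) (fun z => z.1 b)) l (𝓝 σx2) ∧
    Tendsto (fun i => 1 / (q i : ℝ) * ∑ a, ∑ b,
      R.factor * R.depend (P i) (fun z => z.2 a) (fun z => z.2 b)) l (𝓝 σy2) ∧
    Tendsto (fun i => 1 / √((p i : ℝ) * q i) * ∑ a, ∑ b,
      R.factor * R.depend (P i) (fun z => z.1 a) (fun z => z.2 b)) l (𝓝 σxy2) := by
  -- Any pair would do, since the covariances do not depend on it.
  let st : Pairs n := ⟨(⟨0, by omega⟩, ⟨1, by omega⟩), by simp⟩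
  have hst : st.1.1 ≠ st.1.2 := st.2.ne
  refine ⟨(D3.tendsto_x st).congr fun i => ?_, (D3.tendsto_y st).congr fun i => ?_,
    (D3.tendsto_xy st).congr fun i => ?_⟩
  · simp only [R.covariance_coord_fst (D1.memLp_fst i) (hlaw i) (hindep i) hst]
  · simp only [R.covariance_coord_snd (D1.memLp_snd i) (hlaw i) (hindep i) hst]
  · simp only [R.covariance_coord_fst_snd (D1.memLp_fst i) (D1.memLp_snd i) (hlaw i) (hindep i) hst]

/-- The ratio of the measures of dependence converges to the correlation of the limit. -/
lemma JointCLT.tendsto_phiRatio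
    (hlaw : ∀ i s, HasLaw (fun ω => (X i s ω, Y i s ω)) (P i) (Pr i))
    (hindep : ∀ i, iIndepFun (fun s ω => (X i s ω, Y i s ω)) (Pr i)) (D1 : MomentBounds P)
    (D3 : JointCLT l R.kernel P Pr X Y σx2 σy2 σxy2) (hn : 4 ≤ n)
    (hp : Tendsto p l atTop) (hq : Tendsto q l atTop) (hσx : 0 < σx2) (hσy : 0 < σy2) :
    Tendsto (fun i => R.phiRatio (P i)) l (𝓝 (σxy2 / √(σx2 * σy2))) := by
  obtain ⟨hx, hy, hxy⟩ := D3.tendsto_depend hlaw hindep D1 hn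
  refine (hxy.div ((hx.mul hy).sqrt) (Real.sqrt_pos.2 (mul_pos hσx hσy)).ne').congr' ?_
  filter_upwards [hp.eventually_gt_atTop 0, hq.eventually_gt_atTop 0] with i hpi hqi
  have h1 : (0 : ℝ) < p i := by exact_mod_cast hpi
  have h2 : (0 : ℝ) < q i := by exact_mod_cast hqi
  have hf := R.factor_pos
  simp only [Pi.div_apply, ← Finset.mul_sum, Stat.phiRatio]
  set A := ∑ a, ∑ b, R.depend (P i) (fun z => z.1 a) (fun z => z.1 b)
  set B := ∑ a, ∑ b, R.depend (P i) (fun z => z.2 a) (fun z => z.2 b)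
  set C := ∑ a, ∑ b, R.depend (P i) (fun z => z.1 a) (fun z => z.2 b)
  -- The common normalization `factor / √(p q)` of numerator and denominator cancels in the ratio.
  have h3 : 1 / (p i : ℝ) * (R.factor * A) * (1 / (q i : ℝ) * (R.factor * B)) =
      R.factor ^ 2 / (p i * q i) * (A * B) := by field_simp
  rw [h3, Real.sqrt_mul (show 0 ≤ R.factor ^ 2 / ((p i : ℝ) * q i) by positivity), Real.sqrt_div (sq_nonneg _), Real.sqrt_sq hf.le]
  have h4 : 0 < √((p i : ℝ) * q i) := Real.sqrt_pos.2 (mul_pos h1 h2)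
  have h5 : 1 / √((p i : ℝ) * q i) * (R.factor * C) = R.factor / √((p i : ℝ) * q i) * C := by
    ring
  rw [h5, mul_div_mul_left _ _ (by positivity)]

/-- Passing to the limit gives `0 ≤ φ`, so that `φ < 1` already means `φ² < 1` and the sign of the
noncentrality is determined. -/
lemma MomentBounds.phiRatio_nonneg (D1 : MomentBounds P) (R : Stat) (i : ι) :
    0 ≤ R.phiRatio (P i) :=
  div_nonneg (Finset.sum_nonneg fun a _ => Finset.sum_nonneg fun b _ =>
    R.depend_nonneg (by fun_prop) (by fun_prop) (D1.memLp_fst i a) (D1.memLp_snd i b))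
    (Real.sqrt_nonneg _)

/-- The limit is centered, and its entries that belong to different pairs of observations are
uncorrelated. -/
lemma JointCLT.exists_gaussian [l.NeBot]
    (hlaw : ∀ i s, HasLaw (fun ω => (X i s ω, Y i s ω)) (P i) (Pr i))
    (hindep : ∀ i, iIndepFun (fun s ω => (X i s ω, Y i s ω)) (Pr i)) (D1 : MomentBounds P)
    (D3 : JointCLT l R.kernel P Pr X Y σx2 σy2 σxy2) (hn : 4 ≤ n) :
    ∃ (G : Measure ((Pairs n → ℝ) × (Pairs n → ℝ))) (_ : IsGaussian G),
      (∀ a, ∫ z, z.1 a ∂G = 0) ∧ (∀ a, ∫ z, z.2 a ∂G = 0) ∧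
      (∀ a b, cov[fun z => z.1 a, fun z => z.1 b; G] = if a = b then σx2 else 0) ∧
      (∀ a b, cov[fun z => z.2 a, fun z => z.2 b; G] = if a = b then σy2 else 0) ∧
      (∀ a b, cov[fun z => z.1 a, fun z => z.2 b; G] = if a = b then σxy2 else 0) ∧
      TendstoInDistribution
        (fun i ω =>
          ((fun st => centeredSum R.kernel (P i).fst (X i st.1.1 ω) (X i st.1.2 ω),
            fun uv => centeredSum R.kernel (P i).snd (Y i uv.1.1 ω) (Y i uv.1.2 ω)) :
            (Pairs n → ℝ) × (Pairs n → ℝ)))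
        l id Pr G := by
  obtain ⟨tx, ty, -⟩ := D3.tendsto_depend hlaw hindep D1 hn
  obtain ⟨G, hG, vx, vy, vxy, hT⟩ := D3.clt
  have kx := fun i => R.isDegenerateKernel_sum_fst (P := P i) (D1.memLp_fst i)
  have ky := fun i => R.isDegenerateKernel_sum_snd (P := P i) (D1.memLp_snd i)
  have mx : ∀ (st : Pairs n) i, MemLp
      (fun ω => centeredSum R.kernel (P i).fst (X i st.1.1 ω) (X i st.1.2 ω)) 2 (Pr i) :=
    fun st i => (kx i).memLp_sample (hlaw i) (hindep i) st.2.ne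
  have my : ∀ (st : Pairs n) i, MemLp
      (fun ω => centeredSum R.kernel (P i).snd (Y i st.1.1 ω) (Y i st.1.2 ω)) 2 (Pr i) :=
    fun st i => (ky i).memLp_sample (hlaw i) (hindep i) st.2.ne
  have sx : ∀ st : Pairs n, Tendsto (fun i =>
      ∫ ω, centeredSum R.kernel (P i).fst (X i st.1.1 ω) (X i st.1.2 ω) ^ 2 ∂(Pr i)) l
        (𝓝 σx2) := fun st => tx.congr fun i => by
    rw [← R.integral_sum_fst_mul (D1.memLp_fst i)]
    simp only [sq]
    exact ((kx i).integral_sample_mul (hlaw i) (hindep i) (kx i) st.2.ne).symm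
  have sy : ∀ st : Pairs n, Tendsto (fun i =>
      ∫ ω, centeredSum R.kernel (P i).snd (Y i st.1.1 ω) (Y i st.1.2 ω) ^ 2 ∂(Pr i)) l
        (𝓝 σy2) := fun st => ty.congr fun i => by
    rw [← R.integral_sum_snd_mul (D1.memLp_snd i)]
    simp only [sq]
    exact ((ky i).integral_sample_mul (hlaw i) (hindep i) (ky i) st.2.ne).symm
  have gx : ∀ a : Pairs n, MemLp (fun z => z.1 a) 2 G := IsGaussian.memLp_fst
  have gy : ∀ a : Pairs n, MemLp (fun z => z.2 a) 2 G := IsGaussian.memLp_snd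
  have cx : ∀ a : Pairs n, Continuous fun z : (Pairs n → ℝ) × (Pairs n → ℝ) => z.1 a :=
    fun a => by fun_prop
  have cy : ∀ a : Pairs n, Continuous fun z : (Pairs n → ℝ) × (Pairs n → ℝ) => z.2 a :=
    fun a => by fun_prop
  -- Once the mean is known to vanish, the second moments of the limit equal its variances, hence
  -- are the limits of the sample moments; this is what the mixed moment lemma requires.
  have x0 : ∀ a, ∫ z, z.1 a ∂G = 0 := fun a =>
    integral_eq_zero_of_tendsto_variance hT (cx a) (gx a) (mx a) (by rw [vx]; exact sx a)
  have y0 : ∀ a, ∫ z, z.2 a ∂G = 0 := fun a =>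
    integral_eq_zero_of_tendsto_variance hT (cy a) (gy a) (my a) (by rw [vy]; exact sy a)
  have x2 : ∀ a, ∫ z, z.1 a ^ 2 ∂G = σx2 := fun a => by
    rw [← vx a, variance_eq_sub (gx a), x0, zero_pow two_ne_zero, sub_zero]; rfl
  have y2 : ∀ a, ∫ z, z.2 a ^ 2 ∂G = σy2 := fun a => by
    rw [← vy a, variance_eq_sub (gy a), y0, zero_pow two_ne_zero, sub_zero]; rfl
  have zero : ∀ {c d : Pairs n → (Pairs n → ℝ) × (Pairs n → ℝ) → ℝ} {a b : Pairs n},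
      MemLp (c a) 2 G → MemLp (d b) 2 G → ∫ z, c a z ∂G = 0 → ∫ z, c a z * d b z ∂G = 0 →
      cov[c a, d b; G] = 0 := fun hc hd h0 h1 => by
    rw [covariance_eq_sub hc hd, h0, zero_mul, sub_zero]; exact h1
  refine ⟨G, hG, x0, y0, fun a b => ?_, fun a b => ?_, fun a b => ?_, hT⟩
  · split_ifs with hab
    · subst hab; rw [covariance_self (gx a).aemeasurable, vx]
    · refine zero (c := fun a z => z.1 a) (d := fun a z => z.1 a) (gx a) (gx b) (x0 a) ?_
      refine integral_mul_eq_of_tendstoInDistribution hT (cx a) (cx b) (gx a) (gx b) (mx a) (mx b)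
        (by rw [x2]; exact sx a) (by rw [x2]; exact sx b) (tendsto_const_nhds.congr fun i => ?_)
      exact ((kx i).integral_sample_mul_of_ne (hlaw i) (hindep i) (kx i) hab).symm
  · split_ifs with hab
    · subst hab; rw [covariance_self (gy a).aemeasurable, vy]
    · refine zero (c := fun a z => z.2 a) (d := fun a z => z.2 a) (gy a) (gy b) (y0 a) ?_
      refine integral_mul_eq_of_tendstoInDistribution hT (cy a) (cy b) (gy a) (gy b) (my a) (my b)
        (by rw [y2]; exact sy a) (by rw [y2]; exact sy b) (tendsto_const_nhds.congr fun i => ?_)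
      exact ((ky i).integral_sample_mul_of_ne (hlaw i) (hindep i) (ky i) hab).symm
  · split_ifs with hab
    · subst hab; exact vxy a
    · refine zero (c := fun a z => z.1 a) (d := fun a z => z.2 a) (gx a) (gy b) (x0 a) ?_
      refine integral_mul_eq_of_tendstoInDistribution hT (cx a) (cy b) (gx a) (gy b) (mx a) (my b)
        (by rw [x2]; exact sx a) (by rw [y2]; exact sy b) (tendsto_const_nhds.congr fun i => ?_)
      exact ((kx i).integral_sample_mul_of_ne (hlaw i) (hindep i) (ky i) hab).symm

end Limit

/-! ### Expansion of the sample statistics -/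

/-- The matrix of (transformed) distances of a sample that belongs to a statistic. -/
noncomputable def Stat.mat (R : Stat) (f : ℝ → ℝ) {n d : ℕ} (x : Fin n → Vec d) (s t : Fin n) : ℝ :=
  match R with
  | .dCov => ‖x s - x t‖
  | .hCov => f (‖x s - x t‖ / bandwidth x)
  | .mdCov => ∑ i, |x s i - x t i|

/-- The slope of the transformation of the distances. -/
noncomputable def Stat.slope (R : Stat) (f : ℝ → ℝ) : ℝ :=
  match R with
  | .dCov => 1
  | .hCov => deriv f 1
  | .mdCov => 1

lemma Stat.studentized_eq (R : Stat) (f g : ℝ → ℝ) {n p q : ℕ} (hn : 2 ≤ n) (x : Fin n → Vec p)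
    (y : Fin n → Vec q) :
    R.studentized f g x y = studentizedRatio ((dof n : ℝ) - 1) (uInner (R.mat f x) (R.mat g y))
      (uInner (R.mat f x) (R.mat f x)) (uInner (R.mat g y) (R.mat g y)) := by
  cases R
  · rfl
  · rfl
  · have h : ∀ {d e : ℕ} (x : Fin n → Vec d) (y : Fin n → Vec e), mdCovSample x y =
        -- The factor is written as `r * s` with `r = s`, the form that `studentizedRatio_scale`
        -- removes.
        √(√(n.choose 2 : ℝ)) * √(√(n.choose 2 : ℝ)) *
          uInner (Stat.mdCov.mat f x) (Stat.mdCov.mat g y) := fun x y => by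
      rw [Real.mul_self_sqrt (Real.sqrt_nonneg _), mdCovSample]
      congr 1
      exact sum_sum_uInner (fun i s t => |x s i - x t i|) fun i s t => |y s i - y t i|
    have hpos : 0 < √(√(n.choose 2 : ℝ)) * √(√(n.choose 2 : ℝ)) := by
      have : (0 : ℝ) < n.choose 2 := by exact_mod_cast Nat.choose_pos hn
      positivity
    rw [← studentizedRatio_scale _ _ _ _ hpos]
    simp only [Stat.studentized, Stat.normalized, Stat.sample, h, studentizedRatio]
    rfl

lemma studentizedRatio_eq_pairStat {n : ℕ} {A B : Fin n → Fin n → ℝ} {a b : Pairs n → ℝ}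
    {c d : ℝ} (hcd : 0 < c * d) (hA : ∀ s t, uCenter A s t = c * uCenter (symMat a) s t)
    (hB : ∀ s t, uCenter B s t = d * uCenter (symMat b) s t) :
    studentizedRatio ((dof n : ℝ) - 1) (uInner A B) (uInner A A) (uInner B B) = pairStat (a, b) := by
  rw [uInner_of_uCenter hA hB, uInner_of_uCenter hA hA, uInner_of_uCenter hB hB,
    studentizedRatio_scale _ _ _ _ hcd, pairStat]

/-- A sum of kernels is, up to additive terms, the centered sum. -/
lemma exists_sum_kernel_eq {k : ℝ → ℝ → ℝ} (hk : ∀ x y, k x y = k y x) {d : ℕ} (hd : 0 < d)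
    (Q : Measure (Vec d)) : ∃ H : Vec d → ℝ, ∀ x x',
      ∑ i, k (x i) (x' i) = √(d : ℝ) * centeredSum k Q x x' + (H x + H x') := by
  let ν : Fin d → Measure ℝ := fun i => Q.map fun w => w i
  -- The total mean is divided equally between the two observations to keep the additive part
  -- symmetric.
  refine ⟨fun x => ∑ i, ((∫ y', k (x i) y' ∂(ν i)) - (∫ x', ∫ y', k x' y' ∂(ν i) ∂(ν i)) / 2),
    fun x x' => ?_⟩
  have h0 : √(d : ℝ) ≠ 0 := (Real.sqrt_pos.2 (by exact_mod_cast hd)).ne'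
  rw [centeredSum, mul_inv_cancel_left₀ h0, ← Finset.sum_add_distrib, ← Finset.sum_add_distrib]
  refine Finset.sum_congr rfl fun i _ => ?_
  simp only [centeredCoord, doubleCentered, hk _ (x' i), ν]
  ring

lemma norm_sub_sq_eq_sum {d : ℕ} (x x' : Vec d) : ‖x - x'‖ ^ 2 = ∑ i, |x i - x' i| ^ 2 := by
  rw [EuclideanSpace.norm_sq_eq]; rfl

/-- `L` is `√(1 + L) - 1` times `√(1 + L) + 1 ≥ 1`. The bound needs no smallness of `L`. -/
lemma abs_sqrt_one_add_sub_one_le {L : ℝ} (hL : -1 ≤ L) : |√(1 + L) - 1| ≤ |L| := by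
  have h := Real.sq_sqrt (show 0 ≤ 1 + L by linarith)
  have h0 := Real.sqrt_nonneg (1 + L)
  have h1 : L = (√(1 + L) - 1) * (√(1 + L) + 1) := by linarith [h, sq (√(1 + L))]
  calc |√(1 + L) - 1| = |√(1 + L) - 1| * 1 := (mul_one _).symm
    _ ≤ |√(1 + L) - 1| * (√(1 + L) + 1) :=
      mul_le_mul_of_nonneg_left (by linarith) (abs_nonneg _)
    _ = |L| := by
      conv_rhs => rw [h1]
      rw [abs_mul, abs_of_nonneg (show 0 ≤ √(1 + L) + 1 by linarith)]

/-- The remainder is exactly `-(√(1 + L) - 1)² / 2`. -/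
lemma abs_sqrt_one_add_sub_le {L : ℝ} (hL : -1 ≤ L) : |√(1 + L) - 1 - L / 2| ≤ L ^ 2 / 2 := by
  have h := Real.sq_sqrt (show 0 ≤ 1 + L by linarith)
  have h1 : √(1 + L) - 1 - L / 2 = -((√(1 + L) - 1) ^ 2 / 2) := by
    have : L = √(1 + L) ^ 2 - 1 := by linarith
    nlinarith
  have h2 := abs_sqrt_one_add_sub_one_le hL
  rw [h1, abs_neg, abs_of_nonneg (by positivity), ← sq_abs, ← sq_abs L]
  gcongr

section Expansion

variable {n d : ℕ} {Q : Measure (Vec d)} {x : Fin n → Vec d}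

lemma neg_one_le_relDev (hτ : 0 < tauSq Q) (z : Vec d × Vec d) : -1 ≤ relDev Q z := by
  rw [relDev, le_div_iff₀ hτ]
  nlinarith [sq_nonneg ‖z.1 - z.2‖]

lemma norm_sub_eq_sqrt_relDev (hτ : 0 < tauSq Q) (z : Vec d × Vec d) :
    ‖z.1 - z.2‖ = √(tauSq Q) * √(1 + relDev Q z) := by
  have h : 1 + relDev Q z = ‖z.1 - z.2‖ ^ 2 / tauSq Q := by
    rw [relDev]; field_simp; ring
  rw [h, ← Real.sqrt_mul hτ.le, mul_div_cancel₀ _ hτ.ne', Real.sqrt_sq (norm_nonneg _)]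

/-- First order expansion of a function of the distances. -/
lemma exists_expansion (hn : 3 ≤ n) (hd : 0 < d) (hτ : 0 < tauSq Q) {F : ℝ → ℝ} {D C η : ℝ}
    (hD : D ≠ 0) (hF : ∀ u, |u - 1| ≤ η → |F u - F 1 - D * (u - 1)| ≤ C * (u - 1) ^ 2)
    (hC : 0 ≤ C) {γ ε : ℝ} (hε : ε ≤ 1 / 2) (hεη : 4 * ε ≤ η) (hγ : |γ / √(tauSq Q) - 1| ≤ ε)
    (hL : ∀ s t, s ≠ t → |relDev Q (x s, x t)| ≤ ε) :
    ∃ a : Pairs n → ℝ,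
      (∀ p : Pairs n, |a p - centeredSum (fun x y => |x - y| ^ 2) Q (x p.1.1) (x p.1.2)| ≤
        tauSq Q / √(d : ℝ) * ((1 + 48 * C / |D|) * ε ^ 2)) ∧
      ∃ c, 0 < c * D ∧ ∀ s t,
        uCenter (fun s t => F (‖x s - x t‖ / γ)) s t = c * uCenter (symMat a) s t := by
  have hε0 : 0 ≤ ε := (abs_nonneg _).trans hγ
  have hd' : (0 : ℝ) < √(d : ℝ) := Real.sqrt_pos.2 (by exact_mod_cast hd)
  obtain ⟨H, hH⟩ := exists_sum_kernel_eq (k := fun x y => |x - y| ^ 2)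
    (fun x y => by rw [abs_sub_comm]) hd Q
  have hD' := abs_pos.2 hD
  set τ := √(tauSq Q) with hτdef
  have hτ0 : 0 < τ := Real.sqrt_pos.2 hτ
  have hτ2 : τ ^ 2 = tauSq Q := Real.sq_sqrt hτ.le
  set κ := γ / τ with hκ
  have hκ1 : 1 / 2 ≤ κ := by linarith [(abs_le.1 hγ).1]
  have hκ2 : κ ≤ 3 / 2 := by linarith [(abs_le.1 hγ).2]
  have hκ0 : 0 < κ := by linarith
  have hγκ : γ = κ * τ := by rw [hκ]; field_simp
  let K : Vec d → Vec d → ℝ := centeredSum (fun x y => |x - y| ^ 2) Q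
  -- With `u = √(1 + L) / κ`, the coefficient of `L` in the expansion is `D / (2 κ)`, and `L = (√d K
  -- + H + H') / τ² - 1`; thus `c` is the coefficient of `K`.
  let c := D * √(d : ℝ) / (2 * κ * tauSq Q)
  have hc : c ≠ 0 := by
    have := hτ.ne'; have := hκ0.ne'; have := hd'.ne'
    positivity
  -- Half of all constants of the expansion, together with the contribution of one observation.
  let h : Fin n → ℝ := fun s => (F 1 - D) / 2 + D / κ * (1 / 4) + D / (2 * κ) * (H (x s) / tauSq Q)
  let A : Fin n → Fin n → ℝ := fun s t => (F (‖x s - x t‖ / γ) - (h s + h t)) / c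
  have hA : ∀ s t, A s t = A t s := fun s t => by
    simp only [A, norm_sub_rev (x s), add_comm (h s)]
  refine ⟨fun p => A p.1.1 p.1.2, fun p => ?_, c, ?_, fun s t => ?_⟩
  · obtain ⟨⟨s, t⟩, hst⟩ := p
    simp only
    have hne : s ≠ t := ne_of_lt hst
    have hL1 := hL s t hne
    have hLm := neg_one_le_relDev hτ (x s, x t)
    set L := relDev Q (x s, x t) with hLdef
    have hu : ‖x s - x t‖ / γ = √(1 + L) / κ := by
      have := norm_sub_eq_sqrt_relDev hτ (x s, x t)
      simp only at this
      rw [this, hγκ, ← hτdef, ← hLdef]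
      field_simp
    set u := ‖x s - x t‖ / γ
    have hLK : L = (√(d : ℝ) * K (x s) (x t) + (H (x s) + H (x t))) / tauSq Q - 1 := by
      rw [← hH, ← norm_sub_sq_eq_sum, hLdef, relDev]; field_simp
    have hs1 := abs_sqrt_one_add_sub_one_le hLm
    have hs2 := abs_sqrt_one_add_sub_le hLm
    -- Both `√(1 + L)` and `κ` are within `ε` of `1`, and dividing by `κ ≥ 1/2` doubles the sum.
    have hu1 : |u - 1| ≤ 4 * ε := by
      have h1 : u - 1 = ((√(1 + L) - 1) - (κ - 1)) / κ := by rw [hu]; field_simp; ring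
      rw [h1, abs_div, abs_of_pos hκ0, div_le_iff₀ hκ0]
      have := abs_sub (√(1 + L) - 1) (κ - 1)
      nlinarith
    have hE := hF u (hu1.trans hεη)
    have hu2 : (u - 1) ^ 2 ≤ 16 * ε ^ 2 := by
      rw [← sq_abs]; nlinarith [abs_nonneg (u - 1)]
    set E := F u - F 1 - D * (u - 1) with hEdef
    set ρ := √(1 + L) - 1 - L / 2 with hρ
    have hE' : |E| ≤ C * (16 * ε ^ 2) := hE.trans (mul_le_mul_of_nonneg_left hu2 hC)
    have hρ' : |ρ| ≤ ε ^ 2 / 2 := by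
      refine hs2.trans ?_
      rw [← sq_abs]
      have := abs_nonneg L
      gcongr
    have key : A s t - K (x s) (x t) =
        tauSq Q / √(d : ℝ) * (2 * ρ + 2 * κ * E / D) := by
      have h1 : F u = F 1 + D * ((1 + L / 2 + ρ) / κ - 1) + E := by
        have h1 : 1 + L / 2 + ρ = √(1 + L) := by rw [hρ]; ring
        rw [h1, ← hu, hEdef]; ring
      simp only [A]
      change (F u - (h s + h t)) / c - _ = _
      rw [div_sub' hc, div_eq_iff hc, h1, hLK]
      simp only [h, c]
      field_simp
      ring
    change |A s t - K (x s) (x t)| ≤ _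
    rw [key, abs_mul, abs_of_pos (div_pos hτ hd')]
    refine mul_le_mul_of_nonneg_left ?_ (div_pos hτ hd').le
    calc |2 * ρ + 2 * κ * E / D| ≤ |2 * ρ| + |2 * κ * E / D| := abs_add_le _ _
      _ = 2 * |ρ| + 2 * κ * |E| / |D| := by
        rw [abs_div, abs_mul, abs_mul, abs_of_pos (show 0 < 2 * κ by linarith)]; simp
      -- The bounds `κ ≤ 3/2` and `(u - 1)² ≤ 16 ε²` produce the constant `48`.
      _ ≤ 2 * (ε ^ 2 / 2) + 2 * (3 / 2) * (C * (16 * ε ^ 2)) / |D| := by gcongr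
      _ = _ := by ring
  · have h1 : c * D = D ^ 2 * √(d : ℝ) / (2 * κ * tauSq Q) := by simp only [c]; ring
    rw [h1]; positivity
  · refine uCenter_of_eq_mul_add hn (h := h) (fun s t hst => ?_) s t
    rw [symMat_restrict hA hst]
    simp only [A]
    field_simp
    ring

lemma median_mem_Icc {β : Type*} {m : Finset β} (hm : m.Nonempty) {a : β → ℝ} {lo hi : ℝ}
    (h : ∀ b ∈ m, a b ∈ Icc lo hi) : median m a ∈ Icc lo hi := by
  have hcard : 0 < m.card := hm.card_pos
  have h1 : ∀ x ∈ {x | m.card ≤ 2 * (m.filter fun b => a b ≤ x).card}, lo ≤ x := fun x hx => by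
    have : 0 < (m.filter fun b => a b ≤ x).card := by
      have : m.card ≤ 2 * (m.filter fun b => a b ≤ x).card := hx
      omega
    obtain ⟨b, hb⟩ := Finset.card_pos.1 this
    rw [Finset.mem_filter] at hb
    exact (h b hb.1).1.trans hb.2
  have h2 : ∀ x ∈ {x | m.card ≤ 2 * (m.filter fun b => x ≤ a b).card}, x ≤ hi := fun x hx => by
    have : 0 < (m.filter fun b => x ≤ a b).card := by
      have : m.card ≤ 2 * (m.filter fun b => x ≤ a b).card := hx
      omega
    obtain ⟨b, hb⟩ := Finset.card_pos.1 this
    rw [Finset.mem_filter] at hb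
    exact hb.2.trans (h b hb.1).2
  have h3 : hi ∈ {x | m.card ≤ 2 * (m.filter fun b => a b ≤ x).card} := by
    have : (m.filter fun b => a b ≤ hi) = m := Finset.filter_true_of_mem fun b hb => (h b hb).2
    change m.card ≤ 2 * (m.filter fun b => a b ≤ hi).card
    rw [this]; omega
  have h4 : lo ∈ {x | m.card ≤ 2 * (m.filter fun b => x ≤ a b).card} := by
    have : (m.filter fun b => lo ≤ a b) = m := Finset.filter_true_of_mem fun b hb => (h b hb).1
    change m.card ≤ 2 * (m.filter fun b => lo ≤ a b).card
    rw [this]; omega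
  have h5 := csInf_le ⟨lo, h1⟩ h3
  have h6 := le_csInf ⟨hi, h3⟩ h1
  have h7 := le_csSup ⟨hi, h2⟩ h4
  have h8 := csSup_le ⟨lo, h4⟩ h2
  rw [median]
  constructor <;> linarith

/-- The median lies between the extreme distances, all of which lie in `τ (1 ± ε)`. The random
bandwidth therefore needs no probabilistic argument of its own. -/
lemma abs_bandwidth_div_sub_one_le (hn : 2 ≤ n) (hτ : 0 < tauSq Q) {ε : ℝ}
    (hL : ∀ s t, s ≠ t → |relDev Q (x s, x t)| ≤ ε) :
    |bandwidth x / √(tauSq Q) - 1| ≤ ε := by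
  have hτ0 : 0 < √(tauSq Q) := Real.sqrt_pos.2 hτ
  have hne : (Finset.univ : Finset (Fin n)).offDiag.Nonempty :=
    ⟨(⟨0, by omega⟩, ⟨1, by omega⟩), by simp⟩
  have h := median_mem_Icc hne (a := fun st : Fin n × Fin n => ‖x st.1 - x st.2‖)
    (lo := √(tauSq Q) * (1 - ε)) (hi := √(tauSq Q) * (1 + ε)) fun st hst => by
      have h1 := norm_sub_eq_sqrt_relDev hτ (x st.1, x st.2)
      have h2 := (abs_sqrt_one_add_sub_one_le (neg_one_le_relDev hτ (x st.1, x st.2))).trans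
        (hL st.1 st.2 (by simpa using hst))
      rw [abs_le] at h2
      simp only at h1
      rw [h1]
      exact ⟨mul_le_mul_of_nonneg_left (by linarith) hτ0.le,
        mul_le_mul_of_nonneg_left (by linarith) hτ0.le⟩
  change bandwidth x ∈ _ at h
  have h1 : bandwidth x / √(tauSq Q) - 1 = (bandwidth x - √(tauSq Q)) / √(tauSq Q) := by
    field_simp
  rw [h1, abs_div, abs_of_pos hτ0, div_le_iff₀ hτ0, abs_le]
  constructor <;> linarith [h.1, h.2]

end Expansion

/-- Quadratic bound for the remainder of the first order expansion of a kernel profile. -/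
lemma exists_quadratic_remainder {f : ℝ → ℝ} (hf : ContDiffAt ℝ 2 f 1) :
    ∃ C η : ℝ, 0 ≤ C ∧ 0 < η ∧
      ∀ u, |u - 1| ≤ η → |f u - f 1 - deriv f 1 * (u - 1)| ≤ C * (u - 1) ^ 2 := by
  have h1 : DifferentiableAt ℝ (deriv f) 1 := by
    have h : DifferentiableAt ℝ (fderiv ℝ f) 1 :=
      (hf.fderiv_right (m := 1) (by norm_num)).differentiableAt (by norm_num)
    exact h.clm_apply (differentiableAt_const (1 : ℝ))
  obtain ⟨C, hC, hC'⟩ := (h1.isBigO_sub).exists_pos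
  have h2 : ∀ᶠ y in 𝓝 (1 : ℝ), ContDiffAt ℝ 2 f y := hf.eventually (by simp)
  obtain ⟨η, hη, h⟩ := Metric.nhds_basis_closedBall.eventually_iff.1 (h2.and hC'.bound)
  refine ⟨C, η, hC.le, hη, fun u hu => ?_⟩
  have hmem : ∀ v ∈ Metric.closedBall (1 : ℝ) |u - 1|, v ∈ Metric.closedBall (1 : ℝ) η :=
    fun v hv => Metric.closedBall_subset_closedBall hu hv
  -- Mean value inequality for `f v - f'(1) v` on the ball of radius `|u - 1|`: its derivative there
  -- is at most `C |u - 1|`, because `f'` is differentiable at `1`.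
  have hd : ∀ v ∈ Metric.closedBall (1 : ℝ) |u - 1|,
      HasDerivWithinAt (fun v => f v - deriv f 1 * v) (deriv f v - deriv f 1)
        (Metric.closedBall (1 : ℝ) |u - 1|) v := fun v hv => by
    have := ((h (hmem v hv)).1.differentiableAt (by norm_num)).hasDerivAt
    have h' := (this.sub ((hasDerivAt_id v).const_mul (deriv f 1))).hasDerivWithinAt
      (s := Metric.closedBall (1 : ℝ) |u - 1|)
    rw [mul_one] at h'
    exact h'
  have hb : ∀ v ∈ Metric.closedBall (1 : ℝ) |u - 1|, ‖deriv f v - deriv f 1‖ ≤ C * |u - 1| :=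
    fun v hv => ((h (hmem v hv)).2).trans (mul_le_mul_of_nonneg_left hv hC.le)
  have := (convex_closedBall (1 : ℝ) |u - 1|).norm_image_sub_le_of_norm_hasDerivWithin_le hd hb
    (Metric.mem_closedBall_self (abs_nonneg _)) (show u ∈ _ from le_of_eq (Real.dist_eq u 1))
  simp only [Real.norm_eq_abs] at this
  calc |f u - f 1 - deriv f 1 * (u - 1)| = |f u - deriv f 1 * u - (f 1 - deriv f 1 * 1)| := by
        congr 1; ring
    _ ≤ C * |u - 1| * |u - 1| := this
    _ = C * (u - 1) ^ 2 := by rw [mul_assoc, abs_mul_abs_self, sq]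

/-! ### Reduction of the sample statistics to the centered sums -/

/-- `C` and `η` depend neither on the dimension nor on the law nor on the sample, so the bound can
be used along the whole sequence. The sign of `c` is tied to the slope because only the product over
the two samples has to be positive. -/
lemma Stat.exists_reduction (R : Stat) {n : ℕ} (hn : 3 ≤ n) {f : ℝ → ℝ} (hf : IsKernelProfile f)
    (hf1 : deriv f 1 ≠ 0) : ∃ C η : ℝ, 0 ≤ C ∧ 0 < η ∧
      ∀ {d : ℕ} (_ : 0 < d) {Q : Measure (Vec d)} (_ : 0 < tauSq Q) {x : Fin n → Vec d} {ε : ℝ}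
        (_ : 0 ≤ ε) (_ : ε ≤ η) (_ : ∀ s t, s ≠ t → |relDev Q (x s, x t)| ≤ ε),
        ∃ a : Pairs n → ℝ,
          (∀ p : Pairs n, |a p - centeredSum R.kernel Q (x p.1.1) (x p.1.2)| ≤
            tauSq Q / √(d : ℝ) * (C * ε ^ 2)) ∧
          ∃ c, 0 < c * R.slope f ∧ ∀ s t,
            uCenter (R.mat f x) s t = c * uCenter (symMat a) s t := by
  cases R
  · refine ⟨1 + 48 * 0 / |1|, 1 / 2, by norm_num, by norm_num,
      fun {d} hd {Q} hτ {x ε} h0 hε hL => ?_⟩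
    have hτ0 : 0 < √(tauSq Q) := Real.sqrt_pos.2 hτ
    -- Plain distances are the identity profile with deterministic bandwidth `τ`, up to the overall
    -- factor `τ`; the Taylor remainder of the profile is zero.
    obtain ⟨a, ha, c, hc, h⟩ := exists_expansion hn hd hτ (F := id) (D := 1) (C := 0) (η := 4 * ε)
      (γ := √(tauSq Q)) one_ne_zero (fun u _ => by simp) le_rfl hε le_rfl
      (by rw [div_self hτ0.ne', sub_self, abs_zero]; exact h0) hL
    refine ⟨a, ha, √(tauSq Q) * c, ?_, fun s t => ?_⟩
    · simp only [Stat.slope, mul_one] at hc ⊢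
      exact mul_pos hτ0 hc
    · rw [mul_assoc, ← h s t, ← uCenter_const_mul]
      refine congrFun₂ (uCenter_congr fun s t _ => ?_) s t
      simp only [Stat.mat, id]
      field_simp
  · obtain ⟨C, η, hC, hη, hF⟩ := exists_quadratic_remainder hf.2
    refine ⟨1 + 48 * C / |deriv f 1|, min (1 / 2) (η / 4), by positivity, by positivity,
      fun {d} hd {Q} hτ {x ε} h0 hε hL => ?_⟩
    rw [le_min_iff] at hε
    exact exists_expansion hn hd hτ (F := f) (D := deriv f 1) (C := C) (η := η)
      hf1 hF hC hε.1 (by linarith [hε.2])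
      (abs_bandwidth_div_sub_one_le (by omega) hτ hL) hL
  -- For `mdCov` the matrix already is a sum of univariate kernels: no expansion and no error.
  · refine ⟨0, 1, le_rfl, one_pos, fun {d} hd {Q} hτ {x ε} h0 hε hL => ?_⟩
    obtain ⟨H, hH⟩ := exists_sum_kernel_eq (k := Stat.mdCov.kernel) (fun x y => abs_sub_comm x y)
      hd Q
    have hsymm : ∀ s t, centeredSum Stat.mdCov.kernel Q (x s) (x t) =
        centeredSum Stat.mdCov.kernel Q (x t) (x s) := fun s t => by
      have h1 := hH (x s) (x t)
      have h2 := hH (x t) (x s)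
      have h3 : ∑ i, Stat.mdCov.kernel (x s i) (x t i) = ∑ i, Stat.mdCov.kernel (x t i) (x s i) :=
        Finset.sum_congr rfl fun i _ => abs_sub_comm _ _
      have h4 : √(d : ℝ) ≠ 0 := (Real.sqrt_pos.2 (by exact_mod_cast hd)).ne'
      exact mul_left_cancel₀ h4 (by linarith)
    refine ⟨fun p => centeredSum Stat.mdCov.kernel Q (x p.1.1) (x p.1.2), fun p => by simp,
      √(d : ℝ), ?_, fun s t => ?_⟩
    · simp only [Stat.slope, mul_one]
      exact Real.sqrt_pos.2 (by exact_mod_cast hd)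
    · refine uCenter_of_eq_mul_add hn (h := fun s => H (x s)) (fun s t hst => ?_) s t
      rw [symMat_restrict hsymm hst]
      exact hH (x s) (x t)

/-! ### Bounds for the mean squared distance -/

lemma integral_sub_sq_prod {S : Type*} [MeasurableSpace S] {Q : Measure S} [IsProbabilityMeasure Q]
    {u : S → ℝ} (hu : MemLp u 2 Q) :
    Integrable (fun z : S × S => (u z.1 - u z.2) ^ 2) (Q.prod Q) ∧
      ∫ z, (u z.1 - u z.2) ^ 2 ∂(Q.prod Q) = 2 * Var[u; Q] := by
  have h1 : Integrable (fun z : S × S => u z.1 ^ 2) (Q.prod Q) := hu.integrable_sq.comp_fst Q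
  have h2 : Integrable (fun z : S × S => u z.2 ^ 2) (Q.prod Q) := hu.integrable_sq.comp_snd Q
  have hi := hu.integrable one_le_two
  have h3 : Integrable (fun z : S × S => u z.1 * u z.2) (Q.prod Q) := hi.mul_prod hi
  have h12 : Integrable (fun z : S × S => u z.1 ^ 2 + u z.2 ^ 2) (Q.prod Q) := h1.add h2
  have h4 : Integrable (fun z : S × S => 2 * (u z.1 * u z.2)) (Q.prod Q) := h3.const_mul 2
  have e : ∀ z : S × S, (u z.1 - u z.2) ^ 2 = u z.1 ^ 2 + u z.2 ^ 2 - 2 * (u z.1 * u z.2) :=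
    fun z => by ring
  simp only [e]
  refine ⟨h12.sub h4, ?_⟩
  rw [integral_sub h12 h4, integral_add h1 h2, integral_const_mul, integral_prod_mul u u,
    integral_fun_fst (fun x => u x ^ 2), integral_fun_snd (fun x => u x ^ 2), variance_eq_sub hu]
  simp only [probReal_univ, one_smul, Pi.pow_apply]
  ring

lemma tauSq_eq {d : ℕ} {Q : Measure (Vec d)} [IsProbabilityMeasure Q]
    (h : ∀ j : Fin d, MemLp (fun x => x j) 2 Q) :
    tauSq Q = ∑ j, 2 * Var[fun x => x j; Q] := by
  simp only [tauSq, norm_sub_sq_eq_sum, sq_abs]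
  rw [integral_finsetSum _ fun j _ => (integral_sub_sq_prod (h j)).1]
  exact Finset.sum_congr rfl fun j _ => (integral_sub_sq_prod (h j)).2

lemma tauSq_pos {d : ℕ} (hd : 0 < d) {Q : Measure (Vec d)} [IsProbabilityMeasure Q] {a : ℝ}
    (ha : 0 < a) (h : ∀ j : Fin d, MemLp (fun x => x j) 2 Q)
    (h1 : ∀ j : Fin d, a ≤ Var[fun x => x j; Q]) : 0 < tauSq Q := by
  rw [tauSq_eq h]
  have : Nonempty (Fin d) := ⟨⟨0, hd⟩⟩
  exact Finset.sum_pos (fun j _ => by linarith [h1 j]) Finset.univ_nonempty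

lemma tauSq_le {d : ℕ} {Q : Measure (Vec d)} [IsProbabilityMeasure Q] {b : ℝ}
    (h : ∀ j : Fin d, MemLp (fun x => x j) 2 Q)
    (h1 : ∀ j : Fin d, ∫ x, x j ^ 2 ∂Q ≤ b) : tauSq Q ≤ d * (2 * b) := by
  rw [tauSq_eq h]
  calc ∑ j, 2 * Var[fun x => x j; Q] ≤ ∑ _j : Fin d, 2 * b :=
        Finset.sum_le_sum fun j _ => by
          have : Var[fun x => x j; Q] ≤ ∫ x, x j ^ 2 ∂Q :=
            variance_le_expectation_sq (h j).aestronglyMeasurable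
          linarith [h1 j]
    _ = _ := by simp

/-- The error of the expansion is negligible. -/
lemma tendsto_tauSq_mul_sq {ι : Type*} {l : Filter ι} {d : ι → ℕ} (hd : Tendsto d l atTop)
    {T a : ι → ℝ} {b : ℝ} (hT0 : ∀ i, 0 ≤ T i) (hT : ∀ i, T i ≤ d i * b)
    (ha : Tendsto (fun i => T i * a i ^ 3) l (𝓝 0)) :
    Tendsto (fun i => T i / √(d i : ℝ) * a i ^ 2) l (𝓝 0) := by
  have h0 : ∀ i, 0 ≤ T i / √(d i : ℝ) * a i ^ 2 := fun i => by have := hT0 i; positivity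
  -- The cube equals `T / d^{3/2}` times `(T a³)²`; the first factor is bounded because `T = O(d)`,
  -- the second tends to zero.
  have h3 : Tendsto (fun i => (T i / √(d i : ℝ) * a i ^ 2) ^ 3) l (𝓝 0) := by
    have hlim : Tendsto (fun i => b * (T i * a i ^ 3) ^ 2) l (𝓝 0) := by
      simpa using (ha.pow 2).const_mul b
    refine squeeze_zero' (.of_forall fun i => by have := h0 i; positivity) ?_ hlim
    filter_upwards [hd.eventually_ge_atTop 1] with i hi
    have hd1 : (1 : ℝ) ≤ d i := by exact_mod_cast hi
    have hr : 1 ≤ √(d i : ℝ) := Real.one_le_sqrt.2 hd1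
    have hr2 : √(d i : ℝ) ^ 2 = d i := Real.sq_sqrt (by linarith)
    set r := √(d i : ℝ)
    have hb : 0 ≤ b := by
      have := (hT0 i).trans (hT i)
      exact nonneg_of_mul_nonneg_right this (by linarith)
    have e : (T i / r * a i ^ 2) ^ 3 = T i / r ^ 3 * (T i * a i ^ 3) ^ 2 := by field_simp
    rw [e]
    refine mul_le_mul_of_nonneg_right ?_ (sq_nonneg _)
    rw [div_le_iff₀ (by positivity)]
    calc T i ≤ d i * b := hT i
      _ = b * r ^ 2 * 1 := by rw [hr2]; ring
      _ ≤ b * r ^ 2 * r := by gcongr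
      _ = b * r ^ 3 := by ring
  rw [Metric.tendsto_nhds]
  intro δ hδ
  filter_upwards [h3.eventually_lt_const (show 0 < δ ^ 3 by positivity)] with i hi
  rw [Real.dist_0_eq_abs, abs_of_nonneg (h0 i)]
  exact lt_of_pow_lt_pow_left₀ 3 hδ.le hi

/-! ### Reduction in probability -/

lemma measurable_relDev {d : ℕ} (Q : Measure (Vec d)) : Measurable (relDev Q) := by
  unfold relDev; fun_prop

/-- With probability tending to one, the `U`-centered sample matrix is proportional to the
`U`-centered matrix of a small perturbation of the centered sums. -/
lemma Stat.tendsto_reduction (R : Stat) {n : ℕ} (hn : 3 ≤ n) {f : ℝ → ℝ} (hf : IsKernelProfile f)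
    (hf1 : deriv f 1 ≠ 0) {ι : Type*} {l : Filter ι} {d : ι → ℕ} (hd : Tendsto d l atTop)
    {Q : ∀ i, Measure (Vec (d i))} [∀ i, IsProbabilityMeasure (Q i)]
    {v w : ℝ} (hv : 0 < v) (hQ : ∀ i (j : Fin (d i)), MemLp (fun x => x j) 2 (Q i) ∧
      v ≤ Var[fun x => x j; Q i] ∧ ∫ x, x j ^ 2 ∂(Q i) ≤ w)
    {Ω : ι → Type*} [∀ i, MeasurableSpace (Ω i)] {Pr : ∀ i, Measure (Ω i)}
    [∀ i, IsProbabilityMeasure (Pr i)] {X : ∀ i, Fin n → Ω i → Vec (d i)}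
    (hX : ∀ i s, HasLaw (X i s) (Q i) (Pr i)) (hi : ∀ i, iIndepFun (X i) (Pr i)) {a : ι → ℝ}
    (hO : IsBigOInProb l (fun i => (Q i).prod (Q i)) (fun i => relDev (Q i)) a)
    (ha : Tendsto a l (𝓝 0)) (ha3 : Tendsto (fun i => tauSq (Q i) * a i ^ 3) l (𝓝 0))
    {δ : ℝ} (hδ : 0 < δ) :
    Tendsto (fun i => Pr i {ω | ¬ ∃ c : Pairs n → ℝ,
      dist c (fun st => centeredSum R.kernel (Q i) (X i st.1.1 ω) (X i st.1.2 ω)) < δ ∧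
      ∃ r, 0 < r * R.slope f ∧ ∀ s t,
        uCenter (R.mat f fun s => X i s ω) s t = r * uCenter (symMat c) s t}) l (𝓝 0) := by
  obtain ⟨C, η, hC, hη, hred⟩ := R.exists_reduction hn hf hf1
  rw [ENNReal.tendsto_nhds_zero]
  intro ε hε
  let I : Finset (Fin n × Fin n) := Finset.univ.offDiag
  have hI : (0 : ℝ) < I.card + 1 := by positivity
  obtain ⟨e, he0, heε⟩ : ∃ e : ℝ, 0 < e ∧ ENNReal.ofReal e ≤ ε := by
    rcases eq_or_ne ε ⊤ with rfl | h
    · exact ⟨1, one_pos, le_top⟩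
    · exact ⟨ε.toReal, ENNReal.toReal_pos hε.ne' h, ENNReal.ofReal_toReal_le⟩
  -- The error probability is shared among the ordered pairs; `+ 1` keeps the denominator positive.
  obtain ⟨M, hM⟩ := hO (e / (I.card + 1)) (by positivity)
  have hT := tendsto_tauSq_mul_sq hd (T := fun i => tauSq (Q i))
    (fun i => integral_nonneg fun _ => by positivity)
    (fun i => tauSq_le (fun j => (hQ i j).1) fun j => (hQ i j).2.2) ha3
  have hT' : Tendsto (fun i => tauSq (Q i) / √(d i : ℝ) * (C * (|M| * |a i|) ^ 2)) l (𝓝 0) := by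
    have := hT.const_mul (C * M ^ 2)
    rw [mul_zero] at this
    refine this.congr fun i => ?_
    rw [mul_pow, sq_abs, sq_abs]; ring
  have ha' : Tendsto (fun i => |M| * |a i|) l (𝓝 0) := by
    simpa using ha.abs.const_mul |M|
  filter_upwards [hM, hT'.eventually_lt_const hδ, ha'.eventually_le_const hη,
    hd.eventually_gt_atTop 0] with i h1 h2 h3 h4
  have hτ := tauSq_pos h4 hv (fun j => (hQ i j).1) fun j => (hQ i j).2.1
  -- `|M|` replaces `M`, which might be negative, so that the bound is an admissible `ε`.
  let B : Fin n × Fin n → Set (Ω i) := fun st =>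
    {ω | |M| * |a i| < |relDev (Q i) (X i st.1 ω, X i st.2 ω)|}
  have hB : ∀ st ∈ I, Pr i (B st) ≤ ENNReal.ofReal (e / (I.card + 1)) := fun st hst => by
    have hne : st.1 ≠ st.2 := by simpa [I] using hst
    have hl := hasLaw_pair (hX i) (hi i) hne
    have hms : MeasurableSet {z | |M| * |a i| < |relDev (Q i) z|} :=
      measurableSet_lt measurable_const (measurable_relDev _).norm
    have h5 : Pr i (B st) = ((Q i).prod (Q i)) {z | |M| * |a i| < |relDev (Q i) z|} := by
      rw [← hl.map_eq, Measure.map_apply_of_aemeasurable hl.aemeasurable hms]; rfl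
    have h6 : {z | |M| * |a i| < |relDev (Q i) z|} ⊆ {z | M * |a i| < |relDev (Q i) z|} :=
      fun z hz => (mul_le_mul_of_nonneg_right (le_abs_self M) (abs_nonneg _)).trans_lt hz
    rw [h5]
    refine (measure_mono h6).trans ?_
    rw [ENNReal.le_ofReal_iff_toReal_le (measure_ne_top _ _) (by positivity)]
    exact h1
  have hsub : {ω | ¬ ∃ c : Pairs n → ℝ,
      dist c (fun st => centeredSum R.kernel (Q i) (X i st.1.1 ω) (X i st.1.2 ω)) < δ ∧
      ∃ r, 0 < r * R.slope f ∧ ∀ s t,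
        uCenter (R.mat f fun s => X i s ω) s t = r * uCenter (symMat c) s t} ⊆
      ⋃ st ∈ I, B st := fun ω hω => by
    by_contra hcon
    refine hω ?_
    have hL : ∀ s t, s ≠ t → |relDev (Q i) (X i s ω, X i t ω)| ≤ |M| * |a i| := fun s t hst => by
      by_contra hlt
      exact hcon (mem_iUnion₂.2 ⟨(s, t), by simpa [I] using hst, not_le.1 hlt⟩)
    obtain ⟨c, hc, hr⟩ := hred h4 hτ (x := fun s => X i s ω) (by positivity) h3 hL
    refine ⟨c, ?_, hr⟩
    rw [dist_pi_lt_iff hδ]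
    exact fun st => (Real.dist_eq _ _).trans_lt ((hc st).trans_lt h2)
  calc _ ≤ Pr i (⋃ st ∈ I, B st) := measure_mono hsub
    _ ≤ ∑ st ∈ I, Pr i (B st) := measure_biUnion_finset_le _ _
    _ ≤ ∑ _st ∈ I, ENNReal.ofReal (e / (I.card + 1)) := Finset.sum_le_sum hB
    _ = ENNReal.ofReal (I.card * (e / (I.card + 1))) := by
      rw [Finset.sum_const, nsmul_eq_mul, ENNReal.ofReal_mul (by positivity), ENNReal.ofReal_natCast]
    _ ≤ ENNReal.ofReal e := by
      refine ENNReal.ofReal_le_ofReal ?_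
      rw [mul_div_assoc', div_le_iff₀ hI]
      nlinarith
    _ ≤ ε := heε

/-! ### The limit of the test statistics -/

section Statistic

variable {ι : Type*} {p q : ι → ℕ} {P : ∀ i, Measure (Vec (p i) × Vec (q i))}

lemma MomentBounds.fst (D1 : MomentBounds P) : ∃ v w : ℝ, 0 < v ∧ ∀ i (j : Fin (p i)),
    MemLp (fun x => x j) 2 (P i).fst ∧ v ≤ Var[fun x => x j; (P i).fst] ∧
      ∫ x, x j ^ 2 ∂(P i).fst ≤ w := by
  obtain ⟨⟨v, w, hv, h⟩, -⟩ := D1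
  refine ⟨v, w, hv, fun i j => ?_⟩
  have hm : Measurable fun x : Vec (p i) => x j := by fun_prop
  rw [Measure.fst, memLp_map_measure_iff hm.aestronglyMeasurable measurable_fst.aemeasurable,
    variance_map hm.aemeasurable measurable_fst.aemeasurable,
    integral_map measurable_fst.aemeasurable (hm.pow_const 2).aestronglyMeasurable]
  exact h i j

lemma MomentBounds.snd (D1 : MomentBounds P) : ∃ v w : ℝ, 0 < v ∧ ∀ i (j : Fin (q i)),
    MemLp (fun x => x j) 2 (P i).snd ∧ v ≤ Var[fun x => x j; (P i).snd] ∧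
      ∫ x, x j ^ 2 ∂(P i).snd ≤ w := by
  obtain ⟨-, v, w, hv, h⟩ := D1
  refine ⟨v, w, hv, fun i j => ?_⟩
  have hm : Measurable fun x : Vec (q i) => x j := by fun_prop
  rw [Measure.snd, memLp_map_measure_iff hm.aestronglyMeasurable measurable_snd.aemeasurable,
    variance_map hm.aemeasurable measurable_snd.aemeasurable,
    integral_map measurable_snd.aemeasurable (hm.pow_const 2).aestronglyMeasurable]
  exact h i j

lemma Stat.slope_mul_pos (R : Stat) {f g : ℝ → ℝ} (hfg : 0 < deriv f 1 * deriv g 1) :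
    0 < R.slope f * R.slope g := by
  cases R <;> simp [Stat.slope, hfg]

/-- Convergence of the probabilities of events of the test statistic to those of its counterpart
for the Gaussian limit. -/
lemma tendsto_measureReal_studentized {l : Filter ι} {n : ℕ} (hn : 4 ≤ n)
    (hp : Tendsto p l atTop) (hq : Tendsto q l atTop) [∀ i, IsProbabilityMeasure (P i)]
    {Ω : ι → Type*} [∀ i, MeasurableSpace (Ω i)] {Pr : ∀ i, Measure (Ω i)}
    [∀ i, IsProbabilityMeasure (Pr i)]
    {X : ∀ i, Fin n → Ω i → Vec (p i)} {Y : ∀ i, Fin n → Ω i → Vec (q i)}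
    (hlaw : ∀ i s, HasLaw (fun ω => (X i s ω, Y i s ω)) (P i) (Pr i))
    (hindep : ∀ i, iIndepFun (fun s ω => (X i s ω, Y i s ω)) (Pr i))
    {f g : ℝ → ℝ} (hf : IsKernelProfile f) (hg : IsKernelProfile g)
    (hfg : 0 < deriv f 1 * deriv g 1) {R : Stat} (D1 : MomentBounds P)
    (D2 : DistanceConcentration l P) {G : Measure ((Pairs n → ℝ) × (Pairs n → ℝ))}
    [IsProbabilityMeasure G]
    (hG : TendstoInDistribution
        (fun i ω =>
          ((fun st => centeredSum R.kernel (P i).fst (X i st.1.1 ω) (X i st.1.2 ω),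
            fun uv => centeredSum R.kernel (P i).snd (Y i uv.1.1 ω) (Y i uv.1.2 ω)) :
            (Pairs n → ℝ) × (Pairs n → ℝ))) l id Pr G)
    {S : Set ℝ} (hS : G (frontier {z | pairStat z ∈ S}) = 0) :
    Tendsto (fun i => (Pr i).real
        {ω | R.studentized f g (fun s => X i s ω) (fun s => Y i s ω) ∈ S}) l
      (𝓝 (G.real {z | pairStat z ∈ S})) := by
  obtain ⟨a, b, hOa, hOb, ha, hb, ha3, hb3, -⟩ := D2
  obtain ⟨v, w, hv, hx⟩ := D1.fst
  obtain ⟨v', w', hv', hy⟩ := D1.snd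
  refine tendsto_measureReal_of_perturbation hG hS fun δ hδ => ?_
  have hX : ∀ i s, HasLaw (X i s) (P i).fst (Pr i) := fun i s =>
    HasLaw.comp (Y := Prod.fst) ⟨measurable_fst.aemeasurable, rfl⟩ (hlaw i s)
  have hY : ∀ i s, HasLaw (Y i s) (P i).snd (Pr i) := fun i s =>
    HasLaw.comp (Y := Prod.snd) ⟨measurable_snd.aemeasurable, rfl⟩ (hlaw i s)
  have hX' : ∀ i, iIndepFun (X i) (Pr i) := fun i =>
    (hindep i).comp (fun _ => Prod.fst) fun _ => measurable_fst
  have hY' : ∀ i, iIndepFun (Y i) (Pr i) := fun i =>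
    (hindep i).comp (fun _ => Prod.snd) fun _ => measurable_snd
  have h1 := R.tendsto_reduction (by omega) hf (left_ne_zero_of_mul hfg.ne') hp hv hx hX hX'
    hOa ha ha3 hδ
  have h2 := R.tendsto_reduction (by omega) hg (right_ne_zero_of_mul hfg.ne') hq hv' hy hY hY'
    hOb hb hb3 hδ
  have h12 := h1.add h2
  rw [add_zero] at h12
  refine tendsto_of_tendsto_of_tendsto_of_le_of_le tendsto_const_nhds h12 (fun i => zero_le)
    fun i => ?_
  refine (measure_mono fun ω hω => ?_).trans (measure_union_le _ _)
  by_contra hcon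
  rw [mem_union, not_or] at hcon
  obtain ⟨c, hc, r, hr, hcr⟩ := not_not.1 hcon.1
  obtain ⟨d, hd, s, hs, hds⟩ := not_not.1 hcon.2
  refine hω ⟨(c, d), ?_, ?_⟩
  · rw [Prod.dist_eq]
    exact max_lt hc hd
  -- Both scale factors carry the signs of their slopes, and `f'(1) g'(1) > 0` makes the signs
  -- cancel.
  · have hrs : 0 < r * s := by
      refine pos_of_mul_pos_left ?_ (R.slope_mul_pos hfg).le
      calc 0 < r * R.slope f * (s * R.slope g) := mul_pos hr hs
        _ = _ := by ring
    rw [mem_ofPred_eq, mem_ofPred_eq, R.studentized_eq f g (by omega),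
      studentizedRatio_eq_pairStat hrs hcr hds]

end Statistic

end HighDimDependence

/-! ### The four claims. -/

theorem corollary1
    {ι : Type*} (l : Filter ι) [l.IsCountablyGenerated]
    (n : ℕ) (hn : 4 ≤ n)
    (p q : ι → ℕ) (hp : Tendsto p l atTop) (hq : Tendsto q l atTop)
    (P : ∀ i, Measure (Vec (p i) × Vec (q i))) [∀ i, IsProbabilityMeasure (P i)]
    {Ω : ι → Type*} [∀ i, MeasurableSpace (Ω i)]
    (Pr : ∀ i, Measure (Ω i)) [∀ i, IsProbabilityMeasure (Pr i)]
    (X : ∀ i, Fin n → Ω i → Vec (p i)) (Y : ∀ i, Fin n → Ω i → Vec (q i))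
    (hlaw : ∀ i s, HasLaw (fun ω => (X i s ω, Y i s ω)) (P i) (Pr i))
    (hindep : ∀ i, iIndepFun (fun s ω => (X i s ω, Y i s ω)) (Pr i))
    (f g : ℝ → ℝ) (hf : IsKernelProfile f) (hg : IsKernelProfile g)
    (hfg : 0 < deriv f 1 * deriv g 1)
    (R : Stat) (σx2 σy2 σxy2 φ : ℝ) (hσx : 0 < σx2) (hσy : 0 < σy2)
    (hφ : φ = σxy2 / √(σx2 * σy2))
    (D1 : MomentBounds P)
    (D2 : DistanceConcentration l P)
    (D3 : JointCLT l R.kernel P Pr X Y σx2 σy2 σxy2) :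
    -- the parameter `φ` is the limit of the ratio built from the squared covariances
    -- (`dCov`, `hCov`) or from the marginal distance covariances (`mdCov`)
    Tendsto (fun i => R.phiRatio (P i)) l (𝓝 φ) ∧
    -- the limit under the null hypothesis of independence
    ((∀ i, IndepFun Prod.fst Prod.snd (P i)) → ∀ t : ℝ,
      Tendsto (fun i => (Pr i).real
          {ω | R.studentized f g (fun s => X i s ω) (fun s => Y i s ω) ≤ t}) l
        (𝓝 ((studentT (dof n - 1)).real (Iic t)))) ∧
    -- the limit in general, in particular under the alternative
    (φ < 1 → ∀ t : ℝ,
      Tendsto (fun i => (Pr i).real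
          {ω | R.studentized f g (fun s => X i s ω) (fun s => Y i s ω) ≤ t}) l
        (𝓝 (mixedNoncentralTCdf (dof n) φ t))) ∧
    -- trivial power of the `dCov` and `hCov` tests when all components are uncorrelated
    (R ≠ Stat.mdCov →
      (∀ i (a : Fin (p i)) (b : Fin (q i)), cov[fun z => z.1 a, fun z => z.2 b; P i] = 0) →
      ∀ α : ℝ, 0 < α → α < 1 →
        Tendsto (fun i => (Pr i).real
            {ω | tQuantile (dof n - 1) α <
              R.studentized f g (fun s => X i s ω) (fun s => Y i s ω)}) l (𝓝 α)) := by
  -- Along the trivial filter every limit statement holds; otherwise limits are unique and preserve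
  -- inequalities.
  rcases l.eq_or_neBot with rfl | hl
  · simp
  have hlim := D3.tendsto_phiRatio hlaw hindep D1 hn hp hq hσx hσy
  rw [← hφ] at hlim
  have hφ0 : 0 ≤ φ := ge_of_tendsto' hlim fun i => D1.phiRatio_nonneg R i
  obtain ⟨G, hG, hx0, hy0, hx, hy, hxy, hT⟩ := D3.exists_gaussian hlaw hindep D1 hn
  have hstat : φ < 1 → ∀ t : ℝ, G (frontier {z | pairStat z ≤ t}) = 0 ∧
      G.real {z | pairStat z ≤ t} = mixedNoncentralTCdf (dof n) φ t := fun hφ1 t =>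
    gaussian_pairStat_le hn hσx hσy hφ hφ0 hφ1 hx0 hy0 hx hy hxy t
  have hconv : φ < 1 → ∀ t : ℝ, Tendsto (fun i => (Pr i).real
      {ω | R.studentized f g (fun s => X i s ω) (fun s => Y i s ω) ≤ t}) l
      (𝓝 (mixedNoncentralTCdf (dof n) φ t)) := fun hφ1 t => by
    rw [← (hstat hφ1 t).2]
    exact tendsto_measureReal_studentized hn hp hq hlaw hindep hf hg hfg D1 D2 hT (S := Iic t)
      (hstat hφ1 t).1
  -- Claims 2 and 4 are the case `φ = 0`: the numerator of the ratio vanishes identically, and the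
  -- mixture is Student's law.
  have hzero : (∀ i (a : Fin (p i)) (b : Fin (q i)),
      R.depend (P i) (fun z => z.1 a) (fun z => z.2 b) = 0) → φ = 0 := fun h => by
    refine tendsto_nhds_unique hlim (tendsto_const_nhds.congr fun i => ?_)
    simp only [Stat.phiRatio, h, Finset.sum_const_zero, zero_div]
  refine ⟨hlim, fun hind t => ?_, hconv, fun hR hcov α hα0 hα1 => ?_⟩
  · have h0 := hzero fun i a b => R.depend_eq_zero (by fun_prop) (by fun_prop)
      (D1.memLp_fst i a) (D1.memLp_snd i b)
      ((hind i).comp (φ := fun x : Vec (p i) => x a) (ψ := fun y : Vec (q i) => y b)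
        (by fun_prop) (by fun_prop))
    have := hconv (by rw [h0]; exact one_pos) t
    rwa [h0, mixedNoncentralTCdf_zero] at this
  · have h0 := hzero fun i a b => by
      cases R
      · simp only [Stat.depend, hcov, zero_pow two_ne_zero]
      · simp only [Stat.depend, hcov, zero_pow two_ne_zero]
      · exact absurd rfl hR
    obtain ⟨h1, h2⟩ := hstat (by rw [h0]; exact one_pos) (tQuantile (dof n - 1) α)
    -- The rejection region of the limit is the complement of a continuity set, hence a continuity
    -- set itself.
    have hcompl : {z : (Pairs n → ℝ) × (Pairs n → ℝ) | pairStat z ∈ Ioi (tQuantile (dof n - 1) α)} =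
        {z | pairStat z ≤ tQuantile (dof n - 1) α}ᶜ := by
      ext z; simp
    have h3 : G.real {z | pairStat z ∈ Ioi (tQuantile (dof n - 1) α)} = α := by
      rw [hcompl, probReal_compl_eq_one_sub (measurableSet_le (measurable_pairStat n) measurable_const),
        h2, h0, mixedNoncentralTCdf_zero,
        studentT_tQuantile (one_le_dof_sub_one hn) hα0 hα1, sub_sub_cancel]
    have h4 := tendsto_measureReal_studentized hn hp hq hlaw hindep hf hg hfg D1 D2 hT
      (S := Ioi (tQuantile (dof n - 1) α)) (by rw [hcompl, frontier_compl]; exact h1)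
    rwa [h3] at h4
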